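/- **Theorem (meromorphy in the space-time dimension of the amplitudes of the vulcanized $\phi^{\star 4}$ model).** Let $G$ be a connected $\phi^{\star 4}$ graph: a finite set $V$ of vertices, each with four cyclically ordered corners $1,2,3,4$, and a finite set of $L$ internal lines, each joining two corners, no corner being used twice; the $N$ unused corners are the external ones. For a line $\ell$ from the corner $i$ to the corner $j$ let $u_\ell=(x_j-x_i)/\sqrt2$ and $v_\ell=(x_j+x_i)/\sqrt2$ be its short and long variables, and let $\bar x_e=\sqrt2\,x_e$ be the rescaled external positions. For a constant $s>0$ let $A(t)+B$ be the real matrix indexed by all the variables $\bar x_e,u_\ell,v_\ell$ and the hypermomenta $p_v$ ($v\in V$), where $A$ is diagonal with entries $1/t_\ell$ on $u_\ell$, $t_\ell$ on $v_\ell$ and $0$ elsewhere, and $B=\begin{pmatrix} sE& C\\ -C^{t}&0\end{pmatrix}$ is antisymmetric, $E$ and $C$ being the integer matrices with $$X E Y^{t}=\sum_{v\in V}\sum_{i\ne j}(-1)^{i+j+1}\omega(i,j)\,X^v_iY^v_j,\qquad X C p^{t}=\sum_{v\in V}\sum_{i=1}^4(-1)^{i+1}X^v_i\,p_v ,$$ where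 $X_i^v$ is $\sqrt2$ times the position of the corner $i$ of $v$ expressed in the variables $\bar x_e,u_\ell,v_\ell$, and $\omega(i,j)=1$ if $i<j$, $-1$ if $i>j$. Fix a root vertex $\bar V$. The external variables are $x=((\bar x_e)_e,p_{\bar V})\in\mathbb R^{4(N+1)}$, and the others are internal. Write $A\otimes 1_4+B\otimes\sigma=\begin{pmatrix}M&P\\P^{t}&Q\end{pmatrix}$ in external and internal blocks, where $\sigma=\mathrm{diag}(\sigma_2,\sigma_2)$, $\sigma_2=\begin{pmatrix}0&-i\\ i&0\end{pmatrix}$, and put, for a constant $\Omega>0$, $$HU(t)=\det\big((A+B)_{\rm int}\big)\prod_\ell t_\ell,\qquad \frac{HV(t,x)}{HU(t)}=\frac{\Omega}{2}\;x\,\big(M-PQ^{-1}P^{t}\big)\,x^{t},$$ where $(A+B)_{\rm int}$ is the block of the internal variables, and $$\mathcal A_G(D;x)=K'(D)\int_{(0,1)^L}\prod_{\ell}dt_\ell\,(1-t_\ell^2)^{\frac D2-1}\;\frac{e^{-HV(t,x)/HU(t)}}{HU(t)^{D/2}} ,$$ where the normalization $K'$ is a constant or, more generally, an entire function of $D$.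 Then there is a set $S_G\subset\mathbb Q$, depending only on the graph $G$, which has finitely many points in every bounded interval and no point in $(0,2)$, such that for every root $\bar V$, all $s,\Omega>0$ and every $K'$ there is a family $(T_D)_{D\in\mathbb C}$ of tempered distributions on $\mathbb R^{4(N+1)}$ with the following properties. 1. If $0<\Re D<2$, then the integral over $t$ converges absolutely for every $x$, and $T_D$ is the distribution given by $\mathcal A_G(D;\cdot)$: for every Schwartz function $f$ the function $f\,\mathcal A_G(D;\cdot)$ is integrable and $T_D(f)=\int f(x)\,\mathcal A_G(D;x)\,dx$. 2. For every Schwartz function $f$ the function $D\mapsto T_D(f)$ is meromorphic in the whole complex plane and analytic at every $D\notin S_G$; in particular it has no singularity in the strip $0<\Re D<2$. -/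

import Mathlib

open MeasureTheory
open scoped Matrix Kronecker

noncomputable section

/-- A graph of the `φ⋆4` model with vertex set `V` and set of internal lines `L`.
The corner number `i` of the vertex `v`, in the cyclic order of the Moyal vertex, is
`(v, i) : V × Fin 4` (the corners `1,2,3,4` are numbered `0,1,2,3`).
The line `ℓ` exits the corner `src ℓ` and enters the corner `tgt ℓ`, and every corner carries
at most one half-line of an internal line.  The other corners carry the external positions. -/
structure Phi4Graph (V L : Type*) where
  src : L → V × Fin 4
  tgt : L → V × Fin 4
  injective : Function.Injective (Sum.elim src tgt)

namespace Phi4Graph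

/-- The simple graph on the vertices: `v` and `w` are adjacent if a line joins them. -/
def underlying {V L : Type*} (G : Phi4Graph V L) : SimpleGraph V :=
  SimpleGraph.fromRel fun v w => ∃ ℓ, (G.src ℓ).1 = v ∧ (G.tgt ℓ).1 = w

/-- The graph is connected. -/
def IsConnected {V L : Type*} (G : Phi4Graph V L) : Prop := G.underlying.Connected

/-- The external corners. -/
abbrev Ext {V L : Type*} (G : Phi4Graph V L) : Type _ :=
  {c : V × Fin 4 // ∀ ℓ, G.src ℓ ≠ c ∧ G.tgt ℓ ≠ c}

/-- The position variables: the external positions, then the short variables `u_ℓ`,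
then the long variables `v_ℓ`. -/
abbrev PosVar {V L : Type*} (G : Phi4Graph V L) : Type _ := G.Ext ⊕ (L ⊕ L)

/-- All the variables: the positions and one hypermomentum for each vertex. -/
abbrev Var {V L : Type*} (G : Phi4Graph V L) : Type _ := G.PosVar ⊕ V

/-- The external variables: the external positions and the hypermomentum of the root. -/
abbrev ExtVar {V L : Type*} (G : Phi4Graph V L) : Type _ := G.Ext ⊕ Unit

/-- The internal variables, those integrated over: the short and the long variables and the
hypermomenta of the vertices other than the root. -/
abbrev IntVar {V : Type*} (L : Type*) (root : V) : Type _ := (L ⊕ L) ⊕ {v : V // v ≠ root}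

/-- The incidence matrix `ε`: `1` if `ℓ` enters the corner `c`, `-1` if it exits at `c`. -/
def eps {V L : Type*} [DecidableEq V] (G : Phi4Graph V L) (ℓ : L) (c : V × Fin 4) : ℤ :=
  (if G.tgt ℓ = c then 1 else 0) - (if G.src ℓ = c then 1 else 0)

/-- The unsigned incidence matrix `η = |ε|`. -/
def eta {V L : Type*} [DecidableEq V] (G : Phi4Graph V L) (ℓ : L) (c : V × Fin 4) : ℤ :=
  |G.eps ℓ c|

/-- The coefficients of the position `x_c` of the corner `c` in the position variables:
`√2 x_c = ∑ τ, posCoeff c τ * X_τ`.  So `√2 x_c = v_ℓ + ε_{ℓ c} u_ℓ` if the line `ℓ` hooks to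
`c`, that is `u_ℓ = (x_{tgt ℓ} - x_{src ℓ}) / √2` and `v_ℓ = (x_{tgt ℓ} + x_{src ℓ}) / √2`, and
at an external corner `X_e = √2 x_e` is the rescaled external position. -/
def posCoeff {V L : Type*} [DecidableEq V] (G : Phi4Graph V L) (c : V × Fin 4) :
    G.PosVar → ℤ
  | Sum.inl e => if e.1 = c then 1 else 0
  | Sum.inr (Sum.inl ℓ) => G.eps ℓ c
  | Sum.inr (Sum.inr ℓ) => G.eta ℓ c

/-- `ω(i,j)` is `1` if `i < j`, `-1` if `j < i` and `0` if `i = j`. -/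
def omega (i j : Fin 4) : ℤ := if i < j then 1 else if j < i then -1 else 0

/-- The matrix of the oscillations
`∑_v ∑_{i,j} (-1)^{i+j+1} ω(i,j) (√2 x_i^v) σ (√2 x_j^v)` of the Moyal vertices. -/
def oscMatrix {V L : Type*} [Fintype V] [DecidableEq V] (G : Phi4Graph V L) :
    Matrix G.PosVar G.PosVar ℤ :=
  Matrix.of fun τ τ' => ∑ v, ∑ i : Fin 4, ∑ j : Fin 4,
    (-1) ^ ((i : ℕ) + (j : ℕ) + 1) * omega i j * G.posCoeff (v, i) τ * G.posCoeff (v, j) τ'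

/-- The coupling of the positions to the hypermomenta, from the representation of
`δ(x_1 - x_2 + x_3 - x_4)` at each vertex as the integral of
`exp (p_v σ (x_1 - x_2 + x_3 - x_4))` over `p_v`. -/
def hyperMatrix {V L : Type*} [DecidableEq V] (G : Phi4Graph V L) : Matrix G.PosVar V ℤ :=
  Matrix.of fun τ v => ∑ i : Fin 4, (-1) ^ (i : ℕ) * G.posCoeff (v, i) τ

/-- The propagator part of the quadratic form: `1 / t_ℓ` on the short variable of the line `ℓ`,
`t_ℓ` on its long variable, and `0` on all the other variables. -/
def propMatrix {V L : Type*} [DecidableEq V] [DecidableEq L] (G : Phi4Graph V L) (t : L → ℝ) :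
    Matrix G.Var G.Var ℝ :=
  Matrix.diagonal
    (Sum.elim (Sum.elim (fun _ => 0) (Sum.elim (fun ℓ => 1 / t ℓ) t)) (fun _ => 0))

/-- The antisymmetric oscillating part `(s E, C; -Cᵗ, 0)` of the quadratic form.  The constant
`s` is the inverse of the product of the parameters `θ` and `Ω`, up to a numerical factor, and
the hypermomenta are measured in units that remove the parameters from `C`. -/
def oscPart {V L : Type*} [Fintype V] [DecidableEq V] (G : Phi4Graph V L) (s : ℝ) :
    Matrix G.Var G.Var ℝ :=
  Matrix.fromBlocks (s • G.oscMatrix.map (Int.cast : ℤ → ℝ))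
    (G.hyperMatrix.map (Int.cast : ℤ → ℝ)) (-(G.hyperMatrix.map (Int.cast : ℤ → ℝ))ᵀ) 0

/-- The inclusion of the external variables. -/
def extVar {V L : Type*} (G : Phi4Graph V L) (root : V) : G.ExtVar → G.Var :=
  Sum.elim (fun e => Sum.inl (Sum.inl e)) (fun _ => Sum.inr root)

/-- The inclusion of the internal variables. -/
def intVar {V L : Type*} (G : Phi4Graph V L) (root : V) : IntVar L root → G.Var :=
  Sum.elim (fun a => Sum.inl (Sum.inr a)) (fun v => Sum.inr v.1)

/-- The `4 × 4` matrix `σ`, two diagonal blocks `(0, -i; i, 0)`. -/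
def sigma4 : Matrix (Fin 4) (Fin 4) ℂ :=
  !![0, -Complex.I, 0, 0; Complex.I, 0, 0, 0; 0, 0, 0, -Complex.I; 0, 0, Complex.I, 0]

/-- The full quadratic form `A ⊗ 1 + B ⊗ σ` in all the variables, each of them in `ℝ⁴`.  The
product of the propagators and of the vertices is `exp (- (Ω / 2) X (A ⊗ 1 + B ⊗ σ) Xᵗ)`. -/
def quadForm {V L : Type*} [Fintype V] [DecidableEq V] [DecidableEq L]
    (G : Phi4Graph V L) (s : ℝ) (t : L → ℝ) : Matrix (G.Var × Fin 4) (G.Var × Fin 4) ℂ :=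
  (G.propMatrix t).map Complex.ofReal ⊗ₖ (1 : Matrix (Fin 4) (Fin 4) ℂ) +
    (G.oscPart s).map Complex.ofReal ⊗ₖ sigma4

/-- The external block `M` of the quadratic form. -/
def blockM {V L : Type*} [Fintype V] [DecidableEq V] [DecidableEq L]
    (G : Phi4Graph V L) (root : V) (s : ℝ) (t : L → ℝ) :
    Matrix (G.ExtVar × Fin 4) (G.ExtVar × Fin 4) ℂ :=
  (G.quadForm s t).submatrix (Prod.map (G.extVar root) id) (Prod.map (G.extVar root) id)

/-- The block `P` of the quadratic form, coupling the external to the internal variables. -/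
def blockP {V L : Type*} [Fintype V] [DecidableEq V] [DecidableEq L]
    (G : Phi4Graph V L) (root : V) (s : ℝ) (t : L → ℝ) :
    Matrix (G.ExtVar × Fin 4) (IntVar L root × Fin 4) ℂ :=
  (G.quadForm s t).submatrix (Prod.map (G.extVar root) id) (Prod.map (G.intVar root) id)

/-- The internal block `Q` of the quadratic form. -/
def blockQ {V L : Type*} [Fintype V] [DecidableEq V] [DecidableEq L]
    (G : Phi4Graph V L) (root : V) (s : ℝ) (t : L → ℝ) :
    Matrix (IntVar L root × Fin 4) (IntVar L root × Fin 4) ℂ :=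
  (G.quadForm s t).submatrix (Prod.map (G.intVar root) id) (Prod.map (G.intVar root) id)

/-- The first hyperbolic polynomial `HU(t) = det (A + B) ∏ t_ℓ`, the determinant being restricted
to the internal variables, so that `det Q = (det (A + B))⁴`. -/
def HU {V L : Type*} [Fintype V] [DecidableEq V] [Fintype L] [DecidableEq L]
    (G : Phi4Graph V L) (root : V) (s : ℝ) (t : L → ℝ) : ℝ :=
  ((G.propMatrix t + G.oscPart s).submatrix (G.intVar root) (G.intVar root)).det * ∏ ℓ, t ℓ

/-- The space of the external variables: one vector of `ℝ⁴` for each external corner, and the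
hypermomentum of the root. -/
abbrev ExtSpace {V L : Type*} (G : Phi4Graph V L) : Type _ :=
  EuclideanSpace ℝ (G.ExtVar × Fin 4)

/-- The second hyperbolic polynomial, a quadratic form in the external variables `x`:
`HV / HU = (Ω / 2) x (M - P Q⁻¹ Pᵗ) xᵗ`, the result of the Gaussian integration over the
internal variables. -/
def HV {V L : Type*} [Fintype V] [DecidableEq V] [Fintype L] [DecidableEq L]
    (G : Phi4Graph V L) (root : V) (s Ω : ℝ) (t : L → ℝ) (x : G.ExtSpace) : ℂ :=
  (G.HU root s t : ℂ) * ((Ω : ℂ) / 2 * ((fun a => (x a : ℂ)) ⬝ᵥ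
    ((G.blockM root s t - G.blockP root s t * (G.blockQ root s t)⁻¹ * (G.blockP root s t)ᵀ) *ᵥ
      (fun a => (x a : ℂ)))))

/-- The integrand of the parametric representation, in dimension `D`. -/
def integrand {V L : Type*} [Fintype V] [DecidableEq V] [Fintype L] [DecidableEq L]
    (G : Phi4Graph V L) (root : V) (s Ω : ℝ) (D : ℂ) (x : G.ExtSpace) (t : L → ℝ) : ℂ :=
  (∏ ℓ, ((1 - t ℓ ^ 2 : ℝ) : ℂ) ^ (D / 2 - 1)) *
    Complex.exp (-(G.HV root s Ω t x / (G.HU root s t : ℂ))) / (G.HU root s t : ℂ) ^ (D / 2)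

/-- The domain `]0,1[^L` of the parameters `t_ℓ = tanh (α_ℓ / 2)`. -/
def cube (L : Type*) : Set (L → ℝ) := Set.univ.pi fun _ => Set.Ioo 0 1

/-- The amplitude, as a function of the external variables, with normalization `K D`. -/
def amplitude {V L : Type*} [Fintype V] [DecidableEq V] [Fintype L] [DecidableEq L]
    (G : Phi4Graph V L) (root : V) (s Ω : ℝ) (K : ℂ → ℂ) (D : ℂ) (x : G.ExtSpace) : ℂ :=
  K D * ∫ t in cube L, G.integrand root s Ω D x t

end Phi4Graph

end

/-! The amplitude is first paired with a Schwartz function, and the resulting integral over the cube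
is continued in `D` by a resolution of the boundary into sectors.

Write `Z(t)` for the real Schur complement of `A + B`. On the two eigenspaces of `σ` the matrix `A ⊗
1 + B ⊗ σ` acts as `A + B` and as its transpose, so `HV / HU` is the form of `tw Z Zᵀ`
(`Phi4Graph.schur_eq`). Since `A ≥ 0` and `B` is skew, the form of `Z` is nonnegative and the
exponential is bounded by 1. But `Z` may blow up at the boundary of the cube, so the exponential is
not smooth there in any obvious sense. The cure is to expand the test function `f` in Gaussian wave
packets by means of its short time Fourier transform (`CoherentDecomposition.integral_eq`). Against
a packet the exponential integrates to a constant times `det (1 + Z)⁻²` times the exponential of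
minus a quadratic phase whose coefficients are entries of `(1 + Z)⁻¹` (`Twisted.integral_gaussian`),
and these stay bounded. The real part of the phase is nonnegative (`Twisted.admissible_inv`), and
the transform of `f` decays rapidly enough to pay for all the polynomials that derivatives of the
phase produce.

All the functions of `t` are now polynomials or their quotients: `HU = U`, `det (1 + Z) = P / U` and
`(1 + Z)⁻¹ = N / P`. Expanding determinants along the diagonal part shows that the coefficients of
`U` are minors of a skew matrix, hence nonnegative, and that coefficientwise `U ≤ P` and `|N| ≤ P`
(`RowMinor.intCoeff_le_fullCoeff`, `RowMinor.abs_entryCoeff_le`). Connectedness of the graph gives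
`U` a nonzero monomial of degree at most 1 in each `t_ℓ` (`Phi4Graph.exists_coeffU_ne_zero`), whence
`U ≥ c ∏ t_ℓ`.

Put `t = 1 / (1 + exp y)` and cut `ℝ^L` into simplicial cones with integer generators on which every
linear form with coefficients in `[-2, 2]` has constant sign (`SectorIntegral.exists_cones`). On
such a cone each of `U` and `P` has a monomial that divides all its others
(`SectorIntegral.exists_minimal`), so that in the cone coordinates `η`, with `z = exp (-η / 2)`, the
integrand is `exp (-∑ s_j η_j)` times a smooth function of `z`, where `s_j = (A_j D + b_j) / 2` with
integers `A_j`, `b_j`. The exponents have positive real part for `0 < Re D < 2`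
(`ParametricData.strip_subset_domain`).

Integration by parts in `η_i` expresses `s_i` times the integral by integrals of the same kind in
which `s_i` is either replaced by 1 or raised by 1/2 (`SectorData.val_recursion`). Finitely many
steps reach any ball, at the price of division by factors `A_i D + b` with `b` an integer. The poles
thus lie in `ℤ / N`, where `N` is a common multiple of the slopes `A_i` and depends only on the set
of lines. The identity theorem glues the continuations on balls (`Continues.exists_global`), and the
convergent integral excludes poles in the strip. -/

noncomputable section

set_option linter.unusedSectionVars false

/-! ### Integration over the positive orthant -/

namespace SectorIntegral

variable {ι : Type*} [Fintype ι] [DecidableEq ι]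

/-- The open positive orthant. -/
def orthant (ι : Type*) : Set (ι → ℝ) := Set.univ.pi fun _ => Set.Ioi 0

theorem mem_orthant {η : ι → ℝ} : η ∈ orthant ι ↔ ∀ i, 0 < η i := by
  simp [orthant]

theorem measurableSet_orthant : MeasurableSet (orthant ι) :=
  MeasurableSet.univ_pi fun _ => measurableSet_Ioi

/-- The coordinates `exp (-η_j / 2)`, which map the closed orthant into the closed cube. -/
def halfExp (η : ι → ℝ) : ι → ℝ := fun j => Real.exp (-η j / 2)

theorem continuous_halfExp : Continuous (halfExp : (ι → ℝ) → ι → ℝ) := by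
  unfold halfExp; fun_prop

/-- Splitting off one coordinate from an integral over the orthant. -/
theorem split_coord (i : ι) : ∃ e : ℝ × ({j // ¬ j = i} → ℝ) ≃ᵐ (ι → ℝ),
    (∀ x y, e (x, y) i = x) ∧
    (∀ x x' y, Function.update (e (x, y)) i x' = e (x', y)) ∧
    (∀ x y, e (x, y) ∈ orthant ι ↔ 0 < x ∧ y ∈ orthant {j // ¬ j = i}) ∧
    MeasurePreserving e ((volume.restrict (Set.Ioi 0)).prod
      (volume.restrict (orthant {j // ¬ j = i}))) (volume.restrict (orthant ι)) := by
  let _ : Fintype {j // j = i} := Subtype.fintype _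
  let u : Unique {j // j = i} := ⟨⟨⟨i, rfl⟩⟩, fun a => Subtype.ext a.2⟩
  let e₁ := MeasurableEquiv.piEquivPiSubtypeProd (fun _ : ι => ℝ) (fun j => j = i)
  let e₂ := (MeasurableEquiv.funUnique {j // j = i} ℝ).symm
  let e : ℝ × ({j // ¬ j = i} → ℝ) ≃ᵐ (ι → ℝ) :=
    (e₂.prodCongr (MeasurableEquiv.refl _)).trans e₁.symm
  have he : ∀ x y j, e (x, y) j = if h : j = i then x else y ⟨j, h⟩ := by
    intro x y j
    rfl
  have hmp : MeasurePreserving e volume volume := by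
    have h1 : MeasurePreserving e₁.symm volume volume :=
      (volume_preserving_piEquivPiSubtypeProd (fun _ : ι => ℝ) (fun j => j = i)).symm _
    have h2 : MeasurePreserving e₂ volume volume := by
      convert (volume_preserving_funUnique {j // j = i} ℝ).symm _
    exact h1.comp (h2.prod (MeasurePreserving.id (volume : Measure ({j // ¬ j = i} → ℝ))))
  have hmem : ∀ x y, e (x, y) ∈ orthant ι ↔ 0 < x ∧ y ∈ orthant {j // ¬ j = i} := by
    intro x y
    simp only [mem_orthant, he]
    constructor
    · intro h
      refine ⟨by simpa using h i, fun j => ?_⟩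
      have := h j.1
      rwa [dif_neg j.2] at this
    · rintro ⟨hx, hy⟩ j
      split_ifs with h
      · exact hx
      · exact hy _
  refine ⟨e, by simp [he], ?_, hmem, ?_⟩
  · intro x x' y
    ext j
    by_cases h : j = i
    · subst h; simp [he]
    · simp [he, h]
  · rw [Measure.prod_restrict]
    have hs : (Set.Ioi (0 : ℝ)) ×ˢ orthant {j // ¬ j = i} = e ⁻¹' orthant ι := by
      ext ⟨x, y⟩
      simpa using (hmem x y).symm
    rw [hs]
    exact hmp.restrict_preimage measurableSet_orthant

/-- Integration by parts in one coordinate over the orthant. -/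
theorem integral_partial (i : ι) {g g' : (ι → ℝ) → ℂ}
    (hg' : Integrable g' (volume.restrict (orthant ι)))
    (hderiv : ∀ η x, HasDerivAt (fun x : ℝ => g (Function.update η i x))
      (g' (Function.update η i x)) x)
    (hlim : ∀ η ∈ orthant ι, Filter.Tendsto (fun x : ℝ => g (Function.update η i x))
      Filter.atTop (nhds 0)) 
    (hb : Integrable (fun η => Real.exp (-η i) * g (Function.update η i 0))
      (volume.restrict (orthant ι))) :
    ∫ η in orthant ι, g' η = - ∫ η in orthant ι, Real.exp (-η i) * g (Function.update η i 0) := by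
  obtain ⟨e, he, hu, hmem, hmp⟩ := split_coord i
  rw [← hmp.integral_comp', ← hmp.integral_comp']
  have hg'' := (hmp.integrable_comp_emb e.measurableEmbedding).2 hg'
  have hb'' := (hmp.integrable_comp_emb e.measurableEmbedding).2 hb
  rw [integral_prod_symm (fun p => g' (e p)) hg'', integral_prod_symm (fun p => (Real.exp (-e p i) : ℂ) * g (Function.update (e p) i 0)) hb'', ← integral_neg]
  have h1 := hg''.prod_left_ae
  refine integral_congr_ae ?_
  filter_upwards [h1, ae_restrict_mem measurableSet_orthant] with y hy hyO
  have key : ∫ x in Set.Ioi (0:ℝ), g' (e (x, y)) = 0 - g (e (0, y)) := by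
    refine integral_Ioi_of_hasDerivAt_of_tendsto (f := fun x => g (e (x, y))) ?_ ?_ hy ?_
    · have := (hderiv (e (0, y)) 0).continuousAt
      simp only [hu] at this
      exact this.continuousWithinAt
    · intro x _
      have := hderiv (e (0, y)) x
      simpa only [hu] using this
    · have := hlim (e (1, y)) ((hmem 1 y).2 ⟨one_pos, hyO⟩)
      simpa only [hu] using this
  rw [key]
  simp only [he, hu]
  -- The weight `exp (-x)` has integral 1 over the half line. The boundary value at `η i = 0` is
  -- thus an integral over the whole orthant, and the index set need not shrink.
  rw [integral_mul_const]
  have : ∫ x in Set.Ioi (0:ℝ), (Real.exp (-x) : ℂ) = 1 := by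
    rw [integral_complex_ofReal, integral_exp_neg_Ioi_zero]; simp
  rw [this]; simp

/-- `exp (-c ∑ η)` is integrable over the orthant. -/
theorem integrable_exp_neg_sum {c : ℝ} (hc : 0 < c) :
    Integrable (fun η : ι → ℝ => Real.exp (-c * ∑ j, η j)) (volume.restrict (orthant ι)) := by
  have : ∀ η : ι → ℝ, Real.exp (-c * ∑ j, η j) = ∏ j, Real.exp (-c * η j) := by
    intro η; rw [← Real.exp_sum, Finset.mul_sum]
  simp_rw [this]
  rw [orthant, volume_pi, Measure.restrict_pi_pi]
  exact Integrable.fintype_prod (f := fun _ x => Real.exp (-c * x)) 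
    fun _ => exp_neg_integrableOn_Ioi 0 hc

/-- A continuous function is bounded on the image of the closed orthant. -/
theorem exists_bound_halfExp {E : Type*} [NormedAddCommGroup E] {h : (ι → ℝ) → E}
    (hh : Continuous h) : ∃ C, 0 ≤ C ∧ ∀ η : ι → ℝ, (∀ j, 0 ≤ η j) → ‖h (halfExp η)‖ ≤ C := by
  have hK : IsCompact (Set.univ.pi fun _ : ι => Set.Icc (0:ℝ) 1) :=
    isCompact_univ_pi fun _ => isCompact_Icc
  obtain ⟨C, hC⟩ := hK.exists_bound_of_continuousOn hh.continuousOn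
  refine ⟨max C 0, le_max_right _ _, fun η hη => (hC _ ?_).trans (le_max_left _ _)⟩
  intro j _
  exact ⟨(Real.exp_pos _).le, Real.exp_le_one_iff.2 (by have := hη j; linarith)⟩

end SectorIntegral

/-! ### Averages of phases and their derivatives -/

namespace SectorIntegral

open scoped ContDiff

variable {ι : Type*} [Fintype ι] [DecidableEq ι]

/-- A linear family of densities `F f` on a phase space, all of whose moments with respect to
the functions `q k` are continuous in `f`. -/
structure PhaseFamily (X Ω κ : Type*) [AddCommGroup X] [Module ℂ X] [TopologicalSpace X]
    [MeasurableSpace Ω] where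
  ν : Measure Ω
  F : X →ₗ[ℂ] (Ω → ℂ)
  q : κ → Ω → ℂ
  measurable_q : ∀ k, Measurable (q k)
  integrable : ∀ (l : List κ) (f : X), Integrable (fun w => F f w * (l.map fun k => q k w).prod) ν
  bound : ∀ l : List κ, ∃ p : Seminorm ℂ X, Continuous p ∧
    ∀ f, ∫ w, ‖F f w * (l.map fun k => q k w).prod‖ ∂ν ≤ p f

namespace PhaseFamily

variable {X Ω κ : Type*} [AddCommGroup X] [Module ℂ X] [TopologicalSpace X]
    [MeasurableSpace Ω] [Fintype κ] (P : PhaseFamily X Ω κ)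

/-- The coefficients of a phase with nonnegative real part. -/
def Admissible (R : κ → ℂ) : Prop := ∀ w, 0 ≤ (∑ k, R k * P.q k w).re

/-- A monomial in the functions `q k`. -/
def mono (l : List κ) (w : Ω) : ℂ := (l.map fun k => P.q k w).prod

/-- The moment of `F f` weighted with the exponential of minus the phase. -/
def avg (l : List κ) (R : κ → ℂ) (f : X) : ℂ :=
  ∫ w, P.F f w * P.mono l w * Complex.exp (-∑ k, R k * P.q k w) ∂P.ν

/-- The absolute moment. -/
def absMoment (l : List κ) (f : X) : ℝ := ∫ w, ‖P.F f w * P.mono l w‖ ∂P.ν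

theorem absMoment_nonneg (l : List κ) (f : X) : 0 ≤ P.absMoment l f :=
  integral_nonneg fun _ => norm_nonneg _

theorem integrable' (l : List κ) (f : X) : Integrable (fun w => P.F f w * P.mono l w) P.ν :=
  P.integrable l f

theorem measurable_phase (R : κ → ℂ) :
    Measurable fun w => Complex.exp (-∑ k, R k * P.q k w) := by
  have := P.measurable_q
  fun_prop

theorem norm_exp_phase_le {R : κ → ℂ} (hR : P.Admissible R) (w : Ω) :
    ‖Complex.exp (-∑ k, R k * P.q k w)‖ ≤ 1 := by
  rw [Complex.norm_exp, Complex.neg_re]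
  exact Real.exp_le_one_iff.2 (by have := hR w; linarith)

theorem norm_avg_integrand_le (l : List κ) {R : κ → ℂ} (hR : P.Admissible R) (f : X) (w : Ω) :
    ‖P.F f w * P.mono l w * Complex.exp (-∑ k, R k * P.q k w)‖ ≤ ‖P.F f w * P.mono l w‖ := by
  rw [norm_mul]
  exact mul_le_of_le_one_right (norm_nonneg _) (P.norm_exp_phase_le hR w)

theorem aesm_avg_integrand (l : List κ) (R : κ → ℂ) (f : X) : AEStronglyMeasurable
    (fun w => P.F f w * P.mono l w * Complex.exp (-∑ k, R k * P.q k w)) P.ν :=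
  (P.integrable' l f).1.mul (P.measurable_phase R).aestronglyMeasurable

theorem integrable_avg (l : List κ) {R : κ → ℂ} (hR : P.Admissible R) (f : X) : Integrable
    (fun w => P.F f w * P.mono l w * Complex.exp (-∑ k, R k * P.q k w)) P.ν :=
  (P.integrable' l f).mono (P.aesm_avg_integrand l R f)
    (Filter.Eventually.of_forall fun w => P.norm_avg_integrand_le l hR f w)

theorem norm_avg_le (l : List κ) {R : κ → ℂ} (hR : P.Admissible R) (f : X) :
    ‖P.avg l R f‖ ≤ P.absMoment l f :=
  (norm_integral_le_integral_norm _).trans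
    (integral_mono_of_nonneg (Filter.Eventually.of_forall fun _ => norm_nonneg _)
      (P.integrable' l f).norm
      (Filter.Eventually.of_forall fun w => P.norm_avg_integrand_le l hR f w))

theorem avg_add (l : List κ) {R : κ → ℂ} (hR : P.Admissible R) (f g : X) :
    P.avg l R (f + g) = P.avg l R f + P.avg l R g := by
  unfold avg
  rw [← integral_add (P.integrable_avg l hR f) (P.integrable_avg l hR g)]
  congr 1; ext w
  simp only [map_add, Pi.add_apply]; ring

theorem avg_smul (l : List κ) (R : κ → ℂ) (c : ℂ) (f : X) :
    P.avg l R (c • f) = c * P.avg l R f := by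
  unfold avg
  rw [← integral_const_mul]
  congr 1; ext w
  simp only [map_smul, Pi.smul_apply, smul_eq_mul]; ring

theorem continuous_avg (l : List κ) {Z : Type*} [TopologicalSpace Z] [FirstCountableTopology Z]
    {R : Z → κ → ℂ} (hR : ∀ z, P.Admissible (R z)) (hc : Continuous R) (f : X) :
    Continuous fun z => P.avg l (R z) f := by
  refine continuous_of_dominated (bound := fun w => ‖P.F f w * P.mono l w‖)
    (fun z => P.aesm_avg_integrand l (R z) f)
    (fun z => Filter.Eventually.of_forall fun w => P.norm_avg_integrand_le l (hR z) f w)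
    (P.integrable' l f).norm (Filter.Eventually.of_forall fun w => ?_)
  have : ∀ k, Continuous fun z => R z k := fun k => (continuous_apply k).comp hc
  fun_prop

/-- A derivative of the exponential brings down `-∑ R'_k q_k`, which is absorbed by prolonging the
monomial. Admissible phases have exponentials of modulus at most 1, so the next absolute moments
dominate, and the averages stay in one class under differentiation. -/
theorem hasDerivAt_avg (l : List κ) {R R' : ℝ → κ → ℂ} (hR : ∀ z, P.Admissible (R z))
    (hd : ∀ k x, HasDerivAt (fun x => R x k) (R' x k) x) (hc : ∀ k, Continuous fun x => R' x k)
    (f : X) (x : ℝ) : HasDerivAt (fun x => P.avg l (R x) f)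
      (-∑ k, R' x k * P.avg (k :: l) (R x) f) x := by
  have hK : IsCompact (Metric.closedBall x 1) := isCompact_closedBall x 1
  choose C hC using fun k => hK.exists_bound_of_continuousOn (hc k).continuousOn
  have key := hasDerivAt_integral_of_dominated_loc_of_deriv_le (μ := P.ν) (x₀ := x)
    (F := fun x w => P.F f w * P.mono l w * Complex.exp (-∑ k, R x k * P.q k w))
    (F' := fun x w => -∑ k, R' x k * 
      (P.F f w * P.mono (k :: l) w * Complex.exp (-∑ k, R x k * P.q k w)))
    (s := Metric.ball x 1) (bound := fun w => ∑ k, C k * ‖P.F f w * P.mono (k :: l) w‖)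
    (Metric.ball_mem_nhds x one_pos)
    (Filter.Eventually.of_forall fun y => P.aesm_avg_integrand l (R y) f)
    (P.integrable_avg l (hR x) f) ?_ ?_ ?_ ?_
  · refine key.2.congr_deriv ?_
    rw [integral_neg, integral_finsetSum]
    · simp_rw [integral_const_mul]; rfl
    · intro k _
      exact (P.integrable_avg (k :: l) (hR x) f).const_mul _
  · refine AEStronglyMeasurable.neg ?_
    have : ∀ k ∈ Finset.univ, AEStronglyMeasurable (fun w => R' x k * 
      (P.F f w * P.mono (k :: l) w * Complex.exp (-∑ k, R x k * P.q k w))) P.ν :=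
      fun k _ => (P.aesm_avg_integrand (k :: l) (R x) f).const_mul _
    exact Finset.aestronglyMeasurable_fun_sum _ this
  · refine Filter.Eventually.of_forall fun w y hy => ?_
    rw [norm_neg]
    refine (norm_sum_le _ _).trans (Finset.sum_le_sum fun k _ => ?_)
    rw [norm_mul]
    exact mul_le_mul (hC k y (Metric.ball_subset_closedBall hy))
      (P.norm_avg_integrand_le (k :: l) (hR y) f w) (norm_nonneg _)
      ((norm_nonneg _).trans (hC k y (Metric.ball_subset_closedBall hy)))
  · exact integrable_finsetSum _ fun k _ => (P.integrable' (k :: l) f).norm.const_mul _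
  · refine Filter.Eventually.of_forall fun w y _ => ?_
    have h1 : HasDerivAt (fun x => -∑ k, R x k * P.q k w) (-∑ k, R' y k * P.q k w) y :=
      (HasDerivAt.fun_sum fun k _ => (hd k y).mul_const _).neg
    refine (h1.cexp.const_mul (P.F f w * P.mono l w)).congr_deriv ?_
    simp only [mono, List.map_cons, List.prod_cons, mul_neg, Finset.mul_sum]
    congr 1
    refine Finset.sum_congr rfl fun k _ => ?_
    ring

end PhaseFamily

/-- A partial derivative. -/
def pd {E : Type*} [NormedAddCommGroup E] [NormedSpace ℝ E] (i : ι) (h : (ι → ℝ) → E)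
    (z : ι → ℝ) : E := fderiv ℝ h z (Pi.single i 1)

theorem contDiff_pd {E : Type*} [NormedAddCommGroup E] [NormedSpace ℝ E] (i : ι)
    {h : (ι → ℝ) → E} (hh : ContDiff ℝ ∞ h) : ContDiff ℝ ∞ (pd i h) := by
  unfold pd
  exact (hh.fderiv_right (m := ∞) (by simp)).clm_apply contDiff_const

theorem halfExp_update (η : ι → ℝ) (i : ι) (x : ℝ) :
    halfExp (Function.update η i x) = Function.update (halfExp η) i (Real.exp (-x / 2)) := by
  ext j
  by_cases h : j = i
  · subst h; simp [halfExp]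
  · simp [halfExp, h]

/-- The factor `exp (-x / 2)` in the derivative is the gain of every integration by parts: it raises
the exponent of the coordinate `i` by one half. -/
theorem hasDerivAt_comp_halfExp {E : Type*} [NormedAddCommGroup E] [NormedSpace ℝ E] (i : ι)
    {h : (ι → ℝ) → E} (hh : ContDiff ℝ ∞ h) (η : ι → ℝ) (x : ℝ) :
    HasDerivAt (fun x => h (halfExp (Function.update η i x)))
      ((-(1 / 2) * Real.exp (-x / 2)) • pd i h (halfExp (Function.update η i x))) x := by
  have h1 : HasDerivAt (fun x : ℝ => Real.exp (-x / 2)) (-(1 / 2) * Real.exp (-x / 2)) x := by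
    have := ((hasDerivAt_id' x).fun_neg.div_const 2).exp
    convert this using 1
    simp; ring
  have h2 : HasDerivAt (fun x => halfExp (Function.update η i x))
      ((-(1 / 2) * Real.exp (-x / 2)) • (Pi.single i 1 : ι → ℝ)) x := by
    simp_rw [halfExp_update]
    have := (hasDerivAt_update (halfExp η) i (Real.exp (-x / 2))).scomp x h1
    exact this
  have h3 := (hh.differentiable (by simp)).differentiableAt (x := halfExp (Function.update η i x))
  have := h3.hasFDerivAt.comp_hasDerivAt x h2
  rw [map_smul] at this
  exact this

end SectorIntegral

/-! ### Sector integrals in their domain of convergence -/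

namespace SectorIntegral

open scoped ContDiff

variable {ι : Type*} [Fintype ι] [DecidableEq ι] {X Ω κ : Type*} [AddCommGroup X] [Module ℂ X]
  [TopologicalSpace X] [MeasurableSpace Ω] [Fintype κ] {P : PhaseFamily X Ω κ}

/-- The data of a sector integral
`∫ exp (-∑ s_j η_j) exp (D a(z)) ρ(z) ⟨F f · mono l · exp (-phase R(z))⟩ dη` over the orthant, where
`z_j = exp (-η_j / 2)` and `s_j = (A_j D + b_j) / 2`. -/
structure SectorData (ι : Type*) [Fintype ι] (P : PhaseFamily X Ω κ) where
  A : ι → ℤ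
  b : ι → ℤ
  a : (ι → ℝ) → ℂ
  ρ : (ι → ℝ) → ℂ
  R : (ι → ℝ) → κ → ℂ
  l : List κ
  smooth_a : ContDiff ℝ ∞ a
  smooth_ρ : ContDiff ℝ ∞ ρ
  smooth_R : ∀ k, ContDiff ℝ ∞ fun z => R z k
  adm : ∀ z, P.Admissible (R z)

namespace SectorData

variable (d : SectorData ι P)

theorem continuous_R : Continuous d.R := continuous_pi fun k => (d.smooth_R k).continuous

/-- The exponents. -/
def s (D : ℂ) (j : ι) : ℂ := (d.A j * D + d.b j) / 2

/-- The smooth part of the integrand. -/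
def reg (D : ℂ) (f : X) (z : ι → ℝ) : ℂ :=
  Complex.exp (D * d.a z) * d.ρ z * P.avg d.l (d.R z) f

/-- The integrand. -/
def kernel (D : ℂ) (f : X) (η : ι → ℝ) : ℂ :=
  Complex.exp (-∑ j, d.s D j * η j) * d.reg D f (halfExp η)

/-- The sector integral. -/
def val (D : ℂ) (f : X) : ℂ := ∫ η in orthant ι, d.kernel D f η

theorem continuous_reg (D : ℂ) (f : X) : Continuous (d.reg D f) := by
  have h1 := d.smooth_a.continuous
  have h2 := d.smooth_ρ.continuous
  have h3 := P.continuous_avg d.l d.adm d.continuous_R f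
  unfold reg
  fun_prop

theorem continuous_kernel (D : ℂ) (f : X) : Continuous (d.kernel D f) := by
  have h1 := (d.continuous_reg D f).comp continuous_halfExp
  unfold kernel
  simp only [Function.comp_def] at h1
  fun_prop

theorem exists_bound_reg (r : ℝ) : ∃ C, 0 ≤ C ∧ ∀ D : ℂ, ‖D‖ ≤ r → ∀ f : X, ∀ η : ι → ℝ,
    (∀ j, 0 ≤ η j) → ‖d.reg D f (halfExp η)‖ ≤ C * P.absMoment d.l f := by
  obtain ⟨C₁, h₁, hC₁⟩ := exists_bound_halfExp d.smooth_a.continuous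
  obtain ⟨C₂, h₂, hC₂⟩ := exists_bound_halfExp d.smooth_ρ.continuous
  refine ⟨Real.exp (|r| * C₁) * C₂, by positivity, fun D hD f η hη => ?_⟩
  unfold reg
  rw [norm_mul, norm_mul]
  refine mul_le_mul (mul_le_mul ?_ (hC₂ η hη) (norm_nonneg _) (Real.exp_pos _).le)
    (P.norm_avg_le _ (d.adm _) _) (norm_nonneg _) (by positivity)
  refine (Complex.norm_exp_le_exp_norm _).trans (Real.exp_le_exp.2 ?_)
  rw [norm_mul]
  exact mul_le_mul (hD.trans (le_abs_self r)) (hC₁ η hη) (norm_nonneg _) (abs_nonneg _)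

theorem norm_exp_le {D : ℂ} {δ : ℝ} (hδ : ∀ j, δ ≤ (d.s D j).re) {η : ι → ℝ}
    (hη : ∀ j, 0 ≤ η j) :
    ‖Complex.exp (-∑ j, d.s D j * η j)‖ ≤ Real.exp (-δ * ∑ j, η j) := by
  rw [Complex.norm_exp]
  refine Real.exp_le_exp.2 ?_
  rw [Complex.neg_re, Complex.re_sum, neg_mul, neg_le_neg_iff, Finset.mul_sum]
  refine Finset.sum_le_sum fun j _ => ?_
  rw [Complex.re_mul_ofReal]
  exact mul_le_mul_of_nonneg_right (hδ j) (hη j)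

theorem exists_bound_kernel (r δ : ℝ) : ∃ C, 0 ≤ C ∧ ∀ D : ℂ, ‖D‖ ≤ r → (∀ j, δ ≤ (d.s D j).re) →
    ∀ f : X, ∀ η : ι → ℝ, (∀ j, 0 ≤ η j) →
      ‖d.kernel D f η‖ ≤ C * P.absMoment d.l f * Real.exp (-δ * ∑ j, η j) := by
  obtain ⟨C, h, hC⟩ := d.exists_bound_reg r
  refine ⟨C, h, fun D hD hs f η hη => ?_⟩
  rw [kernel, norm_mul, mul_comm]
  exact mul_le_mul (hC D hD f η hη) (d.norm_exp_le hs hη) (norm_nonneg _)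
    (mul_nonneg h (P.absMoment_nonneg _ _))

/-- The domain in which the sector integral converges. -/
def domain : Set ℂ := {D | ∀ j, 0 < (d.s D j).re}

theorem continuous_s (j : ι) : Continuous fun D => d.s D j := by
  unfold s; fun_prop

/-- The finitely many exponents are continuous in `D`, so they share a positive lower bound near any
point of the domain. This is the uniform rate of decay needed for domination. -/
theorem exists_lower_bound {D : ℂ} (hD : D ∈ d.domain) :
    ∃ δ > 0, ∃ ε > 0, ∀ D' ∈ Metric.ball D ε, ∀ j, δ ≤ (d.s D' j).re := by
  have h : ∀ j, ∃ δ > 0, ∀ᶠ D' in nhds D, δ ≤ (d.s D' j).re := fun j => by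
    refine ⟨(d.s D j).re / 2, half_pos (hD j), ?_⟩
    have : ContinuousAt (fun D => (d.s D j).re) D :=
      (Complex.continuous_re.comp (d.continuous_s j)).continuousAt
    exact (this.eventually (lt_mem_nhds (half_lt_self (hD j)))).mono fun _ h => h.le
  choose δ hδ hev using h
  have hall := Filter.eventually_all.2 hev
  obtain ⟨ε, hε, hball⟩ := Metric.eventually_nhds_iff_ball.1 hall
  cases isEmpty_or_nonempty ι with
  | inl _ => exact ⟨1, one_pos, 1, one_pos, fun _ _ j => isEmptyElim j⟩
  | inr _ =>
    obtain ⟨j₀, hj₀⟩ := Finite.exists_min δ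
    exact ⟨δ j₀, hδ j₀, ε, hε, fun D' hD' j => (hj₀ j).trans (hball D' hD' j)⟩

theorem integrable_of_bound {g : (ι → ℝ) → ℂ} (hg : AEStronglyMeasurable g
    (volume.restrict (orthant ι))) {δ C : ℝ} (hδ : 0 < δ)
    (h : ∀ η : ι → ℝ, (∀ j, 0 ≤ η j) → ‖g η‖ ≤ C * Real.exp (-δ * ∑ j, η j)) :
    Integrable g (volume.restrict (orthant ι)) := by
  refine ((integrable_exp_neg_sum (ι := ι) hδ).const_mul C).mono' hg ?_
  filter_upwards [ae_restrict_mem measurableSet_orthant] with η hη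
  exact h η fun j => (mem_orthant.1 hη j).le

theorem integrable_kernel {D : ℂ} (hD : D ∈ d.domain) (f : X) :
    Integrable (d.kernel D f) (volume.restrict (orthant ι)) := by
  obtain ⟨δ, hδ, ε, hε, h⟩ := d.exists_lower_bound hD
  obtain ⟨C, -, hC⟩ := d.exists_bound_kernel ‖D‖ δ
  exact integrable_of_bound (d.continuous_kernel D f).aestronglyMeasurable hδ
    (hC D le_rfl (h D (Metric.mem_ball_self hε)) f)

theorem val_add {D : ℂ} (hD : D ∈ d.domain) (f g : X) :
    d.val D (f + g) = d.val D f + d.val D g := by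
  unfold val
  rw [← integral_add (d.integrable_kernel hD f) (d.integrable_kernel hD g)]
  congr 1; ext η
  simp only [kernel, reg, P.avg_add _ (d.adm _)]; ring

theorem val_smul (D : ℂ) (c : ℂ) (f : X) : d.val D (c • f) = c * d.val D f := by
  unfold val
  rw [← integral_const_mul]
  congr 1; ext η
  simp only [kernel, reg, P.avg_smul]; ring

theorem exists_bound_val {D : ℂ} (hD : D ∈ d.domain) :
    ∃ C, 0 ≤ C ∧ ∀ f, ‖d.val D f‖ ≤ C * P.absMoment d.l f := by
  obtain ⟨δ, hδ, ε, hε, h⟩ := d.exists_lower_bound hD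
  obtain ⟨C, hC0, hC⟩ := d.exists_bound_kernel ‖D‖ δ
  refine ⟨C * ∫ η in orthant ι, Real.exp (-δ * ∑ j, η j), mul_nonneg hC0
    (integral_nonneg fun _ => (Real.exp_pos _).le), fun f => ?_⟩
  rw [mul_right_comm, ← integral_const_mul]
  refine norm_integral_le_of_norm_le ((integrable_exp_neg_sum hδ).const_mul _) ?_
  filter_upwards [ae_restrict_mem measurableSet_orthant] with η hη
  exact hC D le_rfl (h D (Metric.mem_ball_self hε)) f η fun j => (mem_orthant.1 hη j).le

/-- The derivative of the exponent of the integrand in `D`. -/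
def expDeriv (η : ι → ℝ) : ℂ := -∑ j, (d.A j : ℂ) / 2 * η j + d.a (halfExp η)

/-- A derivative in `D` costs a factor that is at most linear in `η`, and an exponential of
arbitrarily small rate absorbs it. -/
theorem exists_bound_expDeriv {δ : ℝ} (hδ : 0 < δ) : ∃ C, 0 ≤ C ∧ ∀ η : ι → ℝ, (∀ j, 0 ≤ η j) →
    ‖d.expDeriv η‖ ≤ C * Real.exp (δ * ∑ j, η j) := by
  obtain ⟨C₁, h₁, hC₁⟩ := exists_bound_halfExp d.smooth_a.continuous
  refine ⟨∑ j, ‖(d.A j : ℂ) / 2‖ / δ + C₁, by positivity, fun η hη => ?_⟩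
  have hsum : 0 ≤ ∑ j, η j := Finset.sum_nonneg fun j _ => hη j
  have hexp : 1 ≤ Real.exp (δ * ∑ j, η j) := Real.one_le_exp (by positivity)
  rw [add_mul]
  refine (norm_add_le _ _).trans (add_le_add ?_ ?_)
  · rw [norm_neg, Finset.sum_mul]
    refine (norm_sum_le _ _).trans (Finset.sum_le_sum fun j _ => ?_)
    rw [norm_mul, div_mul_eq_mul_div, mul_div_assoc]
    refine mul_le_mul_of_nonneg_left ?_ (norm_nonneg _)
    rw [Complex.norm_real, Real.norm_of_nonneg (hη j), le_div_iff₀ hδ]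
    have h1 : η j ≤ ∑ j, η j := Finset.single_le_sum (fun j _ => hη j) (Finset.mem_univ j)
    have h2 := Real.add_one_le_exp (δ * ∑ j, η j)
    nlinarith
  · exact (hC₁ η hη).trans (le_mul_of_one_le_right h₁ hexp)

theorem kernel_hasDerivAt (D : ℂ) (f : X) (η : ι → ℝ) :
    HasDerivAt (fun D => d.kernel D f η) (d.expDeriv η * d.kernel D f η) D := by
  have h0 : ∀ j ∈ Finset.univ, HasDerivAt (fun D => d.s D j * η j) ((d.A j : ℂ) / 2 * η j) D := by
    intro j _
    have : HasDerivAt (fun D : ℂ => ((d.A j : ℂ) * D + d.b j) / 2) ((d.A j : ℂ) / 2) D := by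
      have := (((hasDerivAt_id' D).const_mul (d.A j : ℂ)).add_const (d.b j : ℂ)).div_const 2
      simpa using this
    exact this.mul_const _
  have h1 := (HasDerivAt.fun_sum h0).fun_neg.cexp
  have h2 := ((hasDerivAt_id' D).mul_const (d.a (halfExp η))).cexp
  have h3 := (h1.mul ((h2.mul_const (d.ρ (halfExp η))).mul_const (P.avg d.l (d.R (halfExp η)) f)))
  refine h3.congr_deriv ?_
  simp only [expDeriv, kernel, reg]; ring

theorem val_hasDerivAt {D : ℂ} (hD : D ∈ d.domain) (f : X) :
    DifferentiableAt ℂ (fun D => d.val D f) D := by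
  obtain ⟨δ, hδ, ε, hε, h⟩ := d.exists_lower_bound hD
  obtain ⟨C, hC0, hC⟩ := d.exists_bound_kernel (‖D‖ + ε) δ
  -- Half of the rate of decay is spent on the derivative of the exponent; the other half keeps the
  -- bound integrable.
  obtain ⟨C', hC'0, hC'⟩ := d.exists_bound_expDeriv (half_pos hδ)
  have hexp : Continuous d.expDeriv := by
    have h1 := (d.smooth_a.continuous).comp continuous_halfExp
    unfold expDeriv
    simp only [Function.comp_def] at h1
    fun_prop
  have key := hasDerivAt_integral_of_dominated_loc_of_deriv_le
    (μ := volume.restrict (orthant ι)) (x₀ := D)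
    (F := fun D η => d.kernel D f η) (F' := fun D η => d.expDeriv η * d.kernel D f η)
    (s := Metric.ball D ε)
    (bound := fun η => C' * (C * P.absMoment d.l f) * Real.exp (-(δ / 2) * ∑ j, η j))
    (Metric.ball_mem_nhds D hε)
    (Filter.Eventually.of_forall fun D => (d.continuous_kernel D f).aestronglyMeasurable)
    (d.integrable_kernel hD f)
    (hexp.mul (d.continuous_kernel D f)).aestronglyMeasurable ?_
    ((integrable_exp_neg_sum (half_pos hδ)).const_mul _)
    (Filter.Eventually.of_forall fun η D _ => d.kernel_hasDerivAt D f η)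
  · exact key.2.differentiableAt
  · filter_upwards [ae_restrict_mem measurableSet_orthant] with η hη D' hD'
    have hη' : ∀ j, 0 ≤ η j := fun j => (mem_orthant.1 hη j).le
    have hn : ‖D'‖ ≤ ‖D‖ + ε := by
      have := norm_sub_norm_le D' D
      have h2 := mem_ball_iff_norm.1 hD'
      linarith
    rw [norm_mul]
    calc _ ≤ (C' * Real.exp (δ / 2 * ∑ j, η j)) *
          (C * P.absMoment d.l f * Real.exp (-δ * ∑ j, η j)) :=
          mul_le_mul (hC' η hη') (hC D' hn (h D' hD') f η hη') (norm_nonneg _) (by positivity)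
      _ = _ := by
        rw [mul_mul_mul_comm, ← Real.exp_add]
        congr 2; ring

/-- The sector integral as a continuous linear functional in its domain. -/
theorem exists_clm [IsTopologicalAddGroup X] {D : ℂ} (hD : D ∈ d.domain) :
    ∃ T : X →L[ℂ] ℂ, ∀ f, T f = d.val D f := by
  obtain ⟨C, hC0, hC⟩ := d.exists_bound_val hD
  obtain ⟨p, hp, hpb⟩ := P.bound d.l
  let T : X →ₗ[ℂ] ℂ :=
    { toFun := d.val D
      map_add' := d.val_add hD
      map_smul' := fun c f => d.val_smul D c f }
  refine ⟨⟨T, ?_⟩, fun f => rfl⟩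
  refine continuous_of_continuousAt_zero T ?_
  have hb : ∀ f, ‖T f‖ ≤ C * p f := fun f => (hC f).trans
    (mul_le_mul_of_nonneg_left (hpb f) hC0)
  have h0 : Filter.Tendsto (fun f => C * p f) (nhds 0) (nhds 0) := by
    have := (hp.tendsto 0).const_mul C
    simpa using this
  rw [ContinuousAt, map_zero]
  exact squeeze_zero_norm hb h0

end SectorData

end SectorIntegral

/-! ### The recursion by integration by parts -/

namespace SectorIntegral

open scoped ContDiff

variable {ι : Type*} [Fintype ι] [DecidableEq ι] {X Ω κ : Type*} [AddCommGroup X] [Module ℂ X]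
  [TopologicalSpace X] [MeasurableSpace Ω] [Fintype κ] {P : PhaseFamily X Ω κ}

namespace SectorData

variable (d : SectorData ι P)

theorem contDiff_update (i : ι) (x : ℝ) : ContDiff ℝ ∞ fun z : ι → ℝ => Function.update z i x := by
  rw [contDiff_pi]
  intro j
  by_cases h : j = i
  · subst h; simpa using contDiff_const
  · simpa [h] using contDiff_apply ℝ ℝ j

/-- The data on the face `z_i = 1`. -/
def face (i : ι) : SectorData ι P where
  A := Function.update d.A i 0
  b := Function.update d.b i 2
  a := fun z => d.a (Function.update z i 1)
  ρ := fun z => d.ρ (Function.update z i 1)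
  R := fun z => d.R (Function.update z i 1)
  l := d.l
  smooth_a := d.smooth_a.comp (contDiff_update i 1)
  smooth_ρ := d.smooth_ρ.comp (contDiff_update i 1)
  smooth_R := fun k => (d.smooth_R k).comp (contDiff_update i 1)
  adm := fun _ => d.adm _

/-- The data with the exponent of `z_i` raised, and with new weight and monomial. -/
def raise (i : ι) (ρ : (ι → ℝ) → ℂ) (hρ : ContDiff ℝ ∞ ρ) (l : List κ) : SectorData ι P where
  A := d.A
  b := Function.update d.b i (d.b i + 1)
  a := d.a
  ρ := ρ
  R := d.R
  l := l
  smooth_a := d.smooth_a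
  smooth_ρ := hρ
  smooth_R := d.smooth_R
  adm := d.adm

/-- The term from the derivative of the factor `exp (D a)`. -/
def raiseExp (i : ι) : SectorData ι P :=
  d.raise i (fun z => pd i d.a z * d.ρ z) ((contDiff_pd i d.smooth_a).mul d.smooth_ρ) d.l

/-- The term from the derivative of the weight. -/
def raiseWeight (i : ι) : SectorData ι P :=
  d.raise i (pd i d.ρ) (contDiff_pd i d.smooth_ρ) d.l

/-- The term from the derivative of one coefficient of the phase. -/
def raisePhase (i : ι) (k : κ) : SectorData ι P :=
  d.raise i (fun z => pd i (fun z => d.R z k) z * d.ρ z)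
    ((contDiff_pd i (d.smooth_R k)).mul d.smooth_ρ) (k :: d.l)

/-- The values `A_i = 0` and `b_i = 2` make the new exponent equal to 1, and nothing else depends on
`η_i` any more. This is exactly the weighted boundary term of `integral_partial`. -/
theorem kernel_face (i : ι) (D : ℂ) (f : X) (η : ι → ℝ) :
    (d.face i).kernel D f η = Real.exp (-η i) * d.kernel D f (Function.update η i 0) := by
  have h1 : ∑ j, (d.face i).s D j * η j = η i + ∑ j, d.s D j * Function.update η i 0 j := by
    rw [← Finset.add_sum_erase _ _ (Finset.mem_univ i),
      ← Finset.add_sum_erase (a := i) _ (fun j => d.s D j * (Function.update η i 0 j : ℝ))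
        (Finset.mem_univ i)]
    simp only [s, face, Function.update_self]
    congr 1
    · simp
    · simp only [Complex.ofReal_zero, mul_zero, zero_add]
      refine Finset.sum_congr rfl fun j hj => ?_
      have := Finset.ne_of_mem_erase hj
      simp [this]
  have h2 : (d.face i).reg D f (halfExp η) = d.reg D f (halfExp (Function.update η i 0)) := by
    simp [reg, face, halfExp_update]
  rw [kernel, kernel, h1, h2, neg_add, Complex.exp_add]
  push_cast
  ring

theorem sum_s_raise (i : ι) (ρ : (ι → ℝ) → ℂ) (hρ : ContDiff ℝ ∞ ρ) (l : List κ) (D : ℂ)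
    (η : ι → ℝ) : ∑ j, (d.raise i ρ hρ l).s D j * η j = ∑ j, d.s D j * η j + η i / 2 := by
  rw [← Finset.add_sum_erase _ _ (Finset.mem_univ i),
      ← Finset.add_sum_erase (a := i) _ (fun j => d.s D j * η j) (Finset.mem_univ i)]
  have : ∀ j ∈ Finset.univ.erase i, (d.raise i ρ hρ l).s D j * η j = d.s D j * η j := by
    intro j hj
    have := Finset.ne_of_mem_erase hj
    simp [s, raise, this]
  rw [Finset.sum_congr rfl this]
  simp only [s, raise, Function.update_self]
  push_cast
  ring

/-- Raising `b_i` by 1 multiplies the kernel by `exp (-η_i / 2)`, the factor left by the chain rule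
through `halfExp`. -/
theorem kernel_raise (i : ι) (ρ : (ι → ℝ) → ℂ) (hρ : ContDiff ℝ ∞ ρ) (l : List κ) (D : ℂ) (f : X)
    (η : ι → ℝ) : (d.raise i ρ hρ l).kernel D f η =
      Real.exp (-η i / 2) * Complex.exp (-∑ j, d.s D j * η j) *
        (Complex.exp (D * d.a (halfExp η)) * ρ (halfExp η) *
          P.avg l (d.R (halfExp η)) f) := by
  rw [kernel, sum_s_raise, neg_add, Complex.exp_add]
  simp only [reg, raise]
  push_cast
  rw [neg_div]
  ring

/-- The derivative of the integrand in the coordinate `i`. -/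
def kernelDeriv (i : ι) (D : ℂ) (f : X) (η : ι → ℝ) : ℂ :=
  -(d.s D i * d.kernel D f η) - 1 / 2 * (D * (d.raiseExp i).kernel D f η +
    (d.raiseWeight i).kernel D f η - ∑ k, (d.raisePhase i k).kernel D f η)

theorem kernel_hasDerivAt_coord (i : ι) (D : ℂ) (f : X) (η : ι → ℝ) (x : ℝ) :
    HasDerivAt (fun x => d.kernel D f (Function.update η i x))
      (d.kernelDeriv i D f (Function.update η i x)) x := by
  have h1 : HasDerivAt (fun x => -∑ j, d.s D j * (Function.update η i x j : ℝ)) (-d.s D i) x := by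
    have e : ∀ x : ℝ, -∑ j, d.s D j * (Function.update η i x j : ℝ) =
        -(d.s D i * x + ∑ j ∈ Finset.univ.erase i, d.s D j * η j) := by
      intro x
      rw [← Finset.add_sum_erase _ _ (Finset.mem_univ i)]
      congr 2
      · simp
      · refine Finset.sum_congr rfl fun j hj => ?_
        have := Finset.ne_of_mem_erase hj
        simp [this]
    simp_rw [e]
    have := ((Complex.ofRealCLM.hasDerivAt (x := x)).const_mul (d.s D i)).add_const
      (∑ j ∈ Finset.univ.erase i, d.s D j * η j)
    exact this.fun_neg.congr_deriv (by simp)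
  have h2 := (((hasDerivAt_comp_halfExp i d.smooth_a η x).const_mul D).cexp.mul
    (hasDerivAt_comp_halfExp i d.smooth_ρ η x))
  have h3 := P.hasDerivAt_avg d.l (R := fun x => d.R (halfExp (Function.update η i x)))
    (R' := fun x k => (-(1 / 2) * Real.exp (-x / 2)) •
      pd i (fun z => d.R z k) (halfExp (Function.update η i x)))
    (fun _ => d.adm _) (fun k x => hasDerivAt_comp_halfExp i (d.smooth_R k) η x)
    (fun k => by
      have hu : Continuous fun x : ℝ => Function.update η i x :=
        continuous_const.update i continuous_id
      have h := (contDiff_pd i (d.smooth_R k)).continuous.comp (continuous_halfExp.comp hu)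
      simp only [Function.comp_def] at h
      fun_prop) f x
  have h4 := h1.cexp.mul (h2.mul h3)
  refine h4.congr_deriv ?_
  simp only [kernelDeriv, raiseExp, raiseWeight, raisePhase, kernel_raise, Function.update_self,
    Pi.mul_apply]
  simp only [kernel, reg, Complex.real_smul, Complex.ofReal_mul, Complex.ofReal_neg,
    Complex.ofReal_div, Complex.ofReal_one, Complex.ofReal_ofNat]
  have e : ∑ k, (-(1 / 2) * (Real.exp (-x / 2) : ℂ)) *
      pd i (fun z => d.R z k) (halfExp (Function.update η i x)) *
      P.avg (k :: d.l) (d.R (halfExp (Function.update η i x))) f =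
      (-(1 / 2) * (Real.exp (-x / 2) : ℂ)) * ∑ k, 
      pd i (fun z => d.R z k) (halfExp (Function.update η i x)) *
      P.avg (k :: d.l) (d.R (halfExp (Function.update η i x))) f := by
    rw [Finset.mul_sum]; exact Finset.sum_congr rfl fun _ _ => by ring
  have e' : ∀ E₁ E₂ E₃ : ℂ, ∑ k, E₁ * E₂ * (E₃ * (pd i (fun z => d.R z k)
      (halfExp (Function.update η i x)) * d.ρ (halfExp (Function.update η i x))) *
      P.avg (k :: d.l) (d.R (halfExp (Function.update η i x))) f) =
      E₁ * E₂ * E₃ * d.ρ (halfExp (Function.update η i x)) * ∑ k, 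
      pd i (fun z => d.R z k) (halfExp (Function.update η i x)) *
      P.avg (k :: d.l) (d.R (halfExp (Function.update η i x))) f := by
    intro E₁ E₂ E₃
    rw [Finset.mul_sum]; exact Finset.sum_congr rfl fun _ _ => by ring
  rw [e, e']
  ring

theorem domain_face (i : ι) {D : ℂ} (hD : D ∈ d.domain) : D ∈ (d.face i).domain := by
  intro j
  by_cases h : j = i
  · subst h; simp [s, face]
  · have := hD j
    simpa [s, face, h] using this

theorem domain_raise (i : ι) (ρ : (ι → ℝ) → ℂ) (hρ : ContDiff ℝ ∞ ρ) (l : List κ) {D : ℂ}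
    (hD : D ∈ d.domain) : D ∈ (d.raise i ρ hρ l).domain := by
  intro j
  have := hD j
  by_cases h : j = i
  · subst h
    simp only [s, raise, Function.update_self] at this ⊢
    push_cast
    rw [← add_assoc, add_div, Complex.add_re]
    have h2 : (0 : ℝ) < ((1 : ℂ) / 2).re := by norm_num
    linarith
  · simpa [s, raise, h] using this

/-- Integrate the derivative in `η_i` of the kernel. The exponential factor gives `-s_i` times the
integral; the three smooth factors give the raised terms. The kernel decays at infinity, so that
only the face `η_i = 0` contributes to the boundary. The right side converges on a larger domain in
the direction `i`, which is what allows continuation. -/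
theorem val_recursion (i : ι) {D : ℂ} (hD : D ∈ d.domain) (f : X) :
    d.s D i * d.val D f = (d.face i).val D f - 1 / 2 * (D * (d.raiseExp i).val D f +
      (d.raiseWeight i).val D f - ∑ k, (d.raisePhase i k).val D f) := by
  have i0 := d.integrable_kernel hD f
  have i1 := (d.face i).integrable_kernel (d.domain_face i hD) f
  have i2 := (d.raiseExp i).integrable_kernel (d.domain_raise i _ _ _ hD) f
  have i3 := (d.raiseWeight i).integrable_kernel (d.domain_raise i _ _ _ hD) f
  have i4 := fun k => (d.raisePhase i k).integrable_kernel (d.domain_raise i _ _ _ hD) f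
  have i5 : Integrable (fun η => ∑ k, (d.raisePhase i k).kernel D f η)
    (volume.restrict (orthant ι)) := integrable_finsetSum _ fun k _ => i4 k
  have i6 : Integrable (fun η => D * (d.raiseExp i).kernel D f η)
    (volume.restrict (orthant ι)) := i2.const_mul D
  have i7 : Integrable (fun η => D * (d.raiseExp i).kernel D f η +
    (d.raiseWeight i).kernel D f η) (volume.restrict (orthant ι)) := i6.add i3
  have i8 : Integrable (fun η => D * (d.raiseExp i).kernel D f η +
    (d.raiseWeight i).kernel D f η - ∑ k, (d.raisePhase i k).kernel D f η)
    (volume.restrict (orthant ι)) := i7.sub i5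
  have i9 : Integrable (fun η => -(d.s D i * d.kernel D f η)) (volume.restrict (orthant ι)) :=
    (i0.const_mul _).neg
  have key := integral_partial i (g := d.kernel D f) (g' := d.kernelDeriv i D f)
    (i9.sub (i8.const_mul _)) (d.kernel_hasDerivAt_coord i D f) ?_ ?_
  · simp_rw [← kernel_face] at key
    unfold kernelDeriv at key
    rw [integral_sub i9 (i8.const_mul _), integral_neg, integral_const_mul,
      integral_const_mul, integral_sub i7 i5, integral_add i6 i3, integral_const_mul,
      integral_finsetSum _ fun k _ => i4 k] at key
    simp only [val]
    linear_combination -key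
  · intro η hη
    obtain ⟨δ, hδ, ε, hε, h⟩ := d.exists_lower_bound hD
    obtain ⟨C, hC0, hC⟩ := d.exists_bound_kernel ‖D‖ δ
    have hpos := mem_orthant.1 hη
    have hb : ∀ᶠ x : ℝ in Filter.atTop, ‖d.kernel D f (Function.update η i x)‖ ≤
        C * P.absMoment d.l f * Real.exp (-δ * x) := by
      filter_upwards [Filter.eventually_ge_atTop 0] with x hx
      have hup : ∀ j, 0 ≤ Function.update η i x j := fun j => by
        by_cases h : j = i
        · subst h; simpa using hx
        · simpa [h] using (hpos j).le
      refine (hC D le_rfl (h D (Metric.mem_ball_self hε)) f _ hup).trans ?_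
      refine mul_le_mul_of_nonneg_left (Real.exp_le_exp.2 ?_)
        (mul_nonneg hC0 (P.absMoment_nonneg _ _))
      have := Finset.single_le_sum (fun j _ => hup j) (Finset.mem_univ i)
      rw [Function.update_self] at this
      nlinarith
    refine squeeze_zero_norm' hb ?_
    have : Filter.Tendsto (fun x : ℝ => Real.exp (-δ * x)) Filter.atTop (nhds 0) := by
      refine Real.tendsto_exp_atBot.comp ?_
      exact Filter.tendsto_id.const_mul_atTop_of_neg (neg_neg_of_pos hδ)
    simpa using this.const_mul (C * P.absMoment d.l f)
  · simp_rw [← kernel_face]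
    exact i1

end SectorData

end SectorIntegral

/-! ### Continuation with polynomial denominators -/

namespace SectorIntegral

variable {X : Type*} [AddCommGroup X] [Module ℂ X] [TopologicalSpace X]

/-- The functionals `J D`, given for `0 < re D < 2`, continue to a meromorphic family of continuous
functionals on the ball of radius `r`, with poles in `ℤ / N`. -/
def Continues (N : ℕ) (r : ℝ) (J : ℂ → X → ℂ) : Prop :=
  ∃ p : Polynomial ℂ, p ≠ 0 ∧ (∀ x, p.IsRoot x → ∃ k : ℤ, (N : ℂ) * x = k) ∧
    ∃ T : ℂ → X →L[ℂ] ℂ, (∀ f, DifferentiableOn ℂ (fun D => T D f) (Metric.ball 0 r)) ∧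
      ∀ D ∈ Metric.ball 0 r, 0 < D.re → D.re < 2 → ∀ f, T D f = p.eval D * J D f

namespace Continues

variable {N : ℕ} {r : ℝ} {J J' : ℂ → X → ℂ}

theorem congr (h : Continues N r J)
    (hJ : ∀ D : ℂ, 0 < D.re → D.re < 2 → ∀ f, J' D f = J D f) : Continues N r J' := by
  obtain ⟨p, hp, hr, T, hT, hTJ⟩ := h
  exact ⟨p, hp, hr, T, hT, fun D hD h0 h2 f => by rw [hTJ D hD h0 h2, hJ D h0 h2]⟩

theorem zero : Continues N r (fun _ _ => 0 : ℂ → X → ℂ) :=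
  ⟨1, one_ne_zero, fun x hx => by simp at hx, fun _ => 0, by simp, by simp⟩

theorem add (h : Continues N r J) (h' : Continues N r J') :
    Continues N r fun D f => J D f + J' D f := by
  obtain ⟨p, hp, hr, T, hT, hTJ⟩ := h
  obtain ⟨p', hp', hr', T', hT', hTJ'⟩ := h'
  refine ⟨p * p', mul_ne_zero hp hp', fun x hx => ?_,
    fun D => p'.eval D • T D + p.eval D • T' D, fun f => ?_, fun D hD h0 h2 f => ?_⟩
  · rcases Polynomial.root_mul.1 hx with hx | hx
    · exact hr x hx
    · exact hr' x hx
  · simp only [add_apply, smul_apply, smul_eq_mul]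
    exact (p'.differentiable.differentiableOn.mul (hT f)).add
      (p.differentiable.differentiableOn.mul (hT' f))
  · simp only [add_apply, smul_apply, smul_eq_mul,
      hTJ D hD h0 h2, hTJ' D hD h0 h2, Polynomial.eval_mul]
    ring

theorem mul {g : ℂ → ℂ} (h : Continues N r J) (hg : Differentiable ℂ g) :
    Continues N r fun D f => g D * J D f := by
  obtain ⟨p, hp, hr, T, hT, hTJ⟩ := h
  refine ⟨p, hp, hr, fun D => g D • T D, fun f => ?_, fun D hD h0 h2 f => ?_⟩
  · exact hg.differentiableOn.mul (hT f)
  · simp only [smul_apply, smul_eq_mul, hTJ D hD h0 h2]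
    ring

theorem const_mul (c : ℂ) (h : Continues N r J) : Continues N r fun D f => c * J D f :=
  h.mul (differentiable_const c)

theorem sum {κ : Type*} (s : Finset κ) {J : κ → ℂ → X → ℂ} (h : ∀ k ∈ s, Continues N r (J k)) :
    Continues N r fun D f => ∑ k ∈ s, J k D f := by
  classical
  induction s using Finset.induction_on with
  | empty => simpa using zero
  | insert a s ha ih =>
    simp_rw [Finset.sum_insert ha]
    exact (h a (Finset.mem_insert_self a s)).add
      (ih fun k hk => h k (Finset.mem_insert_of_mem hk))

/-- Dividing by `(A D + b) / 2` adds the linear factor to the denominator. Its root is `-b / A`,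
which lies in `ℤ / N` because `A` divides `N`. -/
theorem of_linear_mul {A b : ℤ} (hA : A ≠ 0) (hAN : A ∣ N)
    (h : Continues N r fun D f => (A * D + b) / 2 * J D f) : Continues N r J := by
  obtain ⟨p, hp, hr, T, hT, hTJ⟩ := h
  have hA' : (A : ℂ) ≠ 0 := by exact_mod_cast hA
  let c : Polynomial ℂ := Polynomial.C (A : ℂ) * Polynomial.X + Polynomial.C (b : ℂ)
  have hc : ∀ D, c.eval D = A * D + b := fun D => by simp [c]
  have hc0 : c ≠ 0 := by
    intro h0
    have h1 := hc 0
    have h2 := hc 1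
    rw [h0] at h1 h2
    simp only [Polynomial.eval_zero] at h1 h2
    apply hA'
    linear_combination h1 - h2
  refine ⟨p * c, mul_ne_zero hp hc0, fun x hx => ?_, fun D => (2 : ℂ) • T D, fun f => ?_,
    fun D hD h0 h2 f => ?_⟩
  · rcases Polynomial.root_mul.1 hx with hx | hx
    · exact hr x hx
    · obtain ⟨k, hk⟩ := hAN
      refine ⟨-(k * b), ?_⟩
      have h1 : (A : ℂ) * x + b = 0 := by rw [← hc]; exact hx
      have h2 : (N : ℂ) = A * k := by exact_mod_cast hk
      rw [h2]; push_cast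
      linear_combination (k : ℂ) * h1
  · exact (hT f).const_mul 2
  · simp only [smul_apply, smul_eq_mul, hTJ D hD h0 h2, Polynomial.eval_mul, hc]
    ring

end Continues

variable {ι : Type*} [Fintype ι] [DecidableEq ι] {Ω κ : Type*} [IsTopologicalAddGroup X]
  [MeasurableSpace Ω] [Fintype κ] {P : PhaseFamily X Ω κ}

theorem SectorData.exists_family (d : SectorData ι P) : ∃ T : ℂ → X →L[ℂ] ℂ,
    ∀ D ∈ d.domain, ∀ f, T D f = d.val D f := by
  have : ∀ D, ∃ T : X →L[ℂ] ℂ, D ∈ d.domain → ∀ f, T f = d.val D f := fun D => by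
    by_cases hD : D ∈ d.domain
    · obtain ⟨T, hT⟩ := d.exists_clm hD
      exact ⟨T, fun _ => hT⟩
    · exact ⟨0, fun h => absurd h hD⟩
  choose T hT using this
  exact ⟨T, hT⟩

/-- Here `c j` counts the half-integer steps after which the exponent `j` is positive on the whole
ball. If all the counts vanish, the integral converges on the ball. Otherwise the recursion is
applied in a direction `i` with `c i ≠ 0`: the face needs no further step there, as its exponent is
1, and the raised terms need one step less. A coordinate of slope zero has count zero, so division
is only ever by a nonconstant factor. -/
theorem SectorData.continues_of_steps {N : ℕ} {r : ℝ} (n : ℕ) : ∀ (d : SectorData ι P)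
    (c : ι → ℕ), ∑ j, c j = n → (∀ j, d.A j ≠ 0 → d.A j ∣ N) → (∀ j, d.A j = 0 → c j = 0) →
    (∀ D : ℂ, 0 < D.re → D.re < 2 → D ∈ d.domain) →
    (∀ D ∈ Metric.ball (0 : ℂ) r, ∀ j, 0 < (d.s D j + c j / 2).re) → Continues N r d.val := by
  induction n using Nat.strong_induction_on with
  | _ n ih =>
    intro d c hn hN h0 hstrip hc
    by_cases hall : ∀ j, c j = 0
    · obtain ⟨T, hT⟩ := d.exists_family
      have hdom : ∀ D ∈ Metric.ball (0 : ℂ) r, D ∈ d.domain := fun D hD j => by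
        simpa [hall j] using hc D hD j
      refine ⟨1, one_ne_zero, fun x hx => by simp at hx, T, fun f => ?_, fun D hD _ _ f => ?_⟩
      · refine DifferentiableOn.congr (f := fun D => d.val D f) (fun D hD => ?_)
          fun D hD => hT D (hdom D hD) f
        exact (d.val_hasDerivAt (hdom D hD) f).differentiableWithinAt
      · simp [hT D (hdom D hD) f]
    · push Not at hall
      obtain ⟨i, hi⟩ := hall
      have hA : d.A i ≠ 0 := fun h => hi (h0 i h)
      have hsum : ∀ m, m < c i → ∑ j, Function.update c i m j < n := fun m hm => by
        rw [← hn]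
        refine Finset.sum_lt_sum (fun j _ => ?_) ⟨i, Finset.mem_univ i, by simpa using hm⟩
        by_cases h : j = i
        · subst h; simpa using hm.le
        · simp [h]
      have hface : Continues N r (d.face i).val := by
        refine ih _ (hsum 0 (Nat.pos_of_ne_zero hi)) (d.face i) (Function.update c i 0) rfl
          (fun j => ?_) (fun j => ?_) (fun D h h' => d.domain_face i (hstrip D h h'))
          fun D hD j => ?_
        · by_cases h : j = i
          · subst h; simp [face]
          · simpa [face, h] using hN j
        · by_cases h : j = i
          · subst h; simp
          · simpa [face, h] using h0 j
        · by_cases h : j = i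
          · subst h; simp [face, s]
          · simpa [face, s, h] using hc D hD j
      have hraise : ∀ ρ hρ l, Continues N r (d.raise i ρ hρ l).val := fun ρ hρ l => by
        refine ih _ (hsum (c i - 1) (Nat.sub_one_lt hi)) (d.raise i ρ hρ l)
          (Function.update c i (c i - 1)) rfl (fun j => hN j) (fun j hj => ?_)
          (fun D h h' => d.domain_raise i _ _ _ (hstrip D h h')) fun D hD j => ?_
        · by_cases h : j = i
          · subst h; exact absurd hj hA
          · simpa [h] using h0 j hj
        · by_cases h : j = i
          · subst h
            have := hc D hD j
            have e : (d.raise j ρ hρ l).s D j + ((Function.update c j (c j - 1) j : ℕ) : ℂ) / 2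
                = d.s D j + (c j : ℂ) / 2 := by
              have : ((c j - 1 : ℕ) : ℂ) = c j - 1 := by
                rw [Nat.cast_sub (Nat.one_le_iff_ne_zero.2 hi)]; simp
              simp only [s, raise, Function.update_self, this]
              push_cast; ring
            rw [e]; exact this
          · simpa [raise, s, h] using hc D hD j
      refine Continues.of_linear_mul hA (hN i hA) (b := d.b i) ?_
      have h1 := (hraise (fun z => pd i d.a z * d.ρ z) ((contDiff_pd i d.smooth_a).mul d.smooth_ρ)
        d.l).mul differentiable_id
      have h2 := hraise (pd i d.ρ) (contDiff_pd i d.smooth_ρ) d.l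
      have h3 := Continues.sum Finset.univ fun k _ => hraise
        (fun z => pd i (fun z => d.R z k) z * d.ρ z)
        ((contDiff_pd i (d.smooth_R k)).mul d.smooth_ρ) (k :: d.l)
      refine (hface.add (((h1.add h2).add (h3.const_mul (-1))).const_mul (-1 / 2))).congr ?_
      intro D hD hD' f
      have := d.val_recursion i (hstrip D hD hD') f
      rw [s] at this
      rw [this]
      simp only [raiseExp, raiseWeight, raisePhase, id]
      ring

/-- **Continuation of sector integrals.** -/
theorem SectorData.continues {N : ℕ} (d : SectorData ι P) (r : ℝ)
    (hN : ∀ j, d.A j ≠ 0 → d.A j ∣ N) (hstrip : ∀ D : ℂ, 0 < D.re → D.re < 2 → D ∈ d.domain) :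
    Continues N r d.val := by
  have h : ∀ j, ∃ c : ℕ, (d.A j = 0 → c = 0) ∧
      ∀ D ∈ Metric.ball (0 : ℂ) r, 0 < (d.s D j + c / 2).re := fun j => by
    by_cases hA : d.A j = 0
    -- An exponent of slope zero does not depend on `D`, and its value at the point 1 of the strip
    -- is positive.
    · refine ⟨0, fun _ => rfl, fun D _ => ?_⟩
      have := hstrip 1 (by simp) (by norm_num) j
      simpa [s, hA] using this
    -- On the ball `|A_j Re D + b_j|` is at most this bound, so `c` half steps outweigh it.
    · obtain ⟨c, hc⟩ := exists_nat_gt (|(d.A j : ℝ)| * |r| + |(d.b j : ℝ)|)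
      refine ⟨c, fun h => absurd h hA, fun D hD => ?_⟩
      have h1 : |(d.A j : ℝ) * D.re| ≤ |(d.A j : ℝ)| * |r| := by
        rw [abs_mul]
        refine mul_le_mul_of_nonneg_left ?_ (abs_nonneg _)
        exact (Complex.abs_re_le_norm D).trans
          ((mem_ball_zero_iff.1 hD).le.trans (le_abs_self r))
      have h2 := neg_abs_le ((d.A j : ℝ) * D.re)
      have h3 := neg_abs_le (d.b j : ℝ)
      have e : (d.s D j + c / 2).re = ((d.A j : ℝ) * D.re + d.b j + c) / 2 := by
        have : d.s D j + c / 2 = ((d.A j : ℂ) * D + d.b j + c) / 2 := by rw [s]; ring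
        rw [this]
        simp
      rw [e]; linarith
  choose c hc0 hc using h
  exact continues_of_steps _ d c rfl hN hc0 hstrip fun D hD j => hc j D hD

end SectorIntegral

/-! ### Gluing the local continuations -/

namespace SectorIntegral

variable {X : Type*} [AddCommGroup X] [Module ℂ X] [TopologicalSpace X]

/-- The integers are discrete. A formula valid away from the candidate poles thus holds on a
punctured neighbourhood of every point, which is all that meromorphy asks. -/
theorem eventually_not_mul_int {N : ℕ} (hN : N ≠ 0) (D : ℂ) :
    ∀ᶠ D' in nhdsWithin D {D}ᶜ, ¬ ∃ k : ℤ, (N : ℂ) * D' = k := by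
  have hN' : (N : ℂ) ≠ 0 := by exact_mod_cast hN
  have hcont : Continuous fun D' : ℂ => (N : ℂ) * D' := by fun_prop
  by_cases hD : ∃ k : ℤ, (N : ℂ) * D = k
  · obtain ⟨k, hk⟩ := hD
    have h1 : ∀ᶠ D' in nhds D, (N : ℂ) * D' ∈ Metric.ball ((N : ℂ) * D) 1 :=
      hcont.continuousAt.eventually (Metric.ball_mem_nhds _ one_pos)
    filter_upwards [nhdsWithin_le_nhds h1, self_mem_nhdsWithin] with D' h hne
    rintro ⟨k', hk'⟩
    rw [hk, hk', mem_ball_iff_norm, ← Int.cast_sub, Complex.norm_intCast] at h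
    have : k' = k := by
      have : |k' - k| < 1 := by exact_mod_cast h
      have := Int.abs_lt_one_iff.1 this
      omega
    apply hne
    rw [this, ← hk] at hk'
    exact mul_left_cancel₀ hN' hk'
  · refine nhdsWithin_le_nhds ?_
    have : (N : ℂ) * D ∈ (Set.range ((↑) : ℤ → ℂ))ᶜ := by
      rintro ⟨k, hk⟩; exact hD ⟨k, hk.symm⟩
    have := hcont.continuousAt.eventually (Complex.isOpen_compl_range_intCast.mem_nhds this)
    filter_upwards [this] with D' h
    rintro ⟨k, hk⟩
    exact h ⟨k, hk.symm⟩

/-- The strip `0 < re D < 2`. -/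
def strip : Set ℂ := {D | 0 < D.re ∧ D.re < 2}

theorem isOpen_strip : IsOpen strip :=
  (isOpen_lt continuous_const Complex.continuous_re).inter
    (isOpen_lt Complex.continuous_re continuous_const)

/-- Local continuations on all balls fit together. -/
theorem Continues.exists_global {N : ℕ} (hN : N ≠ 0) {J : ℂ → X → ℂ}
    (h : ∀ r, Continues N r J)
    (hclm : ∀ D ∈ strip, ∃ T : X →L[ℂ] ℂ, ∀ f, T f = J D f)
    (hdiff : ∀ f, DifferentiableOn ℂ (fun D => J D f) strip) :
    ∃ T : ℂ → X →L[ℂ] ℂ, (∀ D ∈ strip, ∀ f, T D f = J D f) ∧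
      ∀ f, (∀ D, MeromorphicAt (fun D => T D f) D) ∧
        ∀ D, (D ∈ strip ∨ ¬ ∃ k : ℤ, (N : ℂ) * D = k) → AnalyticAt ℂ (fun D => T D f) D := by
  classical
  -- The radii are at least 2 so that every ball contains the point 1 of the strip, from which the
  -- identity theorem starts.
  choose p hp0 hroot T hT hTJ using fun n : ℕ => h (n + 2)
  choose! T₀ hT₀ using hclm
  let n : ℂ → ℕ := fun D => ⌈‖D‖⌉₊
  have hn : ∀ D, D ∈ Metric.ball (0 : ℂ) ((n D : ℝ) + 2) := fun D => by
    rw [mem_ball_zero_iff]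
    have := Nat.le_ceil ‖D‖
    simp only [n]
    linarith
  -- At a zero of the denominator outside the strip the value is 0 by convention. Inside the strip
  -- the convergent integral is used, whatever the denominators do there.
  let S : ℂ → X →L[ℂ] ℂ := fun D =>
    if D ∈ strip then T₀ D else ((p (n D)).eval D)⁻¹ • T (n D) D
  have hSstrip : ∀ D ∈ strip, ∀ f, S D f = J D f := fun D hD f => by
    simp only [S, if_pos hD, hT₀ D hD]
  have hcompat : ∀ m m' : ℕ, ∀ f, ∀ D, D ∈ Metric.ball (0 : ℂ) ((m : ℝ) + 2) →
      D ∈ Metric.ball (0 : ℂ) ((m' : ℝ) + 2) →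
      (p m').eval D * T m D f = (p m).eval D * T m' D f := by
    intro m m' f D hD hD'
    let r : ℝ := min ((m : ℝ) + 2) ((m' : ℝ) + 2)
    have hr : 1 < r := lt_min (by linarith [(Nat.cast_nonneg m : (0 : ℝ) ≤ m)])
      (by linarith [(Nat.cast_nonneg m' : (0 : ℝ) ≤ m')])
    have hsub : Metric.ball (0 : ℂ) r ⊆ Metric.ball 0 ((m : ℝ) + 2) :=
      Metric.ball_subset_ball (min_le_left _ _)
    have hsub' : Metric.ball (0 : ℂ) r ⊆ Metric.ball 0 ((m' : ℝ) + 2) :=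
      Metric.ball_subset_ball (min_le_right _ _)
    have a1 : AnalyticOnNhd ℂ (fun D => (p m').eval D * T m D f) (Metric.ball 0 r) :=
      ((p m').differentiable.differentiableOn.mul ((hT m f).mono hsub)).analyticOnNhd
        Metric.isOpen_ball
    have a2 : AnalyticOnNhd ℂ (fun D => (p m).eval D * T m' D f) (Metric.ball 0 r) :=
      ((p m).differentiable.differentiableOn.mul ((hT m' f).mono hsub')).analyticOnNhd
        Metric.isOpen_ball
    -- The two cross products are analytic on the smaller of the concentric balls, which is
    -- connected, and they agree near 1 because both are multiples of `J` on the strip.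
    have h1 : (1 : ℂ) ∈ Metric.ball (0 : ℂ) r := by simpa using hr
    refine a1.eqOn_of_preconnected_of_eventuallyEq a2
      (convex_ball (0 : ℂ) r).isPreconnected h1 ?_ (by
        rw [mem_ball_zero_iff] at hD hD' ⊢; exact lt_min hD hD')
    have hs : (1 : ℂ) ∈ strip := by constructor <;> norm_num
    filter_upwards [Metric.isOpen_ball.mem_nhds h1, isOpen_strip.mem_nhds hs] with D hD hDs
    rw [hTJ m D (hsub hD) hDs.1 hDs.2, hTJ m' D (hsub' hD) hDs.1 hDs.2]
    ring
  have hev : ∀ m D, ¬ (∃ k : ℤ, (N : ℂ) * D = k) → (p m).eval D ≠ 0 :=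
    fun m D hD h0 => hD (hroot m D h0)
  have hS : ∀ (m : ℕ) (D), D ∈ Metric.ball (0 : ℂ) ((m : ℝ) + 2) →
      ¬ (∃ k : ℤ, (N : ℂ) * D = k) → ∀ f, S D f = T m D f / (p m).eval D := by
    intro m D hD hk f
    rw [eq_div_iff (hev m D hk)]
    by_cases hs : D ∈ strip
    · rw [hSstrip D hs, hTJ m D hD hs.1 hs.2, mul_comm]
    · simp only [S, if_neg hs, smul_apply, smul_eq_mul]
      have := hcompat (n D) m f D (hn D) hD
      rw [mul_assoc, mul_comm _ (Polynomial.eval D (p m)), this, inv_mul_cancel_left₀ (hev _ D hk)]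
  have hTa : ∀ (m : ℕ) (f) (D), D ∈ Metric.ball (0 : ℂ) ((m : ℝ) + 2) →
      AnalyticAt ℂ (fun D => T m D f) D := fun m f D hD =>
    (hT m f).analyticAt (Metric.isOpen_ball.mem_nhds hD)
  have hpa : ∀ m D, AnalyticAt ℂ (fun D => (p m).eval D) D := fun m D =>
    (p m).differentiable.analyticAt D
  refine ⟨S, hSstrip, fun f => ⟨fun D => ?_, ?_⟩⟩
  · have hm : MeromorphicAt (fun D' => T (n D) D' f / (p (n D)).eval D') D :=
      ((hTa (n D) f D (hn D)).meromorphicAt).fun_div (hpa (n D) D).meromorphicAt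
    refine hm.congr ?_
    filter_upwards [eventually_not_mul_int hN D,
      nhdsWithin_le_nhds (Metric.isOpen_ball.mem_nhds (hn D))] with D' h1 h2
    exact (hS (n D) D' h2 h1 f).symm
  · rintro D (hs | hk)
    · refine ((hdiff f).analyticAt (isOpen_strip.mem_nhds hs)).congr ?_
      filter_upwards [isOpen_strip.mem_nhds hs] with D' h
      exact (hSstrip D' h f).symm
    · have ha : AnalyticAt ℂ (fun D' => T (n D) D' f / (p (n D)).eval D') D :=
        (hTa (n D) f D (hn D)).fun_div (hpa (n D) D) (hev _ D hk)
      refine ha.congr ?_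
      have h1 : ∀ᶠ D' in nhds D, ¬ ∃ k : ℤ, (N : ℂ) * D' = k := by
        have := eventually_nhdsWithin_iff.1 (eventually_not_mul_int hN D)
        filter_upwards [this] with D' h
        by_cases hD : D' = D
        · rw [hD]; exact hk
        · exact h hD
      filter_upwards [h1, Metric.isOpen_ball.mem_nhds (hn D)] with D' h1 h2
      exact (hS (n D) D' h2 h1 f).symm

end SectorIntegral

/-! ### Subdivision of space into integral simplicial cones -/

namespace SectorIntegral

variable {ι : Type*} [Fintype ι] [DecidableEq ι]

/-- The real matrix of an integer matrix. -/
abbrev realMat (M : Matrix ι ι ℤ) : Matrix ι ι ℝ := M.map (Int.cast : ℤ → ℝ)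

theorem det_realMat (M : Matrix ι ι ℤ) : (realMat M).det = (M.det : ℝ) :=
  (Int.cast_det M).symm

theorem realMat_mul (M A : Matrix ι ι ℤ) : realMat (M * A) = realMat M * realMat A :=
  Matrix.map_mul (f := Int.castRingHom ℝ)

theorem measurable_mulVec (A : Matrix ι ι ℝ) : Measurable fun η : ι → ℝ => A *ᵥ η :=
  (Continuous.matrix_mulVec continuous_const continuous_id).measurable

theorem measurableEmbedding_mulVec {A : Matrix ι ι ℝ} (hA : A.det ≠ 0) :
    MeasurableEmbedding fun η : ι → ℝ => A *ᵥ η := by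
  have hu : IsUnit A.det := isUnit_iff_ne_zero.2 hA
  refine (MeasurableEquiv.mk ⟨fun η => A *ᵥ η, fun η => A⁻¹ *ᵥ η, fun η => ?_, fun η => ?_⟩
    (measurable_mulVec A) (measurable_mulVec A⁻¹)).measurableEmbedding
  · simp [Matrix.mulVec_mulVec, Matrix.nonsing_inv_mul A hu]
  · simp [Matrix.mulVec_mulVec, Matrix.mul_nonsing_inv A hu]

theorem restrict_image_mulVec {A : Matrix ι ι ℝ} (hA : A.det ≠ 0) (E : Set (ι → ℝ)) :
    (volume : Measure (ι → ℝ)).restrict ((fun η => A *ᵥ η) '' E) =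
      ENNReal.ofReal |A.det| • Measure.map (fun η => A *ᵥ η) (volume.restrict E) := by
  have hm := measurableEmbedding_mulVec hA
  have h1 := Real.map_matrix_volume_pi_eq_smul_volume_pi hA
  have h2 : (⇑(Matrix.toLin' A)) = fun η => A *ᵥ η := by ext; simp
  rw [h2] at h1
  have h3 : (volume : Measure (ι → ℝ)) =
      ENNReal.ofReal |A.det| • Measure.map (fun η => A *ᵥ η) volume := by
    rw [h1, smul_smul, ← ENNReal.ofReal_mul (abs_nonneg _), ← abs_mul, mul_inv_cancel₀ hA]
    simp
  conv_lhs => rw [h3]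
  rw [Measure.restrict_smul, hm.restrict_map, Set.preimage_image_eq _ hm.injective]

/-- The open simplicial cone spanned by the columns of an integer matrix. -/
def cone (M : Matrix ι ι ℤ) : Set (ι → ℝ) := (fun η => realMat M *ᵥ η) '' orthant ι

/-- The measure `μ` is the sum of the Lebesgue measures of finitely many simplicial cones with a
property `Q`. -/
def Decomp (μ : Measure (ι → ℝ)) (Q : Matrix ι ι ℤ → Prop) : Prop :=
  ∃ l : List (Matrix ι ι ℤ), (∀ M ∈ l, Q M) ∧
    μ = (l.map fun M => (volume : Measure (ι → ℝ)).restrict (cone M)).sum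

namespace Decomp

variable {μ μ' : Measure (ι → ℝ)} {Q Q' : Matrix ι ι ℤ → Prop}

theorem single {M : Matrix ι ι ℤ} (hM : Q M) : Decomp (volume.restrict (cone M)) Q :=
  ⟨[M], by simpa using hM, by simp⟩

theorem add (h : Decomp μ Q) (h' : Decomp μ' Q) : Decomp (μ + μ') Q := by
  obtain ⟨l, hl, rfl⟩ := h
  obtain ⟨l', hl', rfl⟩ := h'
  exact ⟨l ++ l', fun M hM => (List.mem_append.1 hM).elim (hl M) (hl' M), by simp⟩

theorem bind (h : Decomp μ Q) (h' : ∀ M, Q M → Decomp (volume.restrict (cone M)) Q') :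
    Decomp μ Q' := by
  obtain ⟨l, hl, rfl⟩ := h
  induction l with
  | nil => exact ⟨[], by simp, by simp⟩
  | cons M l ih =>
    rw [List.map_cons, List.sum_cons]
    exact (h' M (hl M (by simp))).add (ih fun M' hM' => hl M' (by simp [hM']))

end Decomp

/-- The elementary subdivision: the column `i` is replaced by a combination of the columns
`i` and `j`. -/
def sub (i j k : ι) (p q : ℤ) : Matrix ι ι ℤ :=
  (1 : Matrix ι ι ℤ).updateCol k (fun m => if m = i then p else if m = j then q else 0)

theorem det_sub (i j k : ι) (p q : ℤ) :
    (sub i j k p q).det = if k = i then p else if k = j then q else 0 := by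
  rw [sub, ← Matrix.cramer_apply, Matrix.cramer_one]; rfl

theorem mulVec_updateCol_one {R : Type*} [CommRing R] (k : ι) (v η : ι → R) :
    ((1 : Matrix ι ι R).updateCol k v) *ᵥ η = fun m => v m * η k + if m = k then 0 else η m := by
  ext m
  rw [Matrix.mulVec, dotProduct, ← Finset.add_sum_erase _ _ (Finset.mem_univ k)]
  congr 1
  · simp
  · have : ∀ x ∈ Finset.univ.erase k, (1 : Matrix ι ι R).updateCol k v m x * η x =
        if m = x then η x else 0 := by
      intro x hx
      have := Finset.ne_of_mem_erase hx
      simp [Matrix.updateCol_ne this, Matrix.one_apply]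
    rw [Finset.sum_congr rfl this, Finset.sum_ite_eq]
    by_cases h : m = k <;> simp [h]

theorem vecMul_updateCol_one {R : Type*} [CommRing R] (k : ι) (v c : ι → R) :
    c ᵥ* ((1 : Matrix ι ι R).updateCol k v) = Function.update c k (c ⬝ᵥ v) := by
  ext m
  by_cases h : m = k
  · subst h
    simp [Matrix.vecMul, dotProduct]
  · simp [Matrix.vecMul, dotProduct, h, Matrix.one_apply]

theorem realMat_sub_mulVec (i j k : ι) (p q : ℤ) (η : ι → ℝ) :
    realMat (sub i j k p q) *ᵥ η =
      fun m => (if m = i then (p : ℝ) else if m = j then (q : ℝ) else 0) * η k +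
        if m = k then 0 else η m := by
  rw [← mulVec_updateCol_one]
  congr 1
  ext m n
  by_cases h : n = k
  · subst h
    simp [sub]
  · simp [sub, Matrix.updateCol_ne h, Matrix.one_apply]

theorem sub_vecMul {i j : ι} (hij : i ≠ j) (k : ι) (p q : ℤ) (c : ι → ℤ) :
    c ᵥ* sub i j k p q = Function.update c k (p * c i + q * c j) := by
  rw [sub, vecMul_updateCol_one]
  congr 1
  have : ∀ m, c m * (if m = i then p else if m = j then q else 0) =
      (if m = i then p * c i else 0) + (if m = j then q * c j else 0) := by
    intro m
    by_cases h : m = i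
    · subst h; simp [hij, mul_comm]
    · by_cases h' : m = j
      · subst h'; simp [h, mul_comm]
      · simp [h, h']
  simp [dotProduct, this, Finset.sum_add_distrib]

theorem sub_nonneg {i j k : ι} {p q : ℤ} (hp : 0 ≤ p) (hq : 0 ≤ q) (m n : ι) :
    0 ≤ sub i j k p q m n := by
  by_cases h : n = k
  · subst h
    simp [sub]
    split_ifs <;> simp [hp, hq]
  · simp only [sub, Matrix.updateCol_ne h, Matrix.one_apply]
    split_ifs <;> simp

/-- The points of this cone have `y_i = p η_i` and `y_j = q η_i + η_j`, so positivity of `η_j` is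
the inequality `q y_i < p y_j`. -/
theorem cone_sub_left {i j : ι} (hij : i ≠ j) {p q : ℤ} (hp : 0 < p) (hq : 0 < q) :
    cone (sub i j i p q) = orthant ι ∩ {y | (q : ℝ) * y i < p * y j} := by
  have hp' : (0 : ℝ) < p := by exact_mod_cast hp
  have hq' : (0 : ℝ) < q := by exact_mod_cast hq
  ext y
  simp only [cone, Set.mem_image, Set.mem_inter_iff, mem_orthant, Set.mem_ofPred_eq,
    realMat_sub_mulVec]
  constructor
  · rintro ⟨η, hη, rfl⟩
    refine ⟨fun m => ?_, ?_⟩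
    · have h1 := hη i
      have h2 := hη m
      dsimp only
      by_cases h : m = i
      · subst h; simp; positivity
      · by_cases h' : m = j
        · subst h'; simp [h]; positivity
        · simp [h, h', h2]
    · have := hη j
      simp [hij.symm]
      nlinarith
  · rintro ⟨hy, hlt⟩
    refine ⟨fun m => if m = i then y i / p else if m = j then y j - q * (y i / p) else y m,
      fun m => ?_, ?_⟩
    · by_cases h : m = i
      · subst h; simp; exact div_pos (hy _) hp'
      · by_cases h' : m = j
        · subst h'; simp [h]
          rw [mul_div_assoc', div_lt_iff₀ hp']; linarith
        · simp [h, h', hy m]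
    · ext m
      by_cases h : m = i
      · subst h; simp; field_simp
      · by_cases h' : m = j
        · subst h'; simp [h]
        · simp [h, h']

theorem cone_sub_right {i j : ι} (hij : i ≠ j) {p q : ℤ} (hp : 0 < p) (hq : 0 < q) :
    cone (sub i j j p q) = orthant ι ∩ {y | (p : ℝ) * y j < q * y i} := by
  have : sub i j j p q = sub j i j q p := by
    unfold sub
    congr 1
    ext m
    by_cases h : m = i
    · subst h; simp [hij]
    · simp [h]
  rw [this, cone_sub_left hij.symm hq hp]

theorem cone_mul (M A : Matrix ι ι ℤ) :
    cone (M * A) = (fun η => realMat M *ᵥ η) '' cone A := by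
  simp only [cone, Set.image_image, realMat_mul, Matrix.mulVec_mulVec]

theorem measurableSet_cone {M : Matrix ι ι ℤ} (hM : M.det ≠ 0) : MeasurableSet (cone M) :=
  (measurableEmbedding_mulVec (by rw [det_realMat]; exact_mod_cast hM)).measurableSet_image.2
    measurableSet_orthant

theorem volume_linear_eq_zero {v : ι → ℝ} (hv : v ≠ 0) :
    (volume : Measure (ι → ℝ)) {y | v ⬝ᵥ y = 0} = 0 := by
  let S : Submodule ℝ (ι → ℝ) :=
    { carrier := {y | v ⬝ᵥ y = 0}
      add_mem' := fun {a b} ha hb => by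
        simp only [Set.mem_ofPred_eq] at *; rw [dotProduct_add, ha, hb, add_zero]
      zero_mem' := by simp
      smul_mem' := fun c y hy => by
        simp only [Set.mem_ofPred_eq] at *; rw [dotProduct_smul, hy, smul_zero] }
  have : S ≠ ⊤ := by
    intro h
    apply hv
    have hm : v ∈ S := by rw [h]; trivial
    exact dotProduct_self_eq_zero.1 hm
  exact Measure.addHaar_submodule volume S this

/-- A new ray `p g_i + q g_j` between two generators cuts the cone in two. The common wall lies in a
hyperplane and is null. The orthant is treated first, and the linear map `M` transports the result.
-/
theorem restrict_cone_split {M : Matrix ι ι ℤ} (hM : M.det ≠ 0) {i j : ι} (hij : i ≠ j) {p q : ℤ}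
    (hp : 0 < p) (hq : 0 < q) : (volume : Measure (ι → ℝ)).restrict (cone M) =
      volume.restrict (cone (M * sub i j i p q)) + volume.restrict (cone (M * sub i j j p q)) := by
  have hM' : (realMat M).det ≠ 0 := by rw [det_realMat]; exact_mod_cast hM
  have h0 : (volume : Measure (ι → ℝ)).restrict (orthant ι) =
      volume.restrict (cone (sub i j i p q)) + volume.restrict (cone (sub i j j p q)) := by
    rw [← Measure.restrict_union, cone_sub_left hij hp hq, cone_sub_right hij hp hq]
    · refine Measure.restrict_congr_set (Filter.eventuallyEq_set.2 ?_)
      have hv : (fun m => if m = i then (q : ℝ) else if m = j then -(p : ℝ) else 0) ≠ 0 := by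
        intro h
        have := congrFun h i
        simp at this
        omega
      have hnull := volume_linear_eq_zero hv
      have hdot : ∀ y : ι → ℝ, (fun m => if m = i then (q : ℝ) else if m = j then -(p : ℝ) else 0) ⬝ᵥ y
          = q * y i - p * y j := by
        intro y
        have : ∀ m, (if m = i then (q : ℝ) else if m = j then -(p : ℝ) else 0) * y m =
            (if m = i then q * y i else 0) - (if m = j then p * y j else 0) := by
          intro m
          by_cases h : m = i
          · subst h; simp [hij]
          · by_cases h' : m = j
            · subst h'; simp [h]
            · simp [h, h']
        simp [dotProduct, this, Finset.sum_sub_distrib]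
      simp only [hdot] at hnull
      have hae : ∀ᵐ y : ι → ℝ, (q : ℝ) * y i - p * y j ≠ 0 := by
        rw [ae_iff]; simpa using hnull
      filter_upwards [hae] with y hy
      rw [← Set.inter_union_distrib_left]
      constructor
      · intro h
        refine ⟨h, ?_⟩
        rcases lt_or_gt_of_ne (sub_ne_zero.1 hy) with h | h
        · exact Or.inl h
        · exact Or.inr h
      · exact fun h => h.1
    · rw [cone_sub_left hij hp hq, cone_sub_right hij hp hq, Set.disjoint_left]
      rintro y ⟨-, h⟩ ⟨-, h'⟩
      simp only [Set.mem_ofPred_eq] at h h'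
      linarith
    · exact measurableSet_cone (by rw [det_sub]; simp [hij.symm]; omega)
  rw [cone_mul, cone_mul, restrict_image_mulVec hM', restrict_image_mulVec hM',
    cone, restrict_image_mulVec hM', h0, Measure.map_add _ _ (measurable_mulVec _), smul_add]

/-- All the entries are nonnegative or all are nonpositive. -/
def SignConst (c : ι → ℤ) : Prop := (∀ j, 0 ≤ c j) ∨ ∀ j, c j ≤ 0

theorem SignConst.vecMul {c : ι → ℤ} (hc : SignConst c) {A : Matrix ι ι ℤ} (hA : ∀ m n, 0 ≤ A m n) :
    SignConst (c ᵥ* A) := by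
  rcases hc with h | h
  · exact Or.inl fun j => Finset.sum_nonneg fun m _ => mul_nonneg (h m) (hA m j)
  · exact Or.inr fun j => Finset.sum_nonpos fun m _ => mul_nonpos_of_nonpos_of_nonneg (h m) (hA m j)

/-- If the form `c` takes both signs on the generators, the cone is split along a ray between a
positive and a negative generator on which `c` vanishes. In each half a generator with nonzero value
has been replaced by one with value zero, so the number of nonzero values drops. The factorization
through a nonnegative matrix is recorded because it preserves the signs of other forms. -/
theorem decomp_one_form (c : ι → ℤ) (n : ℕ) : ∀ M : Matrix ι ι ℤ, M.det ≠ 0 →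
    (Finset.univ.filter fun j => (c ᵥ* M) j ≠ 0).card = n →
    Decomp (volume.restrict (cone M)) fun M' => M'.det ≠ 0 ∧ SignConst (c ᵥ* M') ∧
      ∃ A : Matrix ι ι ℤ, (∀ m n, 0 ≤ A m n) ∧ M' = M * A := by
  induction n using Nat.strong_induction_on with
  | _ n ih =>
    intro M hM hn
    by_cases hs : SignConst (c ᵥ* M)
    · refine Decomp.single ⟨hM, hs, 1, fun m n => ?_, by simp⟩
      rw [Matrix.one_apply]; split_ifs <;> simp
    · simp only [SignConst, not_or, not_forall, not_le] at hs
      obtain ⟨⟨j, hj⟩, ⟨i, hi⟩⟩ := hs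
      have hij : i ≠ j := by rintro rfl; exact lt_asymm hi hj
      have hp : 0 < -(c ᵥ* M) j := by omega
      rw [restrict_cone_split hM hij hp hi]
      -- The weights are the absolute values of the form on the opposite generators, which makes it
      -- vanish on the new ray.
      have hzero : -(c ᵥ* M) j * (c ᵥ* M) i + (c ᵥ* M) i * (c ᵥ* M) j = 0 := by ring
      have key : ∀ k, (k = i ∨ k = j) → Decomp (volume.restrict
          (cone (M * sub i j k (-(c ᵥ* M) j) ((c ᵥ* M) i)))) fun M' => M'.det ≠ 0 ∧
          SignConst (c ᵥ* M') ∧ ∃ A : Matrix ι ι ℤ, (∀ m n, 0 ≤ A m n) ∧ M' = M * A := by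
        intro k hk
        have hck : (c ᵥ* M) k ≠ 0 := by rcases hk with rfl | rfl <;> omega
        have hdet : (M * sub i j k (-(c ᵥ* M) j) ((c ᵥ* M) i)).det ≠ 0 := by
          rw [Matrix.det_mul, det_sub]
          refine mul_ne_zero hM ?_
          rcases hk with rfl | rfl
          · simp; omega
          · simp [hij.symm]; omega
        refine (ih _ ?_ _ hdet rfl).bind ?_
        · rw [← hn]
          refine Finset.card_lt_card ?_
          rw [← Matrix.vecMul_vecMul, sub_vecMul hij, hzero]
          refine ⟨fun m hm => ?_, fun h => ?_⟩
          · simp only [Finset.mem_filter, Finset.mem_univ, true_and] at hm ⊢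
            by_cases h : m = k
            · subst h; exact hck
            · simpa [h] using hm
          · have := h (Finset.mem_filter.2 ⟨Finset.mem_univ k, hck⟩)
            simp at this
        · rintro M' ⟨h1, h2, A, hA, rfl⟩
          refine Decomp.single ⟨h1, h2, sub i j k (-(c ᵥ* M) j) ((c ᵥ* M) i) * A, fun m n => ?_,
            by rw [Matrix.mul_assoc]⟩
          exact Finset.sum_nonneg fun x _ => mul_nonneg (sub_nonneg hp.le hi.le m x) (hA x n)
      exact (key i (Or.inl rfl)).add (key j (Or.inr rfl))

/-- The forms are treated one after another. A later subdivision takes nonnegative combinations of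
the generators, and these keep a sign that was already constant. -/
theorem decomp_forms (C : Finset (ι → ℤ)) {μ : Measure (ι → ℝ)}
    (hμ : Decomp μ fun M => M.det ≠ 0) :
    Decomp μ fun M => M.det ≠ 0 ∧ ∀ c ∈ C, SignConst (c ᵥ* M) := by
  classical
  induction C using Finset.induction_on with
  | empty => simpa using hμ
  | insert c C _ ih =>
    refine ih.bind fun M hM => (decomp_one_form c _ M hM.1 rfl).bind ?_
    rintro M' ⟨h1, h2, A, hA, rfl⟩
    refine Decomp.single ⟨h1, fun c' hc' => ?_⟩
    rcases Finset.mem_insert.1 hc' with rfl | h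
    · exact h2
    · rw [← Matrix.vecMul_vecMul]
      exact (hM.2 c' h).vecMul hA

theorem cone_signs (ε : ι → Bool) : cone (Matrix.diagonal fun i => if ε i then (1 : ℤ) else -1) =
    {y | ∀ i, 0 < (if ε i then (1 : ℝ) else -1) * y i} := by
  ext y
  have hmul : ∀ η : ι → ℝ, realMat (Matrix.diagonal fun i => if ε i then (1 : ℤ) else -1) *ᵥ η =
      fun i => (if ε i then (1 : ℝ) else -1) * η i := by
    intro η
    rw [realMat, Matrix.diagonal_map (by simp)]
    ext i
    rw [Matrix.mulVec_diagonal]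
    by_cases h : ε i <;> simp [h]
  simp only [cone, Set.mem_image, mem_orthant, hmul, Set.mem_ofPred_eq]
  constructor
  · rintro ⟨η, hη, rfl⟩ i
    have := hη i
    by_cases h : ε i <;> simp [h, this]
  · intro h
    refine ⟨fun i => (if ε i then (1 : ℝ) else -1) * y i, h, ?_⟩
    ext i
    by_cases h : ε i <;> simp [h]

/-- The starting subdivision consists of the coordinate orthants, which cover everything except the
null coordinate hyperplanes. -/
theorem decomp_volume : Decomp (volume : Measure (ι → ℝ)) fun M => M.det ≠ 0 := by
  let M : (ι → Bool) → Matrix ι ι ℤ := fun ε => Matrix.diagonal fun i => if ε i then (1 : ℤ) else -1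
  have hM : ∀ ε, (M ε).det ≠ 0 := fun ε => by
    rw [Matrix.det_diagonal, Finset.prod_ne_zero_iff]
    intro i _
    split_ifs <;> simp
  refine ⟨(Finset.univ : Finset (ι → Bool)).toList.map M, ?_, ?_⟩
  · intro M' hM'
    obtain ⟨ε, -, rfl⟩ := List.mem_map.1 hM'
    exact hM ε
  · rw [List.map_map, Finset.sum_map_toList, ← Measure.sum_fintype]
    simp only [Function.comp_def]
    rw [← Measure.restrict_iUnion]
    · conv_lhs => rw [← Measure.restrict_univ (μ := (volume : Measure (ι → ℝ)))]
      refine Measure.restrict_congr_set (Filter.eventuallyEq_set.2 ?_)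
      have hae : ∀ᵐ y : ι → ℝ, ∀ i, y i ≠ 0 := by
        rw [ae_all_iff]
        intro i
        have hv : (Pi.single i (1 : ℝ) : ι → ℝ) ≠ 0 := by simp
        have := volume_linear_eq_zero hv
        rw [ae_iff]
        simpa using this
      filter_upwards [hae] with y hy
      simp only [Set.mem_univ, true_iff, Set.mem_iUnion, M, cone_signs, Set.mem_ofPred_eq]
      refine ⟨fun i => decide (0 < y i), fun i => ?_⟩
      rcases lt_or_gt_of_ne (hy i) with h | h
      · simp [not_lt.2 h.le, h]
      · simp [h]
    · intro ε ε' hne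
      obtain ⟨i, hi⟩ := Function.ne_iff.1 hne
      simp only [Function.onFun, M, cone_signs]
      rw [Set.disjoint_left]
      intro y h h'
      have h1 := h i
      have h2 := h' i
      rcases Bool.eq_false_or_eq_true (ε i) with e | e <;>
        rcases Bool.eq_false_or_eq_true (ε' i) with e' | e' <;> simp [e, e'] at h1 h2 hi
      · linarith
      · linarith
    · exact fun ε => measurableSet_cone (hM ε)

/-- Each cone is pulled back to the orthant by its generators, with Jacobian `|det M|`.
Integrability is inherited by every summand of the measure, so it need not be proved cone by cone.
-/
theorem integral_decomp {l : List (Matrix ι ι ℤ)} (hl : ∀ M ∈ l, M.det ≠ 0) {g : (ι → ℝ) → ℂ}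
    (hg : Integrable g (l.map fun M => (volume : Measure (ι → ℝ)).restrict (cone M)).sum) :
    (∀ M ∈ l, IntegrableOn (fun η => g (realMat M *ᵥ η)) (orthant ι)) ∧
    ∫ y, g y ∂(l.map fun M => (volume : Measure (ι → ℝ)).restrict (cone M)).sum =
      (l.map fun M => ((|M.det| : ℤ) : ℂ) * ∫ η in orthant ι, g (realMat M *ᵥ η)).sum := by
  induction l with
  | nil => simp
  | cons M l ih =>
    simp only [List.map_cons, List.sum_cons] at hg ⊢
    have hM := hl M (by simp)
    have hM' : (realMat M).det ≠ 0 := by rw [det_realMat]; exact_mod_cast hM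
    have h1 := hg.left_of_add_measure
    have h2 := hg.right_of_add_measure
    obtain ⟨ih1, ih2⟩ := ih (fun M' hM' => hl M' (by simp [hM'])) h2
    rw [integral_add_measure h1 h2, ih2]
    have hme := measurableEmbedding_mulVec hM'
    rw [cone, restrict_image_mulVec hM'] at h1 ⊢
    have hpos : ENNReal.ofReal |(realMat M).det| ≠ 0 := by
      simpa using hM'
    have h3 := (hme.integrable_map_iff).1 ((integrable_smul_measure hpos ENNReal.ofReal_ne_top).1 h1)
    refine ⟨fun M' hM'' => ?_, ?_⟩
    · rcases List.mem_cons.1 hM'' with rfl | h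
      · exact h3
      · exact ih1 M' h
    · rw [integral_smul_measure, hme.integral_map, ENNReal.toReal_ofReal (abs_nonneg _), det_realMat,
        Complex.real_smul, ← Int.cast_abs, Complex.ofReal_intCast]

end SectorIntegral

/-! ### Logistic coordinates on the cube -/

namespace SectorIntegral

variable {ι : Type*} [Fintype ι] [DecidableEq ι]

/-- The decreasing logistic function. -/
def logistic (y : ℝ) : ℝ := 1 / (1 + Real.exp y)

theorem logistic_pos (y : ℝ) : 0 < logistic y := by
  unfold logistic; positivity

theorem one_sub_logistic (y : ℝ) : 1 - logistic y = Real.exp y / (1 + Real.exp y) := by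
  have : (1 + Real.exp y) ≠ 0 := by positivity
  unfold logistic; field_simp; ring

theorem logistic_lt_one (y : ℝ) : logistic y < 1 := by
  have : 0 < 1 - logistic y := by rw [one_sub_logistic]; positivity
  linarith

theorem hasDerivAt_logistic (y : ℝ) :
    HasDerivAt logistic (-(logistic y * (1 - logistic y))) y := by
  have h : (1 + Real.exp y) ≠ 0 := by positivity
  have := (((Real.hasDerivAt_exp y).const_add 1).fun_inv h)
  have e : logistic = fun y => (1 + Real.exp y)⁻¹ := by ext; simp [logistic]
  rw [one_sub_logistic, e]
  refine this.congr_deriv ?_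
  field_simp

theorem logistic_injective : Function.Injective logistic := by
  intro x y h
  simpa [logistic] using h

theorem range_logistic : Set.range logistic = Set.Ioo 0 1 := by
  ext t
  constructor
  · rintro ⟨y, rfl⟩
    exact ⟨logistic_pos y, logistic_lt_one y⟩
  · rintro ⟨h0, h1⟩
    refine ⟨Real.log ((1 - t) / t), ?_⟩
    rw [logistic, Real.exp_log (div_pos (by linarith) h0)]
    field_simp
    ring

/-- The Jacobian of the logistic change of variables. -/
def logisticJac (y : ι → ℝ) : ℝ := ∏ i, logistic (y i) * (1 - logistic (y i))

/-- The coordinate `y` runs to `+∞` as `t → 0` and to `-∞` as `t → 1`. Both ends of the interval are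
thus at infinity, and powers of `t` and of `1 - t` become exponentials there. -/
theorem cube_change_of_variables (g : (ι → ℝ) → ℂ) :
    (IntegrableOn g (Set.univ.pi fun _ => Set.Ioo 0 1) ↔
      Integrable fun y : ι → ℝ => (logisticJac y : ℂ) * g fun i => logistic (y i)) ∧
    ∫ t in Set.univ.pi fun _ => Set.Ioo 0 1, g t =
      ∫ y : ι → ℝ, (logisticJac y : ℂ) * g fun i => logistic (y i) := by
  let f : (ι → ℝ) → ι → ℝ := fun y i => logistic (y i)
  let f' : (ι → ℝ) → (ι → ℝ) →L[ℝ] (ι → ℝ) := fun y => LinearMap.toContinuousLinearMap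
    (Matrix.toLin' (Matrix.diagonal fun i => -(logistic (y i) * (1 - logistic (y i)))))
  have hf : ∀ y ∈ Set.univ, HasFDerivWithinAt f (f' y) Set.univ y := by
    intro y _
    rw [hasFDerivWithinAt_univ, hasFDerivAt_pi']
    intro i
    have h0 : HasFDerivAt (fun y : ι → ℝ => y i)
        (ContinuousLinearMap.proj (R := ℝ) (φ := fun _ : ι => ℝ) i) y :=
      hasFDerivAt_apply i y
    have h1 := (hasDerivAt_logistic (y i)).comp_hasFDerivAt y h0
    refine h1.congr_fderiv ?_
    ext v
    simp [f', Matrix.mulVec_diagonal]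
  have hdet : ∀ y, |(f' y).det| = logisticJac y := by
    intro y
    simp only [f', LinearMap.det_toContinuousLinearMap, LinearMap.det_toLin', Matrix.det_diagonal]
    rw [Finset.abs_prod]
    refine Finset.prod_congr rfl fun i _ => ?_
    rw [abs_neg, abs_of_pos]
    exact mul_pos (logistic_pos _) (by linarith [logistic_lt_one (y i)])
  have hinj : Set.InjOn f Set.univ := fun x _ y _ h =>
    funext fun i => logistic_injective (congrFun h i)
  have himg : f '' Set.univ = Set.univ.pi fun _ => Set.Ioo 0 1 := by
    rw [Set.image_univ, ← range_logistic, ← Set.range_piMap]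
    rfl
  have h1 := integrableOn_image_iff_integrableOn_abs_det_fderiv_smul volume MeasurableSet.univ
    hf hinj g
  have h2 := integral_image_eq_integral_abs_det_fderiv_smul volume MeasurableSet.univ hf hinj g
  rw [himg] at h1 h2
  simp only [hdet, Complex.real_smul, Measure.restrict_univ, integrableOn_univ, f] at h1 h2
  exact ⟨h1, h2⟩

end SectorIntegral

/-! ### Gaussian integrals with a complex symmetric matrix -/

namespace ComplexGaussian

variable {n : Type*} [Fintype n] [DecidableEq n]

theorem exists_orthogonal_diagonalization {A : Matrix n n ℝ} (hA : A.IsHermitian) :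
    ∃ (O : Matrix n n ℝ) (l : n → ℝ), Oᵀ * O = 1 ∧ A = O * Matrix.diagonal l * Oᵀ := by
  refine ⟨hA.eigenvectorUnitary, hA.eigenvalues, ?_, ?_⟩
  · have := Unitary.coe_star_mul_self hA.eigenvectorUnitary
    simpa [Matrix.star_eq_conjTranspose] using this
  · have := hA.spectral_theorem
    simpa [Unitary.conjStarAlgAut_apply, Matrix.star_eq_conjTranspose] using this

/-- Simultaneous diagonalization of a positive definite and a symmetric real matrix. -/
theorem exists_simultaneous_diagonalization {X Y : Matrix n n ℝ} (hX : X.PosDef) (hY : Yᵀ = Y) :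
    ∃ (T : Matrix n n ℝ) (l : n → ℝ), T.det ≠ 0 ∧ Tᵀ * X * T = 1 ∧
      Tᵀ * Y * T = Matrix.diagonal l := by
  obtain ⟨O, μ, hO, hXO⟩ := exists_orthogonal_diagonalization hX.isHermitian
  have hOO : O * Oᵀ = 1 := mul_eq_one_comm.1 hO
  have hμ : ∀ i, 0 < μ i := by
    intro i
    have h1 : Matrix.diagonal μ = Oᵀ * X * O := by
      rw [hXO]
      simp only [Matrix.mul_assoc, hO, Matrix.mul_one]
      rw [← Matrix.mul_assoc, hO, Matrix.one_mul]
    have h2 : μ i = (O *ᵥ Pi.single i 1) ⬝ᵥ (X *ᵥ (O *ᵥ Pi.single i 1)) := by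
      have : (O *ᵥ Pi.single i 1) ⬝ᵥ (X *ᵥ (O *ᵥ Pi.single i 1)) =
          Pi.single i 1 ⬝ᵥ ((Oᵀ * X * O) *ᵥ Pi.single i 1) := by
        rw [Matrix.mul_assoc, ← Matrix.mulVec_mulVec, ← Matrix.mulVec_mulVec,
          Matrix.dotProduct_mulVec _ Oᵀ, Matrix.vecMul_transpose]
      rw [this, ← h1]
      simp
    rw [h2]
    have hne : O *ᵥ Pi.single i 1 ≠ 0 := by
      intro h
      have : Oᵀ *ᵥ (O *ᵥ Pi.single i 1) = 0 := by rw [h, Matrix.mulVec_zero]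
      rw [Matrix.mulVec_mulVec, hO, Matrix.one_mulVec] at this
      simpa using congrFun this i
    simpa using hX.dotProduct_mulVec_pos hne
  -- Rescaling the eigenbasis of `X` turns `X` into the identity, which the orthogonal matrix that
  -- next diagonalizes `Sᵀ Y S` leaves unchanged.
  let S : Matrix n n ℝ := O * Matrix.diagonal fun i => (Real.sqrt (μ i))⁻¹
  have hS : Sᵀ * X * S = 1 := by
    have : Sᵀ * X * S = (Matrix.diagonal fun i => (Real.sqrt (μ i))⁻¹) * (Oᵀ * O) *
        Matrix.diagonal μ * (Oᵀ * O) * Matrix.diagonal fun i => (Real.sqrt (μ i))⁻¹ := by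
      simp only [S, hXO, Matrix.transpose_mul, Matrix.diagonal_transpose, Matrix.mul_assoc]
    rw [this, hO, Matrix.mul_one, Matrix.mul_one, Matrix.diagonal_mul_diagonal,
      Matrix.diagonal_mul_diagonal, ← Matrix.diagonal_one]
    congr 1
    ext i
    have h1 := Real.sqrt_pos.2 (hμ i)
    have h2 := Real.mul_self_sqrt (hμ i).le
    field_simp
    rw [sq, h2]
  have hSYS : (Sᵀ * Y * S).IsHermitian := by
    rw [Matrix.IsHermitian, Matrix.conjTranspose_eq_transpose_of_trivial]
    simp [Matrix.transpose_mul, hY, Matrix.mul_assoc]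
  obtain ⟨O', l, hO', hY'⟩ := exists_orthogonal_diagonalization hSYS
  have e1 : (S * O')ᵀ * X * (S * O') = 1 := by
    have : (S * O')ᵀ * X * (S * O') = O'ᵀ * (Sᵀ * X * S) * O' := by
      simp only [Matrix.transpose_mul, Matrix.mul_assoc]
    rw [this, hS, Matrix.mul_one, hO']
  refine ⟨S * O', l, ?_, e1, ?_⟩
  · intro h0
    have := congrArg Matrix.det e1
    rw [Matrix.det_mul, h0, mul_zero, Matrix.det_one] at this
    exact zero_ne_one this
  · have : (S * O')ᵀ * Y * (S * O') = O'ᵀ * (Sᵀ * Y * S) * O' := by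
      simp only [Matrix.transpose_mul, Matrix.mul_assoc]
    rw [this, hY']
    have : O'ᵀ * (O' * Matrix.diagonal l * O'ᵀ) * O' =
      (O'ᵀ * O') * Matrix.diagonal l * (O'ᵀ * O') := by simp only [Matrix.mul_assoc]
    rw [this, hO', Matrix.one_mul, Matrix.mul_one]

/-- A complex symmetric matrix given by its real and imaginary parts, the imaginary part scaled. -/
def cmat (X Y : Matrix n n ℝ) (θ : ℝ) : Matrix n n ℂ :=
  X.map Complex.ofReal + (Complex.I * θ) • Y.map Complex.ofReal

theorem map_ofReal_mul (A B : Matrix n n ℝ) :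
    (A * B).map Complex.ofReal = A.map Complex.ofReal * B.map Complex.ofReal :=
  Matrix.map_mul (f := Complex.ofRealHom)

theorem det_map_ofReal (A : Matrix n n ℝ) : (A.map Complex.ofReal).det = (A.det : ℂ) :=
  (Complex.ofRealHom.map_det A).symm

/-- The Gaussian integral with a complex symmetric matrix of positive definite real part. The
square root of the determinant is given as a continuous function along a path to the real part. -/
theorem integral_exp_quadratic {X Y : Matrix n n ℝ} (hX : X.PosDef) (hY : Yᵀ = Y) {k : ℝ → ℝ}
    (hk : ContinuousOn k (Set.Icc 0 1)) (hpos : ∀ θ ∈ Set.Icc (0 : ℝ) 1, 0 < k θ)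
    (hdet : ∀ θ ∈ Set.Icc (0 : ℝ) 1, (cmat X Y θ).det = (k θ : ℂ) ^ 2) (w : n → ℂ) :
    Integrable (fun y : n → ℝ => Complex.exp (-(1 / 2) *
      ((fun a => (y a : ℂ)) ⬝ᵥ (cmat X Y 1 *ᵥ fun a => (y a : ℂ))) + w ⬝ᵥ fun a => (y a : ℂ))) ∧
    ∫ y : n → ℝ, Complex.exp (-(1 / 2) * ((fun a => (y a : ℂ)) ⬝ᵥ
      (cmat X Y 1 *ᵥ fun a => (y a : ℂ))) + w ⬝ᵥ fun a => (y a : ℂ)) =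
      (∏ _i : n, (2 * Real.pi : ℂ) ^ (1 / 2 : ℂ)) / (k 1 : ℂ) *
        Complex.exp (1 / 2 * (w ⬝ᵥ ((cmat X Y 1)⁻¹ *ᵥ w))) := by
  obtain ⟨T, l, hT, hTX, hTY⟩ := exists_simultaneous_diagonalization hX hY
  let Tc : Matrix n n ℂ := T.map Complex.ofReal
  have hTcdet : Tc.det = (T.det : ℂ) := det_map_ofReal T
  have hTc0 : Tc.det ≠ 0 := by rw [hTcdet]; exact_mod_cast hT
  have hdiag : ∀ θ : ℝ, Tcᵀ * cmat X Y θ * Tc =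
      Matrix.diagonal fun i => 1 + Complex.I * θ * l i := by
    intro θ
    have h1 := congrArg (fun M => M.map Complex.ofReal) hTX
    have h2 := congrArg (fun M => M.map Complex.ofReal) hTY
    simp only [map_ofReal_mul] at h1 h2
    have h1' : Tcᵀ * X.map Complex.ofReal * Tc = 1 := by
      rw [Matrix.map_one _ Complex.ofReal_zero Complex.ofReal_one] at h1; exact h1
    have h2' : Tcᵀ * Y.map Complex.ofReal * Tc = Matrix.diagonal fun i => (l i : ℂ) := by
      rw [Matrix.diagonal_map Complex.ofReal_zero] at h2; exact h2
    rw [cmat, Matrix.mul_add, Matrix.add_mul, h1', Matrix.mul_smul, Matrix.smul_mul, h2',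
      ← Matrix.diagonal_one, ← Matrix.diagonal_smul, Matrix.diagonal_add]
    rfl
  let b : ℝ → n → ℂ := fun θ i => 1 + Complex.I * θ * l i
  have hbre : ∀ θ i, (b θ i).re = 1 := fun θ i => by simp [b]
  have hb0 : ∀ θ i, b θ i ≠ 0 := fun θ i h => by
    have := hbre θ i; rw [h] at this; simp at this
  -- the quadratic form in the diagonal coordinates
  have hquad : ∀ η : n → ℝ, (fun a => ((T *ᵥ η) a : ℂ)) = Tc *ᵥ fun a => (η a : ℂ) := by
    intro η
    ext a
    simp [Tc, Matrix.mulVec, dotProduct]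
  have hform : ∀ η : n → ℝ, -(1 / 2) * ((fun a => ((T *ᵥ η) a : ℂ)) ⬝ᵥ
      (cmat X Y 1 *ᵥ fun a => ((T *ᵥ η) a : ℂ))) + w ⬝ᵥ (fun a => ((T *ᵥ η) a : ℂ)) =
      -∑ i, (b 1 i / 2) * (η i : ℂ) ^ 2 + ∑ i, (w ᵥ* Tc) i * η i := by
    intro η
    rw [hquad, Matrix.dotProduct_mulVec w]
    have : (Tc *ᵥ fun a => (η a : ℂ)) ⬝ᵥ (cmat X Y 1 *ᵥ (Tc *ᵥ fun a => (η a : ℂ))) =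
        (fun a => (η a : ℂ)) ⬝ᵥ ((Tcᵀ * cmat X Y 1 * Tc) *ᵥ fun a => (η a : ℂ)) := by
      rw [Matrix.mul_assoc, ← Matrix.mulVec_mulVec, ← Matrix.mulVec_mulVec,
        Matrix.dotProduct_mulVec _ Tcᵀ, Matrix.vecMul_transpose]
    rw [this, hdiag]
    simp only [dotProduct, Matrix.mulVec_diagonal]
    congr 1
    rw [Finset.mul_sum, ← Finset.sum_neg_distrib]
    refine Finset.sum_congr rfl fun i _ => ?_
    simp only [b]; ring
  have hme : MeasurableEmbedding fun η : n → ℝ => T *ᵥ η := SectorIntegral.measurableEmbedding_mulVec hT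
  have hmap := SectorIntegral.restrict_image_mulVec hT (Set.univ : Set (n → ℝ))
  have hsurj : (fun η : n → ℝ => T *ᵥ η) '' Set.univ = Set.univ := by
    rw [Set.image_univ, Set.range_eq_univ]
    intro y
    refine ⟨T⁻¹ *ᵥ y, ?_⟩
    simp [Matrix.mulVec_mulVec, Matrix.mul_nonsing_inv T (isUnit_iff_ne_zero.2 hT)]
  rw [hsurj, Measure.restrict_univ] at hmap
  have hbpos : ∀ i, 0 < (b 1 i / 2).re := fun i => by
    have := hbre 1 i
    simp [this]
  have hposdet : ENNReal.ofReal |T.det| ≠ 0 := by simpa using hT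
  have hint := GaussianFourier.integrable_cexp_neg_sum_mul_add hbpos (w ᵥ* Tc)
  have hval := GaussianFourier.integral_cexp_neg_sum_mul_add hbpos (w ᵥ* Tc)
  simp_rw [← hform] at hint hval
  constructor
  · rw [hmap, integrable_smul_measure hposdet ENNReal.ofReal_ne_top, hme.integrable_map_iff]
    exact hint
  · conv_lhs => rw [hmap]
    rw [integral_smul_measure, hme.integral_map, hval, ENNReal.toReal_ofReal (abs_nonneg _),
      Finset.prod_mul_distrib, ← Complex.exp_sum, Complex.real_smul, ← mul_assoc]
    congr 1
    · -- the normalization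
      have hNcont : ContinuousOn (fun θ : ℝ => ((|T.det| : ℝ) : ℂ) *
          (∏ i, (Real.pi / (b θ i / 2)) ^ (1 / 2 : ℂ)) * k θ) (Set.Icc 0 1) := by
        refine (continuousOn_const.mul ?_).mul (Complex.continuous_ofReal.comp_continuousOn hk)
        refine Continuous.continuousOn (continuous_finsetProd _ fun i _ => ?_)
        refine Continuous.cpow ?_ continuous_const fun θ => ?_
        · refine Continuous.div continuous_const ?_ fun θ => div_ne_zero (hb0 θ i) two_ne_zero
          simp only [b]; fun_prop
        · left
          have h1 : (Real.pi / (b θ i / 2) : ℂ) = (2 * Real.pi : ℝ) * (b θ i)⁻¹ := by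
            have := hb0 θ i
            push_cast; field_simp
          rw [h1, Complex.re_ofReal_mul, Complex.inv_re, hbre]
          have := Complex.normSq_pos.2 (hb0 θ i)
          have := Real.pi_pos
          positivity
      have hsq : ∀ θ ∈ Set.Icc (0 : ℝ) 1, (((|T.det| : ℝ) : ℂ) *
          (∏ i, (Real.pi / (b θ i / 2)) ^ (1 / 2 : ℂ)) * k θ) ^ 2 =
          (∏ _i : n, (2 * Real.pi : ℂ) ^ (1 / 2 : ℂ)) ^ 2 := by
        intro θ hθ
        have hd : (T.det : ℂ) ^ 2 * (k θ : ℂ) ^ 2 = ∏ i, b θ i := by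
          have := congrArg Matrix.det (hdiag θ)
          rw [Matrix.det_mul, Matrix.det_mul, Matrix.det_transpose, hTcdet, hdet θ hθ,
            Matrix.det_diagonal] at this
          simp only [b]
          rw [← this]; ring
        have hc : ∀ z : ℂ, (z ^ (1 / 2 : ℂ)) ^ 2 = z := fun z => by
          rw [← Complex.cpow_nat_mul]; simp
        have habs : ((|T.det| : ℝ) : ℂ) ^ 2 = (T.det : ℂ) ^ 2 := by
          exact_mod_cast sq_abs T.det
        rw [mul_pow, mul_pow, habs, ← Finset.prod_pow, ← Finset.prod_pow, mul_right_comm, hd,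
          ← Finset.prod_mul_distrib]
        refine Finset.prod_congr rfl fun i _ => ?_
        rw [hc, hc]
        have := hb0 θ i
        field_simp
      have hC : ∀ {x : ℝ}, x ∈ Set.Icc (0 : ℝ) 1 →
          (∏ _i : n, (2 * Real.pi : ℂ) ^ (1 / 2 : ℂ)) ≠ 0 := fun _ => by
        rw [Finset.prod_ne_zero_iff]
        intro i _
        rw [Ne, Complex.cpow_eq_zero_iff]
        have : (2 * Real.pi : ℂ) ≠ 0 := by
          have := Real.pi_ne_zero
          simp
        tauto
      have h0 : ((|T.det| : ℝ) : ℂ) * (∏ i, (Real.pi / (b 0 i / 2)) ^ (1 / 2 : ℂ)) * k 0 =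
          ∏ _i : n, (2 * Real.pi : ℂ) ^ (1 / 2 : ℂ) := by
        have hk0 : |T.det| * k 0 = 1 := by
          have hm : (0 : ℝ) ∈ Set.Icc (0 : ℝ) 1 := by simp
          have h1 := congrArg Matrix.det (hdiag 0)
          rw [Matrix.det_mul, Matrix.det_mul, Matrix.det_transpose, hTcdet, hdet 0 hm,
            Matrix.det_diagonal] at h1
          simp only [Complex.ofReal_zero, mul_zero, zero_mul, add_zero, Finset.prod_const_one] at h1
          have h2 : (|T.det| * k 0) ^ 2 = 1 := by
            rw [mul_pow, sq_abs]
            have : T.det * k 0 ^ 2 * T.det = 1 := by exact_mod_cast h1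
            linarith
          have h3 : 0 < |T.det| * k 0 := mul_pos (abs_pos.2 hT) (hpos 0 hm)
          nlinarith
        have hk0' : ((|T.det| : ℝ) : ℂ) * k 0 = 1 := by exact_mod_cast hk0
        rw [mul_right_comm, hk0', one_mul]
        refine Finset.prod_congr rfl fun i _ => ?_
        congr 1
        simp only [b, Complex.ofReal_zero, mul_zero, zero_mul, add_zero]
        field_simp
      -- The principal square roots have a product that is known only up to sign. Along the path `θ`
      -- both sides are continuous with equal squares, the right side never vanishes, and they agree
      -- at `θ = 0`, where everything is real; hence they agree at `θ = 1`.
      have hmain := isPreconnected_Icc.eq_of_sq_eq hNcont continuousOn_const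
        (fun θ hθ => hsq θ hθ) hC (y := 0) (by simp) h0
      have h1 := hmain (show (1 : ℝ) ∈ Set.Icc (0 : ℝ) 1 by simp)
      have hk1 : (k 1 : ℂ) ≠ 0 := by
        have := hpos 1 (by simp)
        exact_mod_cast this.ne'
      rw [eq_div_iff hk1]
      exact h1
    · -- the exponent
      congr 1
      have hD : Matrix.diagonal (b 1) * Matrix.diagonal (fun i => (b 1 i)⁻¹) = 1 := by
        rw [Matrix.diagonal_mul_diagonal, ← Matrix.diagonal_one]
        congr 1; ext i
        exact mul_inv_cancel₀ (hb0 1 i)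
      have hinv : (cmat X Y 1)⁻¹ = Tc * Matrix.diagonal (fun i => (b 1 i)⁻¹) * Tcᵀ := by
        apply Matrix.inv_eq_right_inv
        have hu : IsUnit Tcᵀ.det := by rw [Matrix.det_transpose]; exact isUnit_iff_ne_zero.2 hTc0
        have h1 : Tcᵀ * (cmat X Y 1 * (Tc * Matrix.diagonal (fun i => (b 1 i)⁻¹) * Tcᵀ)) =
            Tcᵀ * 1 := by
          have : Tcᵀ * (cmat X Y 1 * (Tc * Matrix.diagonal (fun i => (b 1 i)⁻¹) * Tcᵀ)) =
            (Tcᵀ * cmat X Y 1 * Tc) * Matrix.diagonal (fun i => (b 1 i)⁻¹) * Tcᵀ := by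
              simp only [Matrix.mul_assoc]
          rw [this, hdiag, hD, Matrix.one_mul, Matrix.mul_one]
        have h2 := congrArg (fun M => (Tcᵀ)⁻¹ * M) h1
        simpa only [← Matrix.mul_assoc, Matrix.nonsing_inv_mul _ hu, Matrix.one_mul,
          Matrix.mul_one] using h2
      rw [hinv, ← Matrix.mulVec_mulVec, ← Matrix.mulVec_mulVec, Matrix.dotProduct_mulVec w Tc,
        Matrix.mulVec_transpose]
      simp only [dotProduct, Matrix.mulVec_diagonal, Finset.mul_sum]
      refine Finset.sum_congr rfl fun i _ => ?_
      have := hb0 1 i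
      field_simp
      ring

end ComplexGaussian

/-! ### Minors of matrices with a nonnegative form -/

namespace RowMinor

variable {n : Type*} [Fintype n] [DecidableEq n]

/-- The quadratic form of a real matrix is positive semidefinite. -/
def FormNonneg (Z : Matrix n n ℝ) : Prop := ∀ x : n → ℝ, 0 ≤ x ⬝ᵥ (Z *ᵥ x)

/-- On the segment from the identity to `Z` the form stays positive definite, so the determinant has
no zero there and keeps the sign it has at the identity. No symmetry of `Z` is required. -/
theorem det_pos_of_form_pos {Z : Matrix n n ℝ} (hZ : ∀ x : n → ℝ, x ≠ 0 → 0 < x ⬝ᵥ (Z *ᵥ x)) :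
    0 < Z.det := by
  let h : ℝ → ℝ := fun θ => ((1 - θ) • (1 : Matrix n n ℝ) + θ • Z).det
  have hcont : ContinuousOn h (Set.Icc 0 1) := by
    refine Continuous.continuousOn (Continuous.matrix_det ?_)
    fun_prop
  have hne : ∀ θ ∈ Set.Icc (0 : ℝ) 1, h θ ≠ 0 := by
    intro θ hθ h0
    obtain ⟨x, hx, hx0⟩ := Matrix.exists_mulVec_eq_zero_iff.2 h0
    have h1 : x ⬝ᵥ (((1 - θ) • (1 : Matrix n n ℝ) + θ • Z) *ᵥ x) = 0 := by rw [hx0]; simp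
    rw [Matrix.add_mulVec, Matrix.smul_mulVec, Matrix.smul_mulVec, Matrix.one_mulVec,
      dotProduct_add, dotProduct_smul, dotProduct_smul, smul_eq_mul, smul_eq_mul] at h1
    have h2 := hZ x hx
    have h3 : 0 < x ⬝ᵥ x := by
      have := Matrix.dotProduct_star_self_pos_iff (v := x)
      simpa using this.2 hx
    rcases eq_or_lt_of_le hθ.1 with h4 | h4
    · rw [← h4] at h1; linarith
    · have := mul_pos h4 h2
      have := mul_nonneg (sub_nonneg.2 hθ.2) h3.le
      linarith
  by_contra hcon
  have h1 : h 1 ≤ 0 := by simpa [h] using not_lt.1 hcon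
  have h0 : h 0 = 1 := by simp [h]
  obtain ⟨θ, hθ, hθ0⟩ := intermediate_value_Icc' zero_le_one hcont
    (show (0 : ℝ) ∈ Set.Icc (h 1) (h 0) from ⟨h1, by rw [h0]; exact zero_le_one⟩)
  exact hne θ hθ hθ0

theorem FormNonneg.det_nonneg {Z : Matrix n n ℝ} (hZ : FormNonneg Z) : 0 ≤ Z.det := by
  have hc : Continuous fun ε : ℝ => (Z + ε • (1 : Matrix n n ℝ)).det :=
    Continuous.matrix_det (by fun_prop)
  have hlim : Filter.Tendsto (fun ε : ℝ => (Z + ε • (1 : Matrix n n ℝ)).det)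
      (nhdsWithin 0 (Set.Ioi 0)) (nhds Z.det) := by
    have := (hc.tendsto 0).mono_left (nhdsWithin_le_nhds (s := Set.Ioi 0))
    simpa using this
  refine ge_of_tendsto hlim ?_
  filter_upwards [self_mem_nhdsWithin] with ε hε
  refine (det_pos_of_form_pos fun x hx => ?_).le
  rw [Matrix.add_mulVec, Matrix.smul_mulVec, Matrix.one_mulVec, dotProduct_add, dotProduct_smul,
    smul_eq_mul]
  have h3 : 0 < x ⬝ᵥ x := by
    have := Matrix.dotProduct_star_self_pos_iff (v := x)
    simpa using this.2 hx
  have := mul_pos (Set.mem_Ioi.1 hε) h3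
  linarith [hZ x]

/-- The rows of the identity matrix. -/
def unitRows : n → n → ℝ := fun i => Pi.single i 1

/-- The rows of a matrix. -/
def rows (Z : Matrix n n ℝ) : n → n → ℝ := fun i j => Z i j

/-- The determinant of the matrix whose rows in `J` are replaced by those of the identity. -/
def rowMinor (J : Finset n) (Z : Matrix n n ℝ) : ℝ :=
  (Matrix.of (J.piecewise unitRows (rows Z))).det

theorem rowMinor_empty (Z : Matrix n n ℝ) : rowMinor ∅ Z = Z.det := by
  rw [rowMinor, Finset.piecewise_empty]; rfl

/-- Each row in `T` is the old row plus `a_i` times a unit row. Multilinearity of the determinant in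
these rows gives the expansion; this is the source of all the polynomials in `t`. -/
theorem rowMinor_add_diagonal (Z : Matrix n n ℝ) (a : n → ℝ) {J T : Finset n}
    (hJT : Disjoint J T) (ha : ∀ i, i ∉ T → a i = 0) :
    rowMinor J (Z + Matrix.diagonal a) =
      ∑ K ∈ T.powerset, (∏ i ∈ K, a i) * rowMinor (J ∪ K) Z := by
  have h1 : J.piecewise unitRows (rows (Z + Matrix.diagonal a)) =
      T.piecewise ((fun i => a i • unitRows i) + J.piecewise unitRows (rows Z))
        (J.piecewise unitRows (rows Z)) := by
    funext i
    by_cases hi : i ∈ T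
    · have hiJ : i ∉ J := fun h => Finset.disjoint_left.1 hJT h hi
      rw [Finset.piecewise_eq_of_notMem _ _ _ hiJ, Finset.piecewise_eq_of_mem _ _ _ hi,
        Pi.add_apply, Finset.piecewise_eq_of_notMem _ _ _ hiJ]
      funext j
      simp only [rows, unitRows, Matrix.add_apply, Pi.add_apply, Pi.smul_apply, smul_eq_mul]
      rw [add_comm, Matrix.diagonal_apply, Pi.single_apply]
      by_cases h : i = j <;> simp [h, eq_comm]
    · rw [Finset.piecewise_eq_of_notMem _ _ _ hi]
      by_cases hiJ : i ∈ J
      · rw [Finset.piecewise_eq_of_mem _ _ _ hiJ, Finset.piecewise_eq_of_mem _ _ _ hiJ]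
      · rw [Finset.piecewise_eq_of_notMem _ _ _ hiJ, Finset.piecewise_eq_of_notMem _ _ _ hiJ]
        funext j
        simp [rows, Matrix.diagonal_apply, ha i hi]
  have h2 := MultilinearMap.map_piecewise_add (Matrix.detRowAlternating (n := n) (R := ℝ)).toMultilinearMap
    (fun i => a i • unitRows i) (J.piecewise unitRows (rows Z)) T
  rw [← h1] at h2
  refine Eq.trans h2 (Finset.sum_congr rfl fun K _ => ?_)
  have h3 : K.piecewise (fun i => a i • unitRows i) (J.piecewise unitRows (rows Z)) =
      K.piecewise (fun i => a i • ((J ∪ K).piecewise unitRows (rows Z)) i)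
        ((J ∪ K).piecewise unitRows (rows Z)) := by
    funext i
    by_cases hi : i ∈ K
    · simp [Finset.piecewise, hi]
    · simp [Finset.piecewise, hi]
  rw [h3, MultilinearMap.map_piecewise_smul, smul_eq_mul]
  rfl

theorem rowMinor_updateRow {J : Finset n} {j : n} (hj : j ∉ J) (Z : Matrix n n ℝ) (r : n → ℝ) :
    rowMinor J (Z.updateRow j r) =
      ((Matrix.of (J.piecewise unitRows (rows Z))).updateRow j r).det := by
  rw [rowMinor]
  congr 1
  ext i k
  by_cases hi : i = j
  · subst hi
    simp [Finset.piecewise, hj, rows]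
  · by_cases hJ : i ∈ J <;> simp [Finset.piecewise, hi, hJ, rows]

/-- With `p` the projection on `J` and `q = 1 - p`, the matrix is `p + q Z = (1 + q Z p) (p + q Z
q)`. The first factor has determinant 1 because `p q = 0`, and the second has a nonnegative form. -/
theorem FormNonneg.rowMinor_nonneg {Z : Matrix n n ℝ} (hZ : FormNonneg Z) (J : Finset n) :
    0 ≤ rowMinor J Z := by
  let p : Matrix n n ℝ := Matrix.diagonal fun i => if i ∈ J then 1 else 0
  let q : Matrix n n ℝ := Matrix.diagonal fun i => if i ∈ J then 0 else 1
  have hpq : p * q = 0 := by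
    simp only [p, q, Matrix.diagonal_mul_diagonal]
    rw [← Matrix.diagonal_zero]; congr 1; ext i; split_ifs <;> simp
  have hpp : p * p = p := by
    simp only [p, Matrix.diagonal_mul_diagonal]
    congr 1; ext i; split_ifs <;> simp
  have hsum : p + q = 1 := by
    simp only [p, q, Matrix.diagonal_add]
    rw [← Matrix.diagonal_one]; congr 1; ext i; split_ifs <;> simp
  have h1 : Matrix.of (J.piecewise unitRows (rows Z)) = p + q * Z := by
    ext i k
    by_cases hi : i ∈ J
    · simp [Finset.piecewise, hi, p, q, Matrix.diagonal_apply, unitRows, Pi.single_apply, eq_comm]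
    · simp [Finset.piecewise, hi, p, q, Matrix.diagonal_apply, rows]
  have h2 : p + q * Z = (1 + q * Z * p) * (p + q * Z * q) := by
    have e1 : q * Z * p * (p + q * Z * q) = q * Z * p := by
      rw [Matrix.mul_add, Matrix.mul_assoc (q * Z) p p, hpp]
      have : q * Z * p * (q * Z * q) = q * Z * (p * q) * (Z * q) := by
        simp only [Matrix.mul_assoc]
      rw [this, hpq]; simp
    rw [Matrix.add_mul, Matrix.one_mul, e1, add_assoc, ← Matrix.mul_add, add_comm q p, hsum,
      Matrix.mul_one]
  have h3 : (1 + q * Z * p).det = 1 := by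
    rw [Matrix.det_one_add_mul_comm, ← Matrix.mul_assoc, hpq]; simp
  rw [rowMinor, h1, h2, Matrix.det_mul, h3, one_mul]
  refine FormNonneg.det_nonneg fun x => ?_
  have h4 : x ⬝ᵥ ((p + q * Z * q) *ᵥ x) = x ⬝ᵥ (p *ᵥ x) + (q *ᵥ x) ⬝ᵥ (Z *ᵥ (q *ᵥ x)) := by
    rw [Matrix.add_mulVec, dotProduct_add, ← Matrix.mulVec_mulVec, ← Matrix.mulVec_mulVec,
      Matrix.dotProduct_mulVec x q]
    congr 2
    ext i
    simp [q, Matrix.mulVec_diagonal, Matrix.vecMul_diagonal, mul_comm]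
  rw [h4]
  refine add_nonneg (Finset.sum_nonneg fun i _ => ?_) (hZ _)
  simp only [p, Matrix.mulVec_diagonal]
  split_ifs
  · nlinarith [mul_self_nonneg (x i)]
  · simp

/-- Perturbing one entry bounds the minor of the matrix with a unit row. -/
theorem abs_rowMinor_updateRow_le {Z : Matrix n n ℝ} {i j : n}
    (hZ : ∀ s : ℝ, |s| ≤ 1 → FormNonneg (Z.updateRow j (Z j + s • Pi.single i 1)))
    {J : Finset n} (hj : j ∉ J) :
    |rowMinor J (Z.updateRow j (Pi.single i 1))| ≤ rowMinor J Z := by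
  have key : ∀ s : ℝ, |s| ≤ 1 →
      0 ≤ rowMinor J Z + s * rowMinor J (Z.updateRow j (Pi.single i 1)) := by
    intro s hs
    have h := (hZ s hs).rowMinor_nonneg J
    rw [rowMinor_updateRow hj, Matrix.det_updateRow_add, Matrix.det_updateRow_smul] at h
    rw [rowMinor_updateRow hj]
    have : (Matrix.of (J.piecewise unitRows (rows Z))).updateRow j (Z j) =
        Matrix.of (J.piecewise unitRows (rows Z)) := by
      conv_rhs => rw [← Matrix.updateRow_eq_self (Matrix.of (J.piecewise unitRows (rows Z))) j]
      congr 1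
      funext k
      simp [Finset.piecewise, hj, rows]
    rw [this] at h
    exact h
  -- The minor is affine in the perturbation `s`; nonnegativity at `s = 1` and `s = -1` bounds its
  -- slope.
  rw [abs_le]
  have h1 := key 1 (by simp)
  have h2 := key (-1) (by simp)
  constructor <;> linarith

end RowMinor

/-! ### Coefficients of the block determinants -/

namespace RowMinor

variable {E I : Type*} [Fintype E] [DecidableEq E] [Fintype I] [DecidableEq I]

theorem form_skew {n : Type*} [Fintype n] {B : Matrix n n ℝ} (hB : Bᵀ = -B) (x : n → ℝ) :
    x ⬝ᵥ (B *ᵥ x) = 0 := by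
  have h1 : x ⬝ᵥ (B *ᵥ x) = x ⬝ᵥ (Bᵀ *ᵥ x) := by
    rw [Matrix.dotProduct_mulVec, Matrix.mulVec_transpose, dotProduct_comm]
  rw [hB, Matrix.neg_mulVec, dotProduct_neg] at h1
  linarith

theorem form_diagonal {n : Type*} [Fintype n] [DecidableEq n] (a x : n → ℝ) :
    x ⬝ᵥ (Matrix.diagonal a *ᵥ x) = ∑ i, a i * x i ^ 2 := by
  simp only [dotProduct, Matrix.mulVec_diagonal]
  exact Finset.sum_congr rfl fun i _ => by ring

/-- The skew matrix with the identity added on the external block. -/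
def withExt (B : Matrix (E ⊕ I) (E ⊕ I) ℝ) : Matrix (E ⊕ I) (E ⊕ I) ℝ :=
  B + Matrix.diagonal (Sum.elim (fun _ => 1) fun _ => 0)

/-- The coefficients of the determinant of the internal block. -/
def intCoeff (B : Matrix (E ⊕ I) (E ⊕ I) ℝ) (J : Finset I) : ℝ :=
  rowMinor (Finset.univ.map Function.Embedding.inl ∪ J.map Function.Embedding.inr) B

/-- The coefficients of the determinant with unit external part. -/
def fullCoeff (B : Matrix (E ⊕ I) (E ⊕ I) ℝ) (J : Finset I) : ℝ :=
  rowMinor (J.map Function.Embedding.inr) (withExt B)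

/-- The coefficients of the cofactors of the external block. -/
def entryCoeff (B : Matrix (E ⊕ I) (E ⊕ I) ℝ) (i j : E) (J : Finset I) : ℝ :=
  rowMinor (J.map Function.Embedding.inr)
    ((withExt B).updateRow (Sum.inl j) (Pi.single (Sum.inl i) 1))

variable {B : Matrix (E ⊕ I) (E ⊕ I) ℝ}

theorem sum_powerset_map {α β : Type*} (f : α ↪ β) (T : Finset α) (g : Finset β → ℝ) :
    ∑ K ∈ (T.map f).powerset, g K = ∑ J ∈ T.powerset, g (J.map f) := by
  symm
  refine Finset.sum_bij (fun J _ => J.map f) ?_ ?_ ?_ ?_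
  · intro J hJ
    exact Finset.mem_powerset.2 (Finset.map_subset_map.2 (Finset.mem_powerset.1 hJ))
  · intro J _ J' _ h
    exact Finset.map_injective _ h
  · intro K hK
    obtain ⟨u, hu, rfl⟩ := Finset.subset_map_iff.1 (Finset.mem_powerset.1 hK)
    exact ⟨u, Finset.mem_powerset.2 hu, rfl⟩
  · intro J _
    rfl

theorem disjoint_inl_inr (T : Finset I) :
    Disjoint ((Finset.univ : Finset E).map Function.Embedding.inl)
      (T.map (Function.Embedding.inr (α := E))) := by
  rw [Finset.disjoint_left]
  simp

theorem elim_eq_zero {T : Finset I} {a : I → ℝ} (ha : ∀ i, i ∉ T → a i = 0) :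
    ∀ i : E ⊕ I, i ∉ T.map Function.Embedding.inr → Sum.elim (fun _ => (0 : ℝ)) a i = 0 := by
  rintro (i | i) hi
  · rfl
  · exact ha i fun h => hi (by simpa using h)

theorem rowMinor_inl (Z : Matrix (E ⊕ I) (E ⊕ I) ℝ) :
    rowMinor ((Finset.univ : Finset E).map Function.Embedding.inl) Z = (Z.toBlocks₂₂).det := by
  rw [rowMinor]
  have : (Matrix.of (((Finset.univ : Finset E).map Function.Embedding.inl).piecewise unitRows
      (rows Z))) = Matrix.fromBlocks 1 0 Z.toBlocks₂₁ Z.toBlocks₂₂ := by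
    ext (i | i) (j | j)
    · simp [Finset.piecewise, unitRows, Matrix.one_apply, Pi.single_apply, eq_comm]
    · simp [Finset.piecewise, unitRows]
    · simp [Finset.piecewise, rows]
      rfl
    · simp [Finset.piecewise, rows]
      rfl
  rw [this, Matrix.det_fromBlocks_zero₁₂, Matrix.det_one, one_mul]

theorem det_toBlocks₂₂_eq (B : Matrix (E ⊕ I) (E ⊕ I) ℝ) {T : Finset I} {a : I → ℝ}
    (ha : ∀ i, i ∉ T → a i = 0) :
    ((B + Matrix.diagonal (Sum.elim (fun _ => 0) a)).toBlocks₂₂).det =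
      ∑ J ∈ T.powerset, (∏ i ∈ J, a i) * intCoeff B J := by
  rw [← rowMinor_inl, rowMinor_add_diagonal B _ (disjoint_inl_inr T) (elim_eq_zero ha),
    sum_powerset_map]
  refine Finset.sum_congr rfl fun J _ => ?_
  rw [Finset.prod_map]
  rfl

theorem add_diagonal_eq (B : Matrix (E ⊕ I) (E ⊕ I) ℝ) (a : I → ℝ) :
    B + Matrix.diagonal (Sum.elim (fun _ => 1) a) =
      withExt B + Matrix.diagonal (Sum.elim (fun _ => 0) a) := by
  rw [withExt, add_assoc, Matrix.diagonal_add]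
  congr 2
  funext i
  rcases i with i | i <;> simp

theorem det_full_eq (B : Matrix (E ⊕ I) (E ⊕ I) ℝ) {T : Finset I} {a : I → ℝ}
    (ha : ∀ i, i ∉ T → a i = 0) :
    (B + Matrix.diagonal (Sum.elim (fun _ => 1) a)).det =
      ∑ J ∈ T.powerset, (∏ i ∈ J, a i) * fullCoeff B J := by
  rw [add_diagonal_eq, ← rowMinor_empty, rowMinor_add_diagonal _ _ (Finset.disjoint_empty_left _)
    (elim_eq_zero ha), sum_powerset_map]
  refine Finset.sum_congr rfl fun J _ => ?_
  rw [Finset.prod_map, Finset.empty_union]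
  rfl

theorem det_entry_eq (B : Matrix (E ⊕ I) (E ⊕ I) ℝ) {T : Finset I} {a : I → ℝ}
    (ha : ∀ i, i ∉ T → a i = 0) (i j : E) :
    ((B + Matrix.diagonal (Sum.elim (fun _ => 1) a)).updateRow (Sum.inl j)
      (Pi.single (Sum.inl i) 1)).det =
      ∑ J ∈ T.powerset, (∏ i ∈ J, a i) * entryCoeff B i j J := by
  have h : (B + Matrix.diagonal (Sum.elim (fun _ => 1) a)).updateRow (Sum.inl j)
      (Pi.single (Sum.inl i) 1) = (withExt B).updateRow (Sum.inl j) (Pi.single (Sum.inl i) 1) +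
        Matrix.diagonal (Sum.elim (fun _ => 0) a) := by
    rw [add_diagonal_eq]
    ext k l
    by_cases hk : k = Sum.inl j
    · subst hk
      rcases l with l | l <;> simp [Matrix.diagonal_apply]
    · simp [hk]
  rw [h, ← rowMinor_empty, rowMinor_add_diagonal _ _ (Finset.disjoint_empty_left _)
    (elim_eq_zero ha), sum_powerset_map]
  refine Finset.sum_congr rfl fun J _ => ?_
  rw [Finset.prod_map, Finset.empty_union]
  rfl

theorem intCoeff_nonneg (hB : Bᵀ = -B) (J : Finset I) : 0 ≤ intCoeff B J :=
  FormNonneg.rowMinor_nonneg (fun x => (form_skew hB x).ge) _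

/-- Expanding the unit external diagonal writes the full coefficient as a sum of nonnegative minors,
one of which is the internal coefficient. -/
theorem intCoeff_le_fullCoeff (hB : Bᵀ = -B) (J : Finset I) : intCoeff B J ≤ fullCoeff B J := by
  rw [fullCoeff, withExt, rowMinor_add_diagonal B _ (disjoint_inl_inr J).symm]
  · have := Finset.single_le_sum (s := ((Finset.univ : Finset E).map
      (Function.Embedding.inl (β := I))).powerset)
      (f := fun K => (∏ i ∈ K, Sum.elim (fun _ => (1 : ℝ)) (fun _ => 0) i) *
        rowMinor (J.map Function.Embedding.inr ∪ K) B) ?_ (Finset.mem_powerset_self _)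
    · refine le_trans (le_of_eq ?_) this
      rw [Finset.prod_map, Finset.union_comm]
      simp [intCoeff]
    · intro K _
      refine mul_nonneg (Finset.prod_nonneg ?_)
        (FormNonneg.rowMinor_nonneg (fun x => (form_skew hB x).ge) _)
      rintro (i | i) _ <;> simp
  · rintro (i | i) hi
    · simp at hi
    · rfl

/-- The identity added on the external block leaves room for a perturbation of one external entry by
`s` with `|s| ≤ 1`: it changes the form by `s x_i x_j`, which `∑ x_k²` dominates. The bound makes
the quotients `N / P` regular wherever `P` can be reduced. -/
theorem abs_entryCoeff_le (hB : Bᵀ = -B) (i j : E) (J : Finset I) :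
    |entryCoeff B i j J| ≤ fullCoeff B J := by
  refine abs_rowMinor_updateRow_le (fun s hs x => ?_) (by simp)
  have h1 : (withExt B).updateRow (Sum.inl j) (withExt B (Sum.inl j) +
      s • Pi.single (Sum.inl i) 1) = withExt B + Matrix.single (Sum.inl j) (Sum.inl i) s := by
    ext k l
    by_cases hk : k = Sum.inl j
    · subst hk
      simp [Matrix.single_apply, Pi.single_apply, eq_comm]
    · simp [hk, Ne.symm hk]
  have h2 : x ⬝ᵥ (Matrix.single (Sum.inl j) (Sum.inl i) s *ᵥ x) =
      s * (x (Sum.inl j) * x (Sum.inl i)) := by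
    rw [Matrix.single_mulVec]
    simp [Function.update_apply, dotProduct]
    ring
  rw [h1, withExt, Matrix.add_mulVec, Matrix.add_mulVec, dotProduct_add, dotProduct_add,
    form_skew hB, form_diagonal, h2, Fintype.sum_sum_type]
  simp only [Sum.elim_inl, one_mul, Sum.elim_inr, zero_mul, Finset.sum_const_zero, add_zero,
    zero_add]
  have h3 : |s * (x (Sum.inl j) * x (Sum.inl i))| ≤ ∑ k, x (Sum.inl k : E ⊕ I) ^ 2 := by
    have h4 : |s * (x (Sum.inl j) * x (Sum.inl i))| ≤ |x (Sum.inl j) * x (Sum.inl i)| := by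
      rw [abs_mul]
      exact mul_le_of_le_one_left (abs_nonneg _) hs
    refine h4.trans ?_
    by_cases hij : i = j
    · subst hij
      rw [abs_mul_self, ← sq]
      exact Finset.single_le_sum (f := fun k => x (Sum.inl k : E ⊕ I) ^ 2)
        (fun k _ => sq_nonneg _) (Finset.mem_univ i)
    · have h5 : ∑ k ∈ ({i, j} : Finset E), x (Sum.inl k : E ⊕ I) ^ 2 ≤
          ∑ k, x (Sum.inl k : E ⊕ I) ^ 2 :=
        Finset.sum_le_sum_of_subset_of_nonneg (Finset.subset_univ _) fun k _ _ => sq_nonneg _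
      rw [Finset.sum_pair hij] at h5
      refine le_trans ?_ h5
      rw [abs_le]
      constructor <;> nlinarith [sq_nonneg (x (Sum.inl i) - x (Sum.inl j)),
        sq_nonneg (x (Sum.inl i) + x (Sum.inl j))]
  linarith [(abs_le.1 h3).1]

/-! ### The Schur complement -/

/-- The Schur complement of the internal block. -/
def schur (Z : Matrix (E ⊕ I) (E ⊕ I) ℝ) : Matrix E E ℝ :=
  Z.toBlocks₁₁ - Z.toBlocks₁₂ * (Z.toBlocks₂₂)⁻¹ * Z.toBlocks₂₁

/-- The form of the Schur complement at `x` is that of `Z` at `(x, y)`, where `y` solves the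
internal equations. -/
theorem schur_form_nonneg {Z : Matrix (E ⊕ I) (E ⊕ I) ℝ} (hZ : FormNonneg Z)
    (hdet : Z.toBlocks₂₂.det ≠ 0) : FormNonneg (schur Z) := by
  intro x
  have hu := isUnit_iff_ne_zero.2 hdet
  set y : I → ℝ := -((Z.toBlocks₂₂)⁻¹ *ᵥ (Z.toBlocks₂₁ *ᵥ x)) with hy
  have h := hZ (Sum.elim x y)
  have h2 : Z.toBlocks₂₁ *ᵥ x + Z.toBlocks₂₂ *ᵥ y = 0 := by
    rw [hy, Matrix.mulVec_neg, Matrix.mulVec_mulVec, Matrix.mul_nonsing_inv _ hu,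
      Matrix.one_mulVec, add_neg_cancel]
  have h1 : Z.toBlocks₁₁ *ᵥ x + Z.toBlocks₁₂ *ᵥ y = schur Z *ᵥ x := by
    rw [hy, Matrix.mulVec_neg, schur, Matrix.sub_mulVec, ← Matrix.mulVec_mulVec,
      ← Matrix.mulVec_mulVec, sub_eq_add_neg]
  rw [← Matrix.fromBlocks_toBlocks Z, Matrix.fromBlocks_mulVec] at h
  simp only [Sum.elim_comp_inl, Sum.elim_comp_inr, h1, h2] at h
  simpa [dotProduct, Fintype.sum_sum_type] using h

theorem det_full_eq_mul {Z : Matrix (E ⊕ I) (E ⊕ I) ℝ} (hdet : Z.toBlocks₂₂.det ≠ 0) :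
    (Z + Matrix.diagonal (Sum.elim (fun _ => 1) fun _ => 0)).det =
      Z.toBlocks₂₂.det * (1 + schur Z).det := by
  have hu := isUnit_iff_ne_zero.2 hdet
  let _ := Matrix.invertibleOfIsUnitDet _ hu
  have h : Z + Matrix.diagonal (Sum.elim (fun _ => 1) fun _ => 0) =
      Matrix.fromBlocks (1 + Z.toBlocks₁₁) Z.toBlocks₁₂ Z.toBlocks₂₁ Z.toBlocks₂₂ := by
    ext (i | i) (j | j)
    · simp [Matrix.toBlocks₁₁, Matrix.diagonal_apply, Matrix.one_apply, add_comm]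
    · simp [Matrix.toBlocks₁₂]
    · simp [Matrix.toBlocks₂₁]
    · simp [Matrix.toBlocks₂₂, Matrix.diagonal_apply]
  rw [h, Matrix.det_fromBlocks₂₂, Matrix.invOf_eq_nonsing_inv, schur, add_sub_assoc]

/-- The inverse of the Schur complement is the external block of the inverse of the full matrix, and
Cramer's rule writes its entries as quotients of determinants that are polynomial in `t` up to a
common factor. -/
theorem inv_one_add_schur {Z : Matrix (E ⊕ I) (E ⊕ I) ℝ} (hdet : Z.toBlocks₂₂.det ≠ 0)
    (hfull : (Z + Matrix.diagonal (Sum.elim (fun _ => 1) fun _ => 0)).det ≠ 0) (i j : E) :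
    (1 + schur Z)⁻¹ i j = ((Z + Matrix.diagonal (Sum.elim (fun _ => 1) fun _ => 0)).updateRow
      (Sum.inl j) (Pi.single (Sum.inl i) 1)).det /
        (Z + Matrix.diagonal (Sum.elim (fun _ => 1) fun _ => 0)).det := by
  have hu := isUnit_iff_ne_zero.2 hdet
  set F := Z + Matrix.diagonal (Sum.elim (fun _ : E => (1 : ℝ)) fun _ : I => 0) with hF
  have h : F = Matrix.fromBlocks (1 + Z.toBlocks₁₁) Z.toBlocks₁₂ Z.toBlocks₂₁ Z.toBlocks₂₂ := by
    ext (i | i) (j | j)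
    · simp [F, Matrix.toBlocks₁₁, Matrix.diagonal_apply, Matrix.one_apply, add_comm]
    · simp [F, Matrix.toBlocks₁₂]
    · simp [F, Matrix.toBlocks₂₁]
    · simp [F, Matrix.toBlocks₂₂, Matrix.diagonal_apply]
  have h1 : F * F⁻¹ = 1 := Matrix.mul_nonsing_inv _ (isUnit_iff_ne_zero.2 hfull)
  have h2 : (1 + schur Z)⁻¹ = F⁻¹.toBlocks₁₁ := by
    apply Matrix.inv_eq_right_inv
    rw [← Matrix.fromBlocks_toBlocks F⁻¹, ← Matrix.fromBlocks_one] at h1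
    conv at h1 => lhs; lhs; rw [h]
    rw [Matrix.fromBlocks_multiply, Matrix.fromBlocks_inj] at h1
    obtain ⟨e1, -, e2, -⟩ := h1
    have e3 : (Z.toBlocks₂₂)⁻¹ * (Z.toBlocks₂₁ * F⁻¹.toBlocks₁₁ + Z.toBlocks₂₂ * F⁻¹.toBlocks₂₁) =
      0 := by rw [e2, Matrix.mul_zero]
    rw [Matrix.mul_add, ← Matrix.mul_assoc _ Z.toBlocks₂₂, Matrix.nonsing_inv_mul _ hu,
      Matrix.one_mul, ← Matrix.mul_assoc] at e3
    have e4 := eq_neg_of_add_eq_zero_right e3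
    rw [e4] at e1
    refine Eq.trans ?_ e1
    rw [schur, Matrix.mul_neg, ← sub_eq_add_neg, ← add_sub_assoc, Matrix.sub_mul]
    simp only [Matrix.mul_assoc]
  rw [h2, Matrix.toBlocks₁₁, Matrix.of_apply, Matrix.inv_def, Matrix.smul_apply,
    Matrix.adjugate_apply, Ring.inverse_eq_inv', smul_eq_mul, div_eq_inv_mul]

end RowMinor

/-! ### The short time Fourier transform of Schwartz functions -/

namespace CoherentDecomposition

open SchwartzMap FourierTransform
open scoped ContDiff RealInnerProductSpace

variable {V : Type*} [NormedAddCommGroup V] [InnerProductSpace ℝ V] [FiniteDimensional ℝ V]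
  [MeasurableSpace V] [BorelSpace V]

theorem sum_apply {κ : Type*} (s : Finset κ) (q : κ → Seminorm ℂ 𝓢(V, ℂ)) (f : 𝓢(V, ℂ)) :
    (∑ m ∈ s, q m) f = ∑ m ∈ s, q m f := by
  change FunLike.coeAddMonoidHom _ _ _ (∑ m ∈ s, q m) f = _
  simp_rw [map_sum, Finset.sum_apply]
  rfl

/-- The product of a Schwartz function with a translated window. -/
def windowed (w : 𝓢(V, ℂ)) (a : V) (f : 𝓢(V, ℂ)) : 𝓢(V, ℂ) :=
  pairing (ContinuousLinearMap.mul ℂ ℂ) f (compSubConstCLM ℂ a w)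

theorem windowed_apply (w : 𝓢(V, ℂ)) (a : V) (f : 𝓢(V, ℂ)) (y : V) :
    windowed w a f y = f y * w (y - a) := rfl

theorem windowed_coe (w : 𝓢(V, ℂ)) (a : V) (f : 𝓢(V, ℂ)) :
    ⇑(windowed w a f) = fun y => f y * w (y - a) := rfl

theorem one_add_norm_le (y a : V) : 1 + ‖a‖ ≤ (1 + ‖y‖) * (1 + ‖y - a‖) := by
  have h1 : ‖a‖ ≤ ‖y‖ + ‖y - a‖ := by
    have := norm_sub_le y (y - a)
    simpa using this
  nlinarith [mul_nonneg (norm_nonneg y) (norm_nonneg (y - a))]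

/-- By `one_add_norm_le` a weight in `a` is paid by weights in `y` and in `y - a`, which the decay
of `f` and of the window supply. The Leibniz rule distributes the derivatives. -/
theorem exists_bound_seminorm_windowed (w : 𝓢(V, ℂ)) (k p n : ℕ) :
    ∃ q : Seminorm ℂ 𝓢(V, ℂ), Continuous q ∧ ∀ f a,
      (1 + ‖a‖) ^ k * SchwartzMap.seminorm ℂ p n (windowed w a f) ≤ q f := by
  let q1 : Seminorm ℂ 𝓢(V, ℂ) :=
    (Finset.Iic (p + k, n)).sup fun m => SchwartzMap.seminorm ℂ m.1 m.2
  let w1 : ℝ := 2 ^ k * (Finset.Iic (k, n)).sup (fun m => SchwartzMap.seminorm ℂ m.1 m.2) w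
  have hw1 : 0 ≤ w1 := by positivity
  let C : ℝ := ∑ i ∈ Finset.range (n + 1), (n.choose i : ℝ) * 2 ^ (p + k) * w1
  have hC : 0 ≤ C := by positivity
  refine ⟨C.toNNReal • q1, ?_, fun f a => ?_⟩
  · have : Continuous q1 := Seminorm.continuous_finsetSup fun m _ =>
      (schwartz_withSeminorms ℂ V ℂ).continuous_seminorm m
    exact this.const_smul C.toNNReal
  have hpos : 0 < (1 + ‖a‖) ^ k := by positivity
  rw [_root_.smul_apply, NNReal.smul_def, Real.coe_toNNReal _ hC, smul_eq_mul, mul_comm,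
    ← le_div_iff₀ hpos]
  refine SchwartzMap.seminorm_le_bound ℂ p n _ (by positivity) fun y => ?_
  rw [le_div_iff₀ hpos, windowed_coe]
  have hle := norm_iteratedFDeriv_mul_le (𝕜 := ℝ) (N := ∞) f.smooth'
    (w.smooth'.comp (contDiff_id.sub contDiff_const) : ContDiff ℝ ∞ fun y : V => w (y - a)) y
    (n := n) (by exact_mod_cast le_top)
  have hterm : ∀ i ∈ Finset.range (n + 1),
      (‖y‖ ^ p * (1 + ‖a‖) ^ k) * ((n.choose i : ℝ) * ‖iteratedFDeriv ℝ i f y‖ *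
        ‖iteratedFDeriv ℝ (n - i) (fun y => w (y - a)) y‖) ≤
      (n.choose i : ℝ) * 2 ^ (p + k) * w1 * q1 f := by
    intro i hi
    rw [iteratedFDeriv_comp_sub]
    have hi' : i ≤ n := Nat.lt_succ_iff.1 (Finset.mem_range.1 hi)
    have h1 := one_add_le_sup_seminorm_apply (𝕜 := ℂ) (m := (p + k, n)) (k := p + k) (n := i)
      le_rfl hi' f y
    have h2 := one_add_le_sup_seminorm_apply (𝕜 := ℂ) (m := (k, n)) (k := k) (n := n - i)
      le_rfl (Nat.sub_le _ _) w (y - a)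
    have h3 : ‖y‖ ^ p * (1 + ‖a‖) ^ k ≤ (1 + ‖y‖) ^ (p + k) * (1 + ‖y - a‖) ^ k := by
      rw [pow_add, mul_assoc, ← mul_pow]
      gcongr
      · linarith
      · exact one_add_norm_le y a
    calc (‖y‖ ^ p * (1 + ‖a‖) ^ k) * ((n.choose i : ℝ) * ‖iteratedFDeriv ℝ i f y‖ *
          ‖iteratedFDeriv ℝ (n - i) w (y - a)‖)
        ≤ ((1 + ‖y‖) ^ (p + k) * (1 + ‖y - a‖) ^ k) * ((n.choose i : ℝ) *
          ‖iteratedFDeriv ℝ i f y‖ * ‖iteratedFDeriv ℝ (n - i) w (y - a)‖) := by gcongr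
      _ = (n.choose i : ℝ) * ((1 + ‖y‖) ^ (p + k) * ‖iteratedFDeriv ℝ i f y‖) *
          ((1 + ‖y - a‖) ^ k * ‖iteratedFDeriv ℝ (n - i) w (y - a)‖) := by ring
      _ ≤ (n.choose i : ℝ) * (2 ^ (p + k) * q1 f) * w1 := by gcongr
      _ = _ := by ring
  calc ‖y‖ ^ p * ‖iteratedFDeriv ℝ n (fun y => f y * w (y - a)) y‖ * (1 + ‖a‖) ^ k
      = (‖y‖ ^ p * (1 + ‖a‖) ^ k) * ‖iteratedFDeriv ℝ n (fun y => f y * w (y - a)) y‖ := by ring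
    _ ≤ (‖y‖ ^ p * (1 + ‖a‖) ^ k) * ∑ i ∈ Finset.range (n + 1), (n.choose i : ℝ) *
        ‖iteratedFDeriv ℝ i f y‖ * ‖iteratedFDeriv ℝ (n - i) (fun y => w (y - a)) y‖ := by gcongr; exact hle
    _ ≤ ∑ i ∈ Finset.range (n + 1), (n.choose i : ℝ) * 2 ^ (p + k) * w1 * q1 f := by
        rw [Finset.mul_sum]
        exact Finset.sum_le_sum hterm
    _ = C * q1 f := by rw [← Finset.sum_mul]

/-- The short time Fourier transform with the window `w`. -/
def stft (w : 𝓢(V, ℂ)) (f : 𝓢(V, ℂ)) (x : V × V) : ℂ := 𝓕 (windowed w x.1 f) x.2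

theorem stft_eq (w : 𝓢(V, ℂ)) (f : 𝓢(V, ℂ)) (x : V × V) :
    stft w f x = ∫ y, Complex.exp (↑(-2 * Real.pi * ⟪y, x.2⟫) * Complex.I) * (f y * w (y - x.1)) := by
  rw [stft, SchwartzMap.fourier_coe, Real.fourier_eq']
  rfl

/-- Continuity of the Fourier transform on Schwartz space turns decay in the frequency `b` into
finitely many seminorms of the windowed function, each of which decays in the position `a`. -/
theorem exists_bound_stft (w : 𝓢(V, ℂ)) (k : ℕ) :
    ∃ q : Seminorm ℂ 𝓢(V, ℂ), Continuous q ∧ ∀ f a b,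
      (1 + ‖a‖) ^ k * (1 + ‖b‖) ^ k * ‖stft w f (a, b)‖ ≤ q f := by
  let P : Seminorm ℂ 𝓢(V, ℂ) :=
    ((Finset.Iic (k, 0)).sup fun m => SchwartzMap.seminorm ℂ m.1 m.2).comp
      (fourierCLM ℂ 𝓢(V, ℂ)).toLinearMap
  have hP : Continuous P := by
    have : Continuous ⇑((Finset.Iic (k, 0)).sup fun m =>
        (SchwartzMap.seminorm ℂ m.1 m.2 : Seminorm ℂ 𝓢(V, ℂ))) := Seminorm.continuous_finsetSup fun m _ =>
      (schwartz_withSeminorms ℂ V ℂ).continuous_seminorm m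
    exact this.comp (fourierCLM ℂ 𝓢(V, ℂ)).continuous
  obtain ⟨s, C, -, hPC⟩ := Seminorm.bound_of_continuous (schwartz_withSeminorms ℂ V ℂ) P hP
  choose q hq hqb using fun m : ℕ × ℕ => exists_bound_seminorm_windowed w k m.1 m.2
  refine ⟨(2 ^ k * C) • ∑ m ∈ s, q m, ?_, fun f a b => ?_⟩
  · have : Continuous (⇑(∑ m ∈ s, q m)) := Seminorm.continuous_finsetSum fun m _ => hq m
    exact this.const_smul (2 ^ k * C)
  have h1 := one_add_le_sup_seminorm_apply (𝕜 := ℂ) (m := (k, 0)) (k := k) (n := 0)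
    le_rfl le_rfl (𝓕 (windowed w a f)) b
  rw [norm_iteratedFDeriv_zero] at h1
  have h2 : P (windowed w a f) ≤ C * ∑ m ∈ s, SchwartzMap.seminorm ℂ m.1 m.2 (windowed w a f) := by
    refine (hPC _).trans ?_
    rw [_root_.smul_apply, NNReal.smul_def, smul_eq_mul]
    refine mul_le_mul_of_nonneg_left ?_ C.2
    refine (Seminorm.finset_sup_le_sum _ s _).trans ?_
    rw [sum_apply]
    rfl
  have h3 : (1 + ‖a‖) ^ k * ∑ m ∈ s, SchwartzMap.seminorm ℂ m.1 m.2 (windowed w a f) ≤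
      ∑ m ∈ s, q m f := by
    rw [Finset.mul_sum]
    exact Finset.sum_le_sum fun m _ => hqb m f a
  rw [_root_.smul_apply, sum_apply, NNReal.smul_def, smul_eq_mul]
  calc (1 + ‖a‖) ^ k * (1 + ‖b‖) ^ k * ‖stft w f (a, b)‖
      = (1 + ‖a‖) ^ k * ((1 + ‖b‖) ^ k * ‖(𝓕 (windowed w a f)) b‖) := by
        rw [mul_assoc]; rfl
    _ ≤ (1 + ‖a‖) ^ k * (2 ^ k * P (windowed w a f)) :=
        mul_le_mul_of_nonneg_left h1 (by positivity)
    _ ≤ (1 + ‖a‖) ^ k * (2 ^ k * (C * ∑ m ∈ s, SchwartzMap.seminorm ℂ m.1 m.2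
        (windowed w a f))) := by gcongr
    _ = (2 ^ k * C) * ((1 + ‖a‖) ^ k * ∑ m ∈ s, SchwartzMap.seminorm ℂ m.1 m.2
        (windowed w a f)) := by ring
    _ ≤ (2 ^ k * C) * ∑ m ∈ s, q m f := by gcongr
    _ = _ := by push_cast; rfl

theorem continuous_stft (w : 𝓢(V, ℂ)) (f : 𝓢(V, ℂ)) : Continuous (stft w f) := by
  have h : stft w f = fun x : V × V =>
      ∫ y, Complex.exp (↑(-2 * Real.pi * ⟪y, x.2⟫) * Complex.I) * (f y * w (y - x.1)) :=
    funext fun x => stft_eq w f x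
  rw [h]
  have hw : ∀ y, ‖w y‖ ≤ SchwartzMap.seminorm ℂ 0 0 w := fun y => SchwartzMap.norm_le_seminorm ℂ w y
  refine continuous_of_dominated (bound := fun y => ‖f y‖ * SchwartzMap.seminorm ℂ 0 0 w)
    (fun x => ?_) (fun x => Filter.Eventually.of_forall fun y => ?_) ?_
    (Filter.Eventually.of_forall fun y => ?_)
  · have h1 := f.continuous
    have h2 := w.continuous
    exact Continuous.aestronglyMeasurable (by fun_prop)
  · rw [norm_mul, Complex.norm_exp_ofReal_mul_I, one_mul, norm_mul]
    exact mul_le_mul_of_nonneg_left (hw _) (norm_nonneg _)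
  · exact f.integrable.norm.mul_const _
  · have h2 := w.continuous
    fun_prop

/-- The short time Fourier transform as a linear map. -/
def stftLinear (w : 𝓢(V, ℂ)) : 𝓢(V, ℂ) →ₗ[ℂ] (V × V → ℂ) where
  toFun := stft w
  map_add' f g := by
    ext x
    have : windowed w x.1 (f + g) = windowed w x.1 f + windowed w x.1 g := by
      ext y; simp [windowed_apply, add_mul]
    simp only [stft, this, Pi.add_apply]
    rw [FourierTransform.fourier_add, _root_.add_apply]
  map_smul' c f := by
    ext x
    have : windowed w x.1 (c • f) = c • windowed w x.1 f := by
      ext y; simp [windowed_apply, mul_assoc]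
    simp only [stft, this, Pi.smul_apply, RingHom.id_apply]
    rw [FourierTransform.fourier_smul, _root_.smul_apply]

/-- The integrable weight on the phase space. -/
theorem integrable_weight : ∃ m : ℕ, Integrable fun x : V × V =>
    ((1 + ‖x.1‖) ^ m)⁻¹ * ((1 + ‖x.2‖) ^ m)⁻¹ := by
  refine ⟨Module.finrank ℝ V + 1, ?_⟩
  have h : Integrable (fun x : V => ((1 + ‖x‖) ^ (Module.finrank ℝ V + 1))⁻¹) := by
    have := integrable_one_add_norm (E := V) (μ := volume) (r := (Module.finrank ℝ V + 1 : ℕ))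
      (by push_cast; linarith)
    refine this.congr (Filter.Eventually.of_forall fun x => ?_)
    simp only
    rw [Real.rpow_neg (by positivity), Real.rpow_natCast]
  exact h.mul_prod h

theorem exists_integral_bound (w : 𝓢(V, ℂ)) {g : V × V → ℂ} (hg : Measurable g) {C : ℝ} {k : ℕ}
    (hgb : ∀ a b, ‖g (a, b)‖ ≤ C * ((1 + ‖a‖) ^ k * (1 + ‖b‖) ^ k)) :
    (∀ f, Integrable fun x => stft w f x * g x) ∧ ∃ p : Seminorm ℂ 𝓢(V, ℂ), Continuous p ∧
      ∀ f, ∫ x, ‖stft w f x * g x‖ ≤ p f := by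
  obtain ⟨m, hm⟩ := integrable_weight (V := V)
  obtain ⟨q, hq, hqb⟩ := exists_bound_stft w (k + m)
  have hC : 0 ≤ C := by
    have := (norm_nonneg _).trans (hgb 0 0)
    simpa using this
  have hle : ∀ f (x : V × V), ‖stft w f x * g x‖ ≤
      C * q f * (((1 + ‖x.1‖) ^ m)⁻¹ * ((1 + ‖x.2‖) ^ m)⁻¹) := by
    rintro f ⟨a, b⟩
    have h1 := hqb f a b
    have h2 := hgb a b
    have ha : 0 < (1 + ‖a‖) ^ m := by positivity
    have hb : 0 < (1 + ‖b‖) ^ m := by positivity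
    rw [← mul_inv, ← div_eq_mul_inv, le_div_iff₀ (mul_pos ha hb), norm_mul]
    calc ‖stft w f (a, b)‖ * ‖g (a, b)‖ * ((1 + ‖a‖) ^ m * (1 + ‖b‖) ^ m)
        ≤ ‖stft w f (a, b)‖ * (C * ((1 + ‖a‖) ^ k * (1 + ‖b‖) ^ k)) *
          ((1 + ‖a‖) ^ m * (1 + ‖b‖) ^ m) := by gcongr
      _ = C * ((1 + ‖a‖) ^ (k + m) * (1 + ‖b‖) ^ (k + m) * ‖stft w f (a, b)‖) := by
          rw [pow_add, pow_add]; ring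
      _ ≤ C * q f := by gcongr
  have hint : ∀ f, Integrable fun x => stft w f x * g x := fun f =>
    (hm.const_mul (C * q f)).mono' ((continuous_stft w f).measurable.mul hg).aestronglyMeasurable
      (Filter.Eventually.of_forall (hle f))
  refine ⟨hint, ?_⟩
  let I : ℝ := ∫ x : V × V, ((1 + ‖x.1‖) ^ m)⁻¹ * ((1 + ‖x.2‖) ^ m)⁻¹
  have hI : 0 ≤ I := integral_nonneg fun x => by positivity
  refine ⟨(C * I).toNNReal • q, hq.const_smul _, fun f => ?_⟩
  rw [_root_.smul_apply, NNReal.smul_def, Real.coe_toNNReal _ (mul_nonneg hC hI), smul_eq_mul]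
  refine (integral_mono (hint f).norm (hm.const_mul (C * q f)) (hle f)).trans (le_of_eq ?_)
  rw [integral_const_mul]
  ring

/-- A phase family made of the short time Fourier transform and of functions of polynomial
growth. -/
def phaseFamily {κ : Type*} (w : 𝓢(V, ℂ)) (q : κ → V × V → ℂ) (hq : ∀ k, Measurable (q k))
    (hb : ∀ k, ∃ (C : ℝ) (m : ℕ), ∀ a b, ‖q k (a, b)‖ ≤ C * ((1 + ‖a‖) ^ m * (1 + ‖b‖) ^ m)) :
    SectorIntegral.PhaseFamily 𝓢(V, ℂ) (V × V) κ :=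
  have hmono : ∀ l : List κ, (Measurable fun x => (l.map fun k => q k x).prod) ∧
      ∃ (C : ℝ) (m : ℕ), ∀ a b, ‖(l.map fun k => q k (a, b)).prod‖ ≤
        C * ((1 + ‖a‖) ^ m * (1 + ‖b‖) ^ m) := by
    intro l
    induction l with
    | nil => exact ⟨by simp, 1, 0, by simp⟩
    | cons k l ih =>
      obtain ⟨hm, C, m, hC⟩ := ih
      obtain ⟨C', m', hC'⟩ := hb k
      refine ⟨by simpa using! (hq k).mul hm, C' * C, m' + m, fun a b => ?_⟩
      rw [List.map_cons, List.prod_cons, norm_mul]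
      refine (mul_le_mul (hC' a b) (hC a b) (norm_nonneg _)
        ((norm_nonneg _).trans (hC' a b))).trans (le_of_eq ?_)
      rw [pow_add, pow_add]; ring
  { ν := volume
    F := stftLinear w
    q := q
    measurable_q := hq
    integrable := fun l f => by
      obtain ⟨hm, C, m, hC⟩ := hmono l
      exact (exists_integral_bound w hm hC).1 f
    bound := fun l => by
      obtain ⟨hm, C, m, hC⟩ := hmono l
      exact (exists_integral_bound w hm hC).2 }

/-- Reconstruction of an integral from the short time Fourier transform. -/
theorem integral_eq (w f : 𝓢(V, ℂ)) {γ : V → ℝ} (hγ : Continuous γ) (hγi : Integrable γ)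
    {Cγ : ℝ} (hγb : ∀ y, |γ y| ≤ Cγ) {G : V → ℂ} (hG : Continuous G) {CG : ℝ}
    (hGb : ∀ x, ‖G x‖ ≤ CG) :
    (∫ y, (γ y : ℂ) * w y) * ∫ x, f x * G x = ∫ p : V × V, stft w f p *
      ∫ x, (γ (x - p.1) : ℂ) * Complex.exp (↑(2 * Real.pi * ⟪p.2, x⟫) * Complex.I) * G x := by
  have hF : Integrable (stft w f) := by
    have := (exists_integral_bound w (g := fun _ => 1) measurable_const (C := 1) (k := 0)
      (by simp)).1 f
    simpa using this
  have hFc := continuous_stft w f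
  let H : (V × V) × V → ℂ := fun z => stft w f z.1 * ((γ (z.2 - z.1.1) : ℂ) *
    Complex.exp (↑(2 * Real.pi * ⟪z.1.2, z.2⟫) * Complex.I) * G z.2)
  have hHc : Continuous H := by
    simp only [H]; fun_prop
  have hHn : ∀ p : V × V, Integrable fun x => H (p, x) := by
    intro p
    have h1 : Integrable fun x => ‖stft w f p‖ * (|γ (x - p.1)| * CG) :=
      (((hγi.comp_sub_right p.1).norm).mul_const CG).const_mul _
    refine h1.mono' (by simp only [H]; exact Continuous.aestronglyMeasurable (by fun_prop))
      (Filter.Eventually.of_forall fun x => ?_)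
    simp only [H]
    rw [norm_mul, norm_mul, norm_mul, Complex.norm_exp_ofReal_mul_I, mul_one, Complex.norm_real,
      Real.norm_eq_abs]
    gcongr
    exact hGb x
  have hHi : Integrable H := by
    rw [Measure.volume_eq_prod, integrable_prod_iff hHc.aestronglyMeasurable]
    refine ⟨Filter.Eventually.of_forall hHn, ?_⟩
    have h1 : Integrable fun p : V × V => ‖stft w f p‖ * ((∫ y, |γ y|) * CG) := hF.norm.mul_const _
    refine h1.mono' ?_ (Filter.Eventually.of_forall fun p => ?_)
    · exact (hHc.norm.aestronglyMeasurable).integral_prod_right'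
    · rw [Real.norm_of_nonneg (integral_nonneg fun _ => norm_nonneg _)]
      have h2 : ∫ x, ‖stft w f p‖ * (|γ (x - p.1)| * CG) =
          ‖stft w f p‖ * ((∫ y, |γ y|) * CG) := by
        rw [integral_const_mul, integral_mul_const,
          integral_sub_right_eq_self (fun y => |γ y|) p.1]
      rw [← h2]
      refine integral_mono (hHn p).norm
        ((((hγi.comp_sub_right p.1).norm).mul_const CG).const_mul _) fun x => ?_
      simp only [H]
      rw [norm_mul, norm_mul, norm_mul, Complex.norm_exp_ofReal_mul_I, mul_one, Complex.norm_real,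
        Real.norm_eq_abs]
      gcongr
      exact hGb x
  have e1 : ∫ p : V × V, stft w f p * ∫ x, (γ (x - p.1) : ℂ) *
      Complex.exp (↑(2 * Real.pi * ⟪p.2, x⟫) * Complex.I) * G x = ∫ p, ∫ x, H (p, x) := by
    congr 1; ext p
    rw [← integral_const_mul]
  rw [e1, integral_integral_swap (f := fun p x => H (p, x)) hHi, ← integral_const_mul]
  congr 1; ext x
  have hFx : Integrable fun p : V × V => H (p, x) := by
    have h1 : Integrable fun p : V × V => ‖stft w f p‖ * (Cγ * CG) := hF.norm.mul_const _
    refine h1.mono' (Continuous.aestronglyMeasurable (by fun_prop))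
      (Filter.Eventually.of_forall fun p => ?_)
    simp only [H]
    rw [norm_mul, norm_mul, norm_mul, Complex.norm_exp_ofReal_mul_I, mul_one, Complex.norm_real,
      Real.norm_eq_abs]
    have := (abs_nonneg _).trans (hγb 0)
    gcongr
    · exact hγb _
    · exact hGb x
  rw [Measure.volume_eq_prod, integral_prod _ hFx]
  -- The integral over the frequency is Fourier inversion for `f` times the translated window. What
  -- then depends on `a` is a translate of `γ w`, whose integral does not depend on `x`.
  have e2 : ∀ a, ∫ b, H ((a, b), x) = (γ (x - a) : ℂ) * w (x - a) * (f x * G x) := by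
    intro a
    have hinv : windowed w a f x = ∫ b, Complex.exp (↑(2 * Real.pi * ⟪b, x⟫) * Complex.I) *
        stft w f (a, b) := by
      have h1 : 𝓕⁻ (𝓕 (windowed w a f)) = windowed w a f := fourierInv_fourier_eq _
      conv_lhs => rw [← h1]
      rw [SchwartzMap.fourierInv_coe, Real.fourierInv_eq']
      rfl
    have h3 : ∀ b, H ((a, b), x) = ((γ (x - a) : ℂ) * G x) *
        (Complex.exp (↑(2 * Real.pi * ⟪b, x⟫) * Complex.I) * stft w f (a, b)) := by
      intro b; simp only [H]; ring
    simp_rw [h3]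
    rw [integral_const_mul, ← hinv, windowed_apply]
    ring
  simp_rw [e2]
  rw [integral_mul_const, integral_sub_left_eq_self (fun y => (γ y : ℂ) * w y)]

end CoherentDecomposition

/-! ### The algebra of the matrices built on the eigenspaces of `σ` -/

namespace Twisted

open Phi4Graph (sigma4)

/-- The projection `(1 + σ) / 2` on an eigenspace of `σ`. -/
def ePlus : Matrix (Fin 4) (Fin 4) ℂ := (1 / 2 : ℂ) • (1 + sigma4)

/-- The projection `(1 - σ) / 2`. -/
def eMinus : Matrix (Fin 4) (Fin 4) ℂ := (1 / 2 : ℂ) • (1 - sigma4)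

theorem sigma4_mul_self : sigma4 * sigma4 = 1 := by
  ext i j
  fin_cases i <;> fin_cases j <;> simp [sigma4, Matrix.mul_apply, Fin.sum_univ_four]

theorem sigma4_transpose : sigma4ᵀ = -sigma4 := by
  ext i j
  fin_cases i <;> fin_cases j <;> simp [sigma4]

theorem ePlus_mul_ePlus : ePlus * ePlus = ePlus := by
  rw [ePlus, Matrix.smul_mul, Matrix.mul_smul, smul_smul, Matrix.add_mul, Matrix.mul_add,
    Matrix.mul_add, sigma4_mul_self, Matrix.one_mul, Matrix.one_mul, Matrix.mul_one,
    add_comm sigma4, ← two_smul ℂ, smul_smul]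
  norm_num

theorem eMinus_mul_eMinus : eMinus * eMinus = eMinus := by
  rw [eMinus, Matrix.smul_mul, Matrix.mul_smul, smul_smul, Matrix.sub_mul, Matrix.mul_sub,
    Matrix.mul_sub, sigma4_mul_self, Matrix.one_mul, Matrix.one_mul, Matrix.mul_one,
    ← neg_sub _ sigma4, sub_neg_eq_add, ← two_smul ℂ, smul_smul]
  norm_num

theorem ePlus_mul_eMinus : ePlus * eMinus = 0 := by
  rw [ePlus, eMinus, Matrix.smul_mul, Matrix.mul_smul, Matrix.add_mul, Matrix.mul_sub,
    Matrix.mul_sub, sigma4_mul_self, Matrix.one_mul, Matrix.mul_one, Matrix.one_mul]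
  simp

theorem eMinus_mul_ePlus : eMinus * ePlus = 0 := by
  rw [ePlus, eMinus, Matrix.smul_mul, Matrix.mul_smul, Matrix.sub_mul, Matrix.mul_add,
    Matrix.mul_add, sigma4_mul_self, Matrix.one_mul, Matrix.mul_one, Matrix.one_mul,
    add_comm sigma4, sub_self, smul_zero, smul_zero]

theorem ePlus_transpose : ePlusᵀ = eMinus := by
  rw [ePlus, eMinus, Matrix.transpose_smul, Matrix.transpose_add, sigma4_transpose,
    Matrix.transpose_one, sub_eq_add_neg]

theorem eMinus_transpose : eMinusᵀ = ePlus := by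
  rw [← ePlus_transpose, Matrix.transpose_transpose]

theorem ePlus_add_eMinus : ePlus + eMinus = 1 := by
  rw [ePlus, eMinus, ← smul_add, add_add_sub_cancel, ← two_smul ℂ, smul_smul]
  norm_num

theorem ePlus_sub_eMinus : ePlus - eMinus = sigma4 := by
  rw [ePlus, eMinus, ← smul_sub, add_sub_sub_cancel, ← two_smul ℂ, smul_smul]
  norm_num

variable {m n p : Type*}

/-- The matrix acting as `Z` on the range of `(1 + σ) / 2` and as `Z'` on that of `(1 - σ) / 2`. -/
def tw (Z Z' : Matrix m n ℝ) : Matrix (m × Fin 4) (n × Fin 4) ℂ :=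
  Z.map Complex.ofReal ⊗ₖ ePlus + Z'.map Complex.ofReal ⊗ₖ eMinus

theorem map_add (A B : Matrix m n ℝ) :
    (A + B).map Complex.ofReal = A.map Complex.ofReal + B.map Complex.ofReal :=
  Matrix.map_add _ Complex.ofReal_add A B

theorem map_sub (A B : Matrix m n ℝ) :
    (A - B).map Complex.ofReal = A.map Complex.ofReal - B.map Complex.ofReal :=
  Matrix.map_sub _ Complex.ofReal_sub A B

theorem map_mul [Fintype n] (A : Matrix m n ℝ) (B : Matrix n p ℝ) :
    (A * B).map Complex.ofReal = A.map Complex.ofReal * B.map Complex.ofReal :=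
  Matrix.map_mul (f := Complex.ofRealHom)

theorem tw_mul [Fintype n] (Z Z' : Matrix m n ℝ) (W W' : Matrix n p ℝ) :
    tw Z Z' * tw W W' = tw (Z * W) (Z' * W') := by
  simp only [tw, Matrix.add_mul, Matrix.mul_add, ← Matrix.mul_kronecker_mul, ePlus_mul_ePlus,
    ePlus_mul_eMinus, eMinus_mul_ePlus, eMinus_mul_eMinus, Matrix.kronecker_zero, map_mul]
  simp

theorem tw_add (Z Z' W W' : Matrix m n ℝ) : tw Z Z' + tw W W' = tw (Z + W) (Z' + W') := by
  simp only [tw, map_add, Matrix.add_kronecker]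
  abel

theorem tw_sub (Z Z' W W' : Matrix m n ℝ) : tw Z Z' - tw W W' = tw (Z - W) (Z' - W') := by
  rw [sub_eq_iff_eq_add, tw_add, sub_add_cancel, sub_add_cancel]

theorem tw_one [DecidableEq m] : tw (1 : Matrix m m ℝ) 1 = 1 := by
  rw [tw, ← Matrix.kronecker_add, ePlus_add_eMinus,
    Matrix.map_one _ Complex.ofReal_zero Complex.ofReal_one, Matrix.one_kronecker_one]

theorem tw_transpose (Z Z' : Matrix m n ℝ) : (tw Z Z')ᵀ = tw Z'ᵀ Zᵀ := by
  change Zᵀ.map Complex.ofReal ⊗ₖ ePlusᵀ + Z'ᵀ.map Complex.ofReal ⊗ₖ eMinusᵀ = _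
  rw [ePlus_transpose, eMinus_transpose, add_comm]
  rfl

/-- Taking blocks commutes with `tw`, as do products and inverses. Every computation with the
quadratic form thus reduces to a computation with one real matrix and its transpose. -/
theorem tw_submatrix {m' n' : Type*} (Z Z' : Matrix m n ℝ) (f : m' → m) (g : n' → n) :
    (tw Z Z').submatrix (Prod.map f id) (Prod.map g id) = tw (Z.submatrix f g) (Z'.submatrix f g) :=
  rfl

theorem tw_inv [Fintype m] [DecidableEq m] {Z Z' : Matrix m m ℝ} (hZ : Z.det ≠ 0)
    (hZ' : Z'.det ≠ 0) : (tw Z Z')⁻¹ = tw Z⁻¹ Z'⁻¹ := by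
  apply Matrix.inv_eq_right_inv
  rw [tw_mul, Matrix.mul_nonsing_inv _ (isUnit_iff_ne_zero.2 hZ),
    Matrix.mul_nonsing_inv _ (isUnit_iff_ne_zero.2 hZ'), tw_one]

theorem sub_kronecker {q : Type*} (A B : Matrix m n ℂ) (C : Matrix p q ℂ) :
    (A - B) ⊗ₖ C = A ⊗ₖ C - B ⊗ₖ C := by
  ext; simp [sub_mul]

theorem kronecker_sub {q : Type*} (A : Matrix m n ℂ) (B C : Matrix p q ℂ) :
    A ⊗ₖ (B - C) = A ⊗ₖ B - A ⊗ₖ C := by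
  ext; simp [mul_sub]

theorem tw_symm_skew [DecidableEq m] (A B : Matrix m n ℝ) :
    tw (A + B) (A - B) = A.map Complex.ofReal ⊗ₖ (1 : Matrix (Fin 4) (Fin 4) ℂ) +
      B.map Complex.ofReal ⊗ₖ sigma4 := by
  rw [tw, map_add, map_sub, ← ePlus_add_eMinus, ← ePlus_sub_eMinus, Matrix.kronecker_add,
    kronecker_sub, Matrix.add_kronecker, sub_kronecker]
  abel

/-- A factorization of the projection through its two-dimensional range. -/
def uPlus : Matrix (Fin 4) (Fin 2) ℂ := !![1, 0; Complex.I, 0; 0, 1; 0, Complex.I]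

/-- The other factor of the projection. -/
def vPlus : Matrix (Fin 2) (Fin 4) ℂ :=
  !![1 / 2, -Complex.I / 2, 0, 0; 0, 0, 1 / 2, -Complex.I / 2]

theorem uPlus_mul_vPlus : uPlus * vPlus = ePlus := by
  ext i j
  fin_cases i <;> fin_cases j <;>
    simp [uPlus, vPlus, ePlus, sigma4, Matrix.mul_apply, Fin.sum_univ_two] <;> ring_nf <;> norm_num

theorem vPlus_mul_uPlus : vPlus * uPlus = 1 := by
  ext i j
  fin_cases i <;> fin_cases j <;>
    simp [uPlus, vPlus, Matrix.mul_apply, Fin.sum_univ_four] <;> ring_nf <;> norm_num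

/-- The difference from the identity factors through the two-dimensional eigenspace. The identity
`det (1 + U V) = det (1 + V U)` then reduces the determinant to that of `Z ⊗ 1_2`. -/
theorem det_tw_one [Fintype m] [DecidableEq m] (Z : Matrix m m ℝ) :
    (tw Z 1).det = (Z.det : ℂ) ^ 2 := by
  have h1 : tw Z 1 = 1 + ((1 : Matrix m m ℂ) ⊗ₖ uPlus) * ((Z - 1).map Complex.ofReal ⊗ₖ vPlus) := by
    rw [← Matrix.mul_kronecker_mul, Matrix.one_mul, uPlus_mul_vPlus, ← tw_one, tw, tw, map_sub,
      sub_kronecker]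
    abel
  rw [h1, Matrix.det_one_add_mul_comm, ← Matrix.mul_kronecker_mul, Matrix.mul_one,
    vPlus_mul_uPlus, ← Matrix.one_kronecker_one, ← Matrix.add_kronecker,
    ← Matrix.map_one Complex.ofReal Complex.ofReal_zero Complex.ofReal_one, ← map_add,
    add_sub_cancel, Matrix.det_kronecker, ComplexGaussian.det_map_ofReal]
  simp

/-- The two eigenspaces are treated separately. Transposition exchanges them, so one case gives the
other. -/
theorem det_tw [Fintype m] [DecidableEq m] (Z Z' : Matrix m m ℝ) :
    (tw Z Z').det = (Z.det : ℂ) ^ 2 * (Z'.det : ℂ) ^ 2 := by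
  have h : tw Z Z' = tw Z 1 * (tw Z'ᵀ 1)ᵀ := by
    rw [tw_transpose, tw_mul, Matrix.transpose_one, Matrix.transpose_transpose, Matrix.mul_one,
      Matrix.one_mul]
  rw [h, Matrix.det_mul, Matrix.det_transpose, det_tw_one, det_tw_one, Matrix.det_transpose]

end Twisted

/-! ### The quadratic form of a graph -/

namespace Phi4Graph

open RowMinor Twisted

variable {V L : Type*} [Fintype V] [DecidableEq V] [Fintype L] [DecidableEq L]
  (G : Phi4Graph V L)

theorem oscMatrix_transpose : G.oscMatrixᵀ = -G.oscMatrix := by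
  ext τ τ'
  simp only [oscMatrix, Matrix.transpose_apply, Matrix.of_apply, Matrix.neg_apply,
    ← Finset.sum_neg_distrib]
  refine Finset.sum_congr rfl fun v _ => ?_
  rw [Finset.sum_comm]
  refine Finset.sum_congr rfl fun i _ => Finset.sum_congr rfl fun j _ => ?_
  have h : omega j i = -omega i j := by
    unfold omega
    rcases lt_trichotomy i j with h | h | h
    · simp [h, h.not_gt]
    · simp [h]
    · simp [h, h.not_gt]
  rw [h, add_comm (j : ℕ)]
  ring

theorem oscPart_transpose (s : ℝ) : (G.oscPart s)ᵀ = -G.oscPart s := by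
  rw [oscPart, Matrix.fromBlocks_transpose, Matrix.fromBlocks_neg, Matrix.transpose_smul,
    ← Matrix.transpose_map, oscMatrix_transpose, Matrix.transpose_neg, Matrix.transpose_transpose,
    neg_neg, Matrix.transpose_zero, neg_zero]
  congr 1
  ext i j
  simp

/-- The real quadratic form, with the external variables first. -/
def form (root : V) (s : ℝ) (t : L → ℝ) :
    Matrix (G.ExtVar ⊕ IntVar L root) (G.ExtVar ⊕ IntVar L root) ℝ :=
  (G.propMatrix t + G.oscPart s).submatrix (Sum.elim (G.extVar root) (G.intVar root))
    (Sum.elim (G.extVar root) (G.intVar root))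

theorem propMatrix_transpose (t : L → ℝ) : (G.propMatrix t)ᵀ = G.propMatrix t :=
  Matrix.diagonal_transpose _

/-- With `A` symmetric and `B` skew, the value `A - B` on the second eigenspace is the transpose of
`A + B`. -/
theorem quadForm_eq (s : ℝ) (t : L → ℝ) : G.quadForm s t =
    tw (G.propMatrix t + G.oscPart s) (G.propMatrix t + G.oscPart s)ᵀ := by
  rw [Matrix.transpose_add, propMatrix_transpose, oscPart_transpose, ← sub_eq_add_neg,
    tw_symm_skew]
  rfl

theorem schur_eq (root : V) (s : ℝ) (t : L → ℝ)
    (hdet : (G.form root s t).toBlocks₂₂.det ≠ 0) :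
    G.blockM root s t - G.blockP root s t * (G.blockQ root s t)⁻¹ * (G.blockP root s t)ᵀ =
      tw (schur (G.form root s t)) (schur (G.form root s t))ᵀ := by
  have hM : G.blockM root s t = tw (G.form root s t).toBlocks₁₁ (G.form root s t).toBlocks₁₁ᵀ := by
    rw [blockM, quadForm_eq, tw_submatrix]
    rfl
  have hP : G.blockP root s t = tw (G.form root s t).toBlocks₁₂ (G.form root s t).toBlocks₂₁ᵀ := by
    rw [blockP, quadForm_eq, tw_submatrix]
    rfl
  have hQ : G.blockQ root s t = tw (G.form root s t).toBlocks₂₂ (G.form root s t).toBlocks₂₂ᵀ := by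
    rw [blockQ, quadForm_eq, tw_submatrix]
    rfl
  rw [hM, hP, hQ, tw_transpose, tw_inv hdet (by rwa [Matrix.det_transpose]), tw_mul, tw_mul,
    tw_sub, schur, Matrix.transpose_sub, Matrix.transpose_mul, Matrix.transpose_mul,
    Matrix.transpose_transpose, Matrix.transpose_nonsing_inv, Matrix.mul_assoc,
    Matrix.mul_assoc]

end Phi4Graph

/-! ### The Gaussian integral over the external variables -/

namespace Twisted

open Phi4Graph (sigma4)
open RowMinor CoherentDecomposition SchwartzMap
open scoped RealInnerProductSpace ContDiff

variable {m : Type*} [Fintype m] [DecidableEq m]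

/-- The real matrix `σ / i`. -/
def tau : Matrix (Fin 4) (Fin 4) ℝ := !![0, -1, 0, 0; 1, 0, 0, 0; 0, 0, 0, -1; 0, 0, 1, 0]

theorem sigma4_eq (k l : Fin 4) : sigma4 k l = Complex.I * tau k l := by
  fin_cases k <;> fin_cases l <;> simp [sigma4, tau]

theorem tau_transpose : tauᵀ = -tau := by
  ext i j
  fin_cases i <;> fin_cases j <;> simp [tau]

theorem cmat_eq (Ω θ : ℝ) (A B : Matrix m m ℝ) :
    ComplexGaussian.cmat (Ω • (A ⊗ₖ (1 : Matrix (Fin 4) (Fin 4) ℝ))) (Ω • (B ⊗ₖ tau)) θ =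
      (Ω : ℂ) • tw (A + θ • B) (A - θ • B) := by
  rw [tw_symm_skew]
  ext ⟨i, k⟩ ⟨j, l⟩
  by_cases h : k = l
  · simp [ComplexGaussian.cmat, sigma4_eq, h]
    ring
  · simp [ComplexGaussian.cmat, sigma4_eq, h]
    ring

/-- The linear term of the Gaussian exponent at a point of the phase space. -/
def source (Ω : ℝ) (p : EuclideanSpace ℝ (m × Fin 4) × EuclideanSpace ℝ (m × Fin 4)) :
    m × Fin 4 → ℂ := fun i => Ω * p.1 i + 2 * Real.pi * Complex.I * p.2 i

/-- The functions on the phase space that appear in the phases. -/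
def phaseFn (Ω : ℝ) :
    Option (m × m) → EuclideanSpace ℝ (m × Fin 4) × EuclideanSpace ℝ (m × Fin 4) → ℂ
  | none => fun p => Ω / 2 * (‖p.1‖ ^ 2 : ℝ)
  | some ij => fun p => -(1 / Ω) * ∑ k, ∑ l, source Ω p (ij.1, k) * ePlus k l * source Ω p (ij.2, l)

/-- The coefficients of a phase. -/
def phaseCoeff (R : Matrix m m ℝ) : Option (m × m) → ℂ
  | none => 1
  | some ij => R ij.1 ij.2

theorem form_transpose {n R : Type*} [Fintype n] [CommRing R] (M : Matrix n n R) (w : n → R) :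
    w ⬝ᵥ (Mᵀ *ᵥ w) = w ⬝ᵥ (M *ᵥ w) := by
  rw [Matrix.mulVec_transpose, Matrix.dotProduct_mulVec w M w, dotProduct_comm]

/-- The two eigenspaces contribute transposed matrices, hence equal quadratic forms. -/
theorem form_tw (R : Matrix m m ℝ) (w : m × Fin 4 → ℂ) :
    w ⬝ᵥ (tw R Rᵀ *ᵥ w) = 2 * ∑ ij : m × m, R ij.1 ij.2 *
      ∑ k, ∑ l, w (ij.1, k) * ePlus k l * w (ij.2, l) := by
  have h1 : Rᵀ.map Complex.ofReal ⊗ₖ eMinus = (R.map Complex.ofReal ⊗ₖ ePlus)ᵀ := by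
    rw [← ePlus_transpose]; rfl
  rw [tw, h1, Matrix.add_mulVec, dotProduct_add, form_transpose, ← two_mul]
  congr 1
  simp only [dotProduct, Matrix.mulVec, Fintype.sum_prod_type, Matrix.kroneckerMap_apply,
    Matrix.map_apply, Finset.mul_sum]
  refine Finset.sum_congr rfl fun i _ => ?_
  rw [Finset.sum_comm]
  refine Finset.sum_congr rfl fun j _ => Finset.sum_congr rfl fun k _ =>
    Finset.sum_congr rfl fun l _ => ?_
  ring

/-- The phase is linear in the entries of `R`, against fixed functions on the phase space. All the
dependence on `t` thus sits in finitely many scalar coefficients, as a phase family requires. -/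
theorem sum_phase (Ω : ℝ) (R : Matrix m m ℝ)
    (p : EuclideanSpace ℝ (m × Fin 4) × EuclideanSpace ℝ (m × Fin 4)) :
    ∑ k, phaseCoeff R k * phaseFn Ω k p = Ω / 2 * (‖p.1‖ ^ 2 : ℝ) -
      1 / 2 * (source Ω p ⬝ᵥ (((Ω : ℂ)⁻¹ • tw R Rᵀ) *ᵥ source Ω p)) := by
  rw [Fintype.sum_option, Matrix.smul_mulVec, dotProduct_smul, form_tw, smul_eq_mul]
  simp only [phaseCoeff, phaseFn, one_mul, Finset.mul_sum]
  rw [sub_eq_add_neg, ← Finset.sum_neg_distrib]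
  congr 1
  refine Finset.sum_congr rfl fun ij _ => ?_
  rw [← Finset.sum_neg_distrib]
  refine Finset.sum_congr rfl fun k _ => ?_
  rw [← Finset.sum_neg_distrib]
  refine Finset.sum_congr rfl fun l _ => ?_
  ring

theorem measurable_phaseFn (Ω : ℝ) (k : Option (m × m)) : Measurable (phaseFn Ω k) := by
  refine Continuous.measurable ?_
  rcases k with _ | k <;> simp only [phaseFn, source] <;> fun_prop

theorem norm_source_le {Ω : ℝ} (hΩ : 0 < Ω) (a b : EuclideanSpace ℝ (m × Fin 4)) (i : m × Fin 4) :
    ‖source Ω (a, b) i‖ ≤ (Ω + 2 * Real.pi) * ((1 + ‖a‖) * (1 + ‖b‖)) := by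
  have ha : ‖a i‖ ≤ ‖a‖ := PiLp.norm_apply_le a i
  have hb : ‖b i‖ ≤ ‖b‖ := PiLp.norm_apply_le b i
  have hpi := Real.pi_pos
  have h1 : ‖source Ω (a, b) i‖ ≤ Ω * ‖a‖ + 2 * Real.pi * ‖b‖ := by
    refine (norm_add_le _ _).trans (add_le_add ?_ ?_)
    · rw [norm_mul, Complex.norm_real, Complex.norm_real, Real.norm_of_nonneg hΩ.le]
      gcongr
    · rw [norm_mul, norm_mul, norm_mul, Complex.norm_I, mul_one, Complex.norm_real,
        Complex.norm_real, Real.norm_of_nonneg hpi.le]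
      simp only [Complex.norm_ofNat]
      gcongr
  have h2 : Ω * ‖a‖ ≤ Ω * ((1 + ‖a‖) * (1 + ‖b‖)) := by
    gcongr
    nlinarith [norm_nonneg a, norm_nonneg b, mul_nonneg (norm_nonneg a) (norm_nonneg b)]
  have h3 : 2 * Real.pi * ‖b‖ ≤ 2 * Real.pi * ((1 + ‖a‖) * (1 + ‖b‖)) := by
    gcongr
    nlinarith [norm_nonneg a, norm_nonneg b, mul_nonneg (norm_nonneg a) (norm_nonneg b)]
  linarith

theorem phaseFn_growth {Ω : ℝ} (hΩ : 0 < Ω) (k : Option (m × m)) : ∃ (C : ℝ) (n : ℕ), ∀ a b,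
    ‖phaseFn Ω k (a, b)‖ ≤ C * ((1 + ‖a‖) ^ n * (1 + ‖b‖) ^ n) := by
  rcases k with _ | ij
  · refine ⟨Ω / 2, 2, fun a b => ?_⟩
    simp only [phaseFn]
    rw [norm_mul, norm_div, Complex.norm_real, Complex.norm_real, Real.norm_of_nonneg hΩ.le,
      Complex.norm_ofNat, Real.norm_of_nonneg (sq_nonneg _)]
    gcongr
    have h1 : ‖a‖ ^ 2 ≤ (1 + ‖a‖) ^ 2 := by gcongr; linarith
    have h2 : 1 ≤ (1 + ‖b‖) ^ 2 := one_le_pow₀ (by linarith [norm_nonneg b])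
    nlinarith [sq_nonneg (1 + ‖a‖)]
  · refine ⟨‖(-(1 / Ω) : ℂ)‖ * ∑ k, ∑ l, (Ω + 2 * Real.pi) ^ 2 * ‖ePlus k l‖, 2, fun a b => ?_⟩
    simp only [phaseFn]
    rw [norm_mul, mul_assoc, Finset.sum_mul]
    gcongr
    refine (norm_sum_le _ _).trans (Finset.sum_le_sum fun k _ => ?_)
    rw [Finset.sum_mul]
    refine (norm_sum_le _ _).trans (Finset.sum_le_sum fun l _ => ?_)
    rw [norm_mul, norm_mul]
    have h1 := norm_source_le hΩ a b (ij.1, k)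
    have h2 := norm_source_le hΩ a b (ij.2, l)
    calc ‖source Ω (a, b) (ij.1, k)‖ * ‖ePlus k l‖ * ‖source Ω (a, b) (ij.2, l)‖
        ≤ ((Ω + 2 * Real.pi) * ((1 + ‖a‖) * (1 + ‖b‖))) * ‖ePlus k l‖ *
          ((Ω + 2 * Real.pi) * ((1 + ‖a‖) * (1 + ‖b‖))) := by
          have := (norm_nonneg _).trans h1
          gcongr
      _ = _ := by ring

/-- The Gaussian window family of the external space. -/
def extFamily {Ω : ℝ} (hΩ : 0 < Ω) (w : 𝓢(EuclideanSpace ℝ (m × Fin 4), ℂ)) :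
    SectorIntegral.PhaseFamily 𝓢(EuclideanSpace ℝ (m × Fin 4), ℂ)
      (EuclideanSpace ℝ (m × Fin 4) × EuclideanSpace ℝ (m × Fin 4)) (Option (m × m)) :=
  phaseFamily w (phaseFn Ω) (measurable_phaseFn Ω) (phaseFn_growth hΩ)

/-- The exponent of the external Gaussian. -/
def gaussExp (Ω : ℝ) (Z : Matrix m m ℝ) (x : EuclideanSpace ℝ (m × Fin 4)) : ℂ :=
  Ω / 2 * ((fun a => (x a : ℂ)) ⬝ᵥ (tw Z Zᵀ *ᵥ fun a => (x a : ℂ)))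

theorem ePlus_re (k l : Fin 4) : (ePlus k l).re = if k = l then 1 / 2 else 0 := by
  fin_cases k <;> fin_cases l <;> simp [ePlus, sigma4]

/-- The real part of the projection `(1 + σ) / 2` is half the identity, so the real part of the
exponent is a sum of the real forms of `Z` over the four components. -/
theorem gaussExp_re_nonneg {Ω : ℝ} (hΩ : 0 < Ω) {Z : Matrix m m ℝ} (hZ : FormNonneg Z)
    (x : EuclideanSpace ℝ (m × Fin 4)) : 0 ≤ (gaussExp Ω Z x).re := by
  have h1 : gaussExp Ω Z x = (Ω : ℝ) * (∑ ij : m × m, (Z ij.1 ij.2 : ℂ) *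
      ∑ k, ∑ l, (x (ij.1, k) : ℂ) * ePlus k l * (x (ij.2, l) : ℂ)) := by
    rw [gaussExp, form_tw]; ring
  have h2 : (∑ ij : m × m, (Z ij.1 ij.2 : ℂ) *
      ∑ k, ∑ l, (x (ij.1, k) : ℂ) * ePlus k l * (x (ij.2, l) : ℂ)).re =
      1 / 2 * ∑ k : Fin 4, (fun i => x (i, k)) ⬝ᵥ (Z *ᵥ fun i => x (i, k)) := by
    simp only [Complex.re_sum, Complex.re_ofReal_mul, Complex.re_mul_ofReal, ePlus_re, mul_ite,
      ite_mul, mul_zero, zero_mul, Finset.sum_ite_eq, Finset.mem_univ, if_true]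
    simp only [dotProduct, Matrix.mulVec, Finset.mul_sum, Fintype.sum_prod_type]
    rw [eq_comm, Finset.sum_comm]
    refine Finset.sum_congr rfl fun i _ => ?_
    rw [Finset.sum_comm]
    refine Finset.sum_congr rfl fun j _ => Finset.sum_congr rfl fun k _ => ?_
    ring
  rw [h1, Complex.re_ofReal_mul, h2]
  have := Finset.sum_nonneg fun (k : Fin 4) (_ : k ∈ Finset.univ) => hZ fun i => x (i, k)
  positivity

theorem continuous_gaussExp (Ω : ℝ) (Z : Matrix m m ℝ) : Continuous (gaussExp Ω Z) := by
  have h : gaussExp Ω Z = fun x => Ω / 2 * ∑ i, (x i : ℂ) * ∑ j, tw Z Zᵀ i j * (x j : ℂ) := rfl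
  rw [h]
  fun_prop

theorem norm_exp_gaussExp_le {Ω : ℝ} (hΩ : 0 < Ω) {Z : Matrix m m ℝ} (hZ : FormNonneg Z)
    (x : EuclideanSpace ℝ (m × Fin 4)) : ‖Complex.exp (-gaussExp Ω Z x)‖ ≤ 1 := by
  rw [Complex.norm_exp, Complex.neg_re]
  exact Real.exp_le_one_iff.2 (by have := gaussExp_re_nonneg hΩ hZ x; linarith)

theorem one_add_form_pos {Z : Matrix m m ℝ} (hZ : FormNonneg Z) (x : m → ℝ) (hx : x ≠ 0) :
    0 < x ⬝ᵥ ((1 + Z) *ᵥ x) := by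
  rw [Matrix.add_mulVec, Matrix.one_mulVec, dotProduct_add]
  have h3 : 0 < x ⬝ᵥ x := by
    have := Matrix.dotProduct_star_self_pos_iff (v := x)
    simpa using this.2 hx
  linarith [hZ x]

theorem one_add_det_pos {Z : Matrix m m ℝ} (hZ : FormNonneg Z) : 0 < (1 + Z).det :=
  det_pos_of_form_pos (one_add_form_pos hZ)

/-- The constant of the Gaussian integral. -/
def gaussConst (m : Type*) [Fintype m] (Ω : ℝ) : ℂ :=
  (∏ _i : m × Fin 4, (2 * Real.pi : ℂ) ^ (1 / 2 : ℂ)) / ((Ω ^ (2 * Fintype.card m) : ℝ) : ℂ)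

theorem gaussConst_ne_zero {Ω : ℝ} (hΩ : 0 < Ω) : gaussConst m Ω ≠ 0 := by
  refine div_ne_zero (Finset.prod_ne_zero_iff.2 fun i _ => ?_) ?_
  · rw [Ne, Complex.cpow_eq_zero_iff]
    have := Real.pi_ne_zero
    simp
  · have : Ω ^ (2 * Fintype.card m) ≠ 0 := by positivity
    exact_mod_cast this

/-- The Gaussian window adds the identity to `Z`. The symmetric part of `1 + Z` is the real part of
the resulting complex matrix; its skew part, tensored with `σ = i τ`, is the imaginary part.
Completing the square leaves `(1 + Z)⁻¹` in the exponent. -/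
theorem integral_gaussian {Ω : ℝ} (hΩ : 0 < Ω) {Z : Matrix m m ℝ} (hZ : FormNonneg Z)
    (p : EuclideanSpace ℝ (m × Fin 4) × EuclideanSpace ℝ (m × Fin 4)) :
    ∫ x, ((Real.exp (-(Ω / 2) * ‖x - p.1‖ ^ 2) : ℝ) : ℂ) *
      Complex.exp (↑(2 * Real.pi * ⟪p.2, x⟫) * Complex.I) * Complex.exp (-gaussExp Ω Z x) =
      gaussConst m Ω / ((1 + Z).det : ℂ) ^ 2 *
        Complex.exp (-∑ k, phaseCoeff (1 + Z)⁻¹ k * phaseFn Ω k p) := by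
  let A : Matrix m m ℝ := 1 + (1 / 2 : ℝ) • (Z + Zᵀ)
  let B : Matrix m m ℝ := (1 / 2 : ℝ) • (Z - Zᵀ)
  have hB : Bᵀ = -B := by
    simp only [B, Matrix.transpose_smul, Matrix.transpose_sub, Matrix.transpose_transpose]
    rw [← smul_neg, neg_sub]
  have hA : Aᵀ = A := by
    simp only [A, Matrix.transpose_add, Matrix.transpose_smul, Matrix.transpose_one,
      Matrix.transpose_transpose, add_comm Zᵀ]
  have hAform : ∀ x : m → ℝ, x ≠ 0 → 0 < x ⬝ᵥ (A *ᵥ x) := by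
    intro x hx
    have h1 : x ⬝ᵥ (Zᵀ *ᵥ x) = x ⬝ᵥ (Z *ᵥ x) := form_transpose Z x
    have h2 : x ⬝ᵥ (A *ᵥ x) = x ⬝ᵥ ((1 + Z) *ᵥ x) := by
      simp only [A, Matrix.add_mulVec, Matrix.smul_mulVec, dotProduct_add, dotProduct_smul, h1,
        smul_eq_mul]
      ring
    rw [h2]
    exact one_add_form_pos hZ x hx
  have hAB : A + B = 1 + Z := by
    simp only [A, B]
    ext i j
    simp
    ring
  have hABt : A - B = (1 + Z)ᵀ := by
    simp only [A, B]
    ext i j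
    simp [Matrix.one_apply, eq_comm]
    ring
  have hApos : A.PosDef := Matrix.PosDef.of_dotProduct_mulVec_pos
    (by rw [Matrix.IsHermitian, Matrix.conjTranspose_eq_transpose_of_trivial, hA])
    fun x hx => by simpa using hAform x hx
  have hX : (Ω • (A ⊗ₖ (1 : Matrix (Fin 4) (Fin 4) ℝ))).PosDef :=
    (hApos.kronecker Matrix.PosDef.one).smul hΩ
  have hY : (Ω • (B ⊗ₖ tau))ᵀ = Ω • (B ⊗ₖ tau) := by
    rw [Matrix.transpose_smul]
    congr 1
    change Bᵀ ⊗ₖ tauᵀ = _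
    rw [hB, tau_transpose]
    ext; simp
  -- The determinant of the complex matrix is `Ω` to the power of the dimension times a fourth
  -- power, so its square root along the path has this explicit positive form.
  let k : ℝ → ℝ := fun θ => Ω ^ (2 * Fintype.card m) * (A + θ • B).det ^ 2
  have hk : Continuous k := by
    have : Continuous fun θ : ℝ => (A + θ • B).det := Continuous.matrix_det (by fun_prop)
    simp only [k]; fun_prop
  have hdpos : ∀ θ : ℝ, 0 < (A + θ • B).det := fun θ => det_pos_of_form_pos fun x hx => by
    rw [Matrix.add_mulVec, Matrix.smul_mulVec, dotProduct_add, dotProduct_smul, form_skew hB,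
      smul_zero, add_zero]
    exact hAform x hx
  have hkpos : ∀ θ ∈ Set.Icc (0 : ℝ) 1, 0 < k θ := fun θ _ => by
    have := hdpos θ
    simp only [k]; positivity
  have hdet : ∀ θ ∈ Set.Icc (0 : ℝ) 1, (ComplexGaussian.cmat
      (Ω • (A ⊗ₖ (1 : Matrix (Fin 4) (Fin 4) ℝ))) (Ω • (B ⊗ₖ tau)) θ).det = (k θ : ℂ) ^ 2 := by
    intro θ _
    have h1 : A - θ • B = (A + θ • B)ᵀ := by
      rw [Matrix.transpose_add, hA, Matrix.transpose_smul, hB, smul_neg, sub_eq_add_neg]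
    rw [cmat_eq, Matrix.det_smul, h1, det_tw, Matrix.det_transpose]
    simp only [k, Fintype.card_prod, Fintype.card_fin]
    push_cast
    ring
  have hmain := (ComplexGaussian.integral_exp_quadratic hX hY hk.continuousOn hkpos hdet
    (source Ω p)).2
  have hc1 : ComplexGaussian.cmat (Ω • (A ⊗ₖ (1 : Matrix (Fin 4) (Fin 4) ℝ))) (Ω • (B ⊗ₖ tau)) 1 =
      (Ω : ℂ) • tw (1 + Z) (1 + Z)ᵀ := by
    rw [cmat_eq, one_smul, hAB, hABt]
  have hΩ' : (Ω : ℂ) ≠ 0 := by exact_mod_cast hΩ.ne'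
  have hd := (one_add_det_pos hZ).ne'
  have hinv : ((Ω : ℂ) • tw (1 + Z) (1 + Z)ᵀ)⁻¹ = (Ω : ℂ)⁻¹ • tw (1 + Z)⁻¹ (1 + Z)⁻¹ᵀ := by
    apply Matrix.inv_eq_right_inv
    have hu := isUnit_iff_ne_zero.2 hd
    have hu' : IsUnit ((1 + Z)ᵀ).det := by rwa [Matrix.det_transpose]
    rw [Matrix.smul_mul, Matrix.mul_smul, smul_smul, tw_mul, Matrix.mul_nonsing_inv _ hu,
      Matrix.transpose_nonsing_inv, Matrix.mul_nonsing_inv _ hu', tw_one, mul_inv_cancel₀ hΩ',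
      one_smul]
  rw [hc1, hinv] at hmain
  have hexp : ∀ y : m × Fin 4 → ℝ,
      ((Real.exp (-(Ω / 2) * ‖WithLp.toLp 2 y - p.1‖ ^ 2) : ℝ) : ℂ) *
      Complex.exp (↑(2 * Real.pi * ⟪p.2, WithLp.toLp 2 y⟫) * Complex.I) *
        Complex.exp (-gaussExp Ω Z (WithLp.toLp 2 y)) =
      Complex.exp (-(1 / 2) * ((fun a => (y a : ℂ)) ⬝ᵥ
        (((Ω : ℂ) • tw (1 + Z) (1 + Z)ᵀ) *ᵥ fun a => (y a : ℂ))) +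
          source Ω p ⬝ᵥ fun a => (y a : ℂ)) * Complex.exp (-(Ω / 2 * (‖p.1‖ ^ 2 : ℝ))) := by
    intro y
    rw [Complex.ofReal_exp, ← Complex.exp_add, ← Complex.exp_add, ← Complex.exp_add]
    congr 1
    have h1 : tw (1 + Z) (1 + Z)ᵀ = 1 + tw Z Zᵀ := by
      rw [Matrix.transpose_add, Matrix.transpose_one, ← tw_add, tw_one]
    have h2 : ‖WithLp.toLp 2 y - p.1‖ ^ 2 = (∑ i, y i * y i) - 2 * (∑ i, p.1 i * y i) + ‖p.1‖ ^ 2 := by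
      rw [EuclideanSpace.norm_sq_eq, EuclideanSpace.norm_sq_eq, Finset.mul_sum,
        ← Finset.sum_sub_distrib, ← Finset.sum_add_distrib]
      refine Finset.sum_congr rfl fun i _ => ?_
      simp only [Real.norm_eq_abs, sq_abs, PiLp.sub_apply]
      ring
    have h3 : ⟪p.2, WithLp.toLp 2 y⟫ = ∑ i, p.2 i * y i := by
      rw [PiLp.inner_apply]
      refine Finset.sum_congr rfl fun i _ => ?_
      simp [mul_comm]
    have h4 : (source Ω p ⬝ᵥ fun a => (y a : ℂ)) =
        Ω * ∑ i, (p.1 i : ℂ) * y i + 2 * Real.pi * Complex.I * ∑ i, (p.2 i : ℂ) * y i := by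
      simp only [dotProduct, source, Finset.mul_sum]
      rw [← Finset.sum_add_distrib]
      refine Finset.sum_congr rfl fun i _ => ?_
      ring
    rw [h1, h2, h3, h4, Matrix.smul_mulVec, Matrix.add_mulVec, Matrix.one_mulVec, dotProduct_smul,
      dotProduct_add, smul_eq_mul, gaussExp]
    simp only [dotProduct]
    push_cast
    ring
  rw [← (PiLp.volume_preserving_toLp (m × Fin 4)).integral_comp
    (MeasurableEquiv.toLp 2 (m × Fin 4 → ℝ)).measurableEmbedding]
  simp_rw [hexp]
  rw [integral_mul_const, hmain, mul_assoc, ← Complex.exp_add, sum_phase]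
  congr 1
  · rw [gaussConst, div_div]
    congr 1
    simp only [k, one_smul, hAB]
    push_cast
    ring
  · congr 1
    ring

theorem integrable_window {Ω : ℝ} (hΩ : 0 < Ω) :
    Integrable fun x : EuclideanSpace ℝ (m × Fin 4) => Real.exp (-(Ω / 2) * ‖x‖ ^ 2) := by
  have h := GaussianFourier.integrable_cexp_neg_mul_sq_norm_add (V := EuclideanSpace ℝ (m × Fin 4))
    (b := ((Ω / 2 : ℝ) : ℂ)) (by simpa using hΩ) 0 0
  refine (h.norm).congr (Filter.Eventually.of_forall fun x => ?_)
  simp only [Complex.norm_exp]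
  congr 1
  simp [← Complex.ofReal_pow]

/-- The phase is homogeneous of degree two. The Gaussian integral it comes from is bounded by the
integral of the window, uniformly over the phase space; a negative real part would make it grow
without bound along a ray. -/
theorem admissible_inv {Ω : ℝ} (hΩ : 0 < Ω) (w : 𝓢(EuclideanSpace ℝ (m × Fin 4), ℂ))
    {Z : Matrix m m ℝ} (hZ : FormNonneg Z) :
    (extFamily hΩ w).Admissible (phaseCoeff (1 + Z)⁻¹) := by
  intro p
  set Q : ℂ := ∑ k, phaseCoeff (1 + Z)⁻¹ k * phaseFn Ω k p with hQ
  change 0 ≤ Q.re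
  have hscale : ∀ r : ℝ, ∑ k, phaseCoeff (1 + Z)⁻¹ k * phaseFn Ω k (r • p) = (r ^ 2 : ℝ) * Q := by
    intro r
    have hs : source Ω (r • p) = (r : ℂ) • source Ω p := by
      ext i
      simp [source]
      ring
    rw [hQ, sum_phase, sum_phase, hs, Matrix.mulVec_smul, smul_dotProduct, dotProduct_smul,
      Prod.smul_fst, norm_smul, Real.norm_eq_abs, mul_pow, sq_abs]
    simp only [smul_eq_mul]
    push_cast
    ring
  let c : ℝ := ‖gaussConst m Ω / ((1 + Z).det : ℂ) ^ 2‖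
  have hc : 0 < c := by
    have hd := (one_add_det_pos hZ).ne'
    have : gaussConst m Ω / ((1 + Z).det : ℂ) ^ 2 ≠ 0 :=
      div_ne_zero (gaussConst_ne_zero hΩ) (pow_ne_zero 2 (by exact_mod_cast hd))
    exact norm_pos_iff.2 this
  let I : ℝ := ∫ x : EuclideanSpace ℝ (m × Fin 4), Real.exp (-(Ω / 2) * ‖x‖ ^ 2)
  have hle : ∀ r : ℝ, c * Real.exp (-(r ^ 2 * Q.re)) ≤ I := by
    intro r
    have h1 := integral_gaussian hΩ hZ (r • p)
    rw [hscale] at h1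
    have h2 := congrArg norm h1
    rw [norm_mul, Complex.norm_exp, Complex.neg_re, Complex.re_ofReal_mul] at h2
    rw [← h2]
    have h3 : I = ∫ x : EuclideanSpace ℝ (m × Fin 4),
        Real.exp (-(Ω / 2) * ‖x - (r • p).1‖ ^ 2) :=
      (integral_sub_right_eq_self (fun x : EuclideanSpace ℝ (m × Fin 4) =>
        Real.exp (-(Ω / 2) * ‖x‖ ^ 2)) (r • p).1).symm
    rw [h3]
    refine norm_integral_le_of_norm_le ((integrable_window hΩ).comp_sub_right _)
      (Filter.Eventually.of_forall fun x => ?_)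
    rw [norm_mul, norm_mul, Complex.norm_exp_ofReal_mul_I, mul_one, Complex.norm_real,
      Real.norm_of_nonneg (Real.exp_pos _).le]
    exact mul_le_of_le_one_right (Real.exp_pos _).le (norm_exp_gaussExp_le hΩ hZ x)
  by_contra hneg
  have hneg' : 0 < -Q.re := by linarith [not_le.1 hneg]
  have h0 : 0 ≤ I := integral_nonneg fun x => (Real.exp_pos _).le
  -- At this scale the bound reads `c exp (I / c) ≤ I`, which `exp u ≥ u + 1` contradicts.
  have h1 := hle (Real.sqrt ((I / c) / -Q.re))
  rw [Real.sq_sqrt (by positivity)] at h1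
  have h2 : -(I / c / -Q.re * Q.re) = I / c := by
    rw [← mul_neg, div_mul_cancel₀ _ hneg'.ne']
  rw [h2] at h1
  have h3 := Real.add_one_le_exp (I / c)
  have h4 : c * (I / c + 1) = I + c := by field_simp
  nlinarith [mul_le_mul_of_nonneg_left h3 hc.le]

theorem integral_mul_gaussian {Ω : ℝ} (hΩ : 0 < Ω) (w : 𝓢(EuclideanSpace ℝ (m × Fin 4), ℂ))
    {Z : Matrix m m ℝ} (hZ : FormNonneg Z) (f : 𝓢(EuclideanSpace ℝ (m × Fin 4), ℂ)) :
    (∫ y, ((Real.exp (-(Ω / 2) * ‖y‖ ^ 2) : ℝ) : ℂ) * w y) *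
      ∫ x, f x * Complex.exp (-gaussExp Ω Z x) =
      gaussConst m Ω / ((1 + Z).det : ℂ) ^ 2 *
        (extFamily hΩ w).avg [] (phaseCoeff (1 + Z)⁻¹) f := by
  have h := integral_eq w f (γ := fun y => Real.exp (-(Ω / 2) * ‖y‖ ^ 2)) (by fun_prop)
    (integrable_window hΩ) (Cγ := 1) (fun y => ?_) (G := fun x => Complex.exp (-gaussExp Ω Z x))
    (by have := continuous_gaussExp Ω Z; fun_prop) (norm_exp_gaussExp_le hΩ hZ)
  · rw [h]
    simp_rw [integral_gaussian hΩ hZ]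
    rw [SectorIntegral.PhaseFamily.avg, ← integral_const_mul]
    refine integral_congr_ae (Filter.Eventually.of_forall fun p => ?_)
    simp only [SectorIntegral.PhaseFamily.mono, List.map_nil, List.prod_nil, mul_one]
    rw [mul_left_comm]
    rfl
  · rw [abs_of_pos (Real.exp_pos _), Real.exp_le_one_iff]
    have := sq_nonneg ‖y‖
    nlinarith

theorem exists_window {Ω : ℝ} : ∃ w : 𝓢(EuclideanSpace ℝ (m × Fin 4), ℂ),
    (∫ y, ((Real.exp (-(Ω / 2) * ‖y‖ ^ 2) : ℝ) : ℂ) * w y) ≠ 0 := by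
  let φ : ContDiffBump (0 : EuclideanSpace ℝ (m × Fin 4)) := ⟨1, 2, one_pos, one_lt_two⟩
  have hs : HasCompactSupport fun x => (φ x : ℂ) :=
    φ.hasCompactSupport.comp_left (g := fun x : ℝ => (x : ℂ)) Complex.ofReal_zero
  have hc : ContDiff ℝ ∞ fun x => (φ x : ℂ) := Complex.ofRealCLM.contDiff.comp φ.contDiff
  refine ⟨hs.toSchwartzMap hc, ?_⟩
  have h1 : (∫ y, ((Real.exp (-(Ω / 2) * ‖y‖ ^ 2) : ℝ) : ℂ) * hs.toSchwartzMap hc y) =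
      ((∫ y, Real.exp (-(Ω / 2) * ‖y‖ ^ 2) * φ y : ℝ) : ℂ) := by
    rw [← integral_complex_ofReal]
    congr 1; ext y
    rw [Complex.ofReal_mul]
    rfl
  rw [h1]
  have h2 : 0 < ∫ y, Real.exp (-(Ω / 2) * ‖y‖ ^ 2) * φ y := by
    refine Continuous.integral_pos_of_hasCompactSupport_nonneg_nonzero (x := 0) ?_ ?_ ?_ ?_
    · have := φ.continuous
      fun_prop
    · exact φ.hasCompactSupport.mul_left
    · exact fun y => mul_nonneg (Real.exp_pos _).le φ.nonneg
    · have : φ 0 = 1 := φ.one_of_mem_closedBall (by simp [φ])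
      simp [this]
  exact_mod_cast h2.ne'

end Twisted

/-! ### The hyperbolic polynomials and their coefficients -/

namespace Phi4Graph

open RowMinor Twisted

variable {V L : Type*} [Fintype V] [DecidableEq V] [Fintype L] [DecidableEq L]
  (G : Phi4Graph V L)

/-- The oscillating part with the external variables first. -/
def skew (root : V) (s : ℝ) : Matrix (G.ExtVar ⊕ IntVar L root) (G.ExtVar ⊕ IntVar L root) ℝ :=
  (G.oscPart s).submatrix (Sum.elim (G.extVar root) (G.intVar root))
    (Sum.elim (G.extVar root) (G.intVar root))

theorem skew_transpose (root : V) (s : ℝ) : (G.skew root s)ᵀ = -G.skew root s := by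
  rw [skew, Matrix.transpose_submatrix, oscPart_transpose]
  rfl

/-- The diagonal part on the internal variables. -/
def propDiag (root : V) (t : L → ℝ) : IntVar L root → ℝ :=
  Sum.elim (Sum.elim (fun ℓ => 1 / t ℓ) t) fun _ => 0

theorem elim_injective (root : V) :
    Function.Injective (Sum.elim (G.extVar root) (G.intVar root)) := by
  rintro ((e | e) | ((u | u) | v)) ((e' | e') | ((u' | u') | v')) h <;>
    simp [extVar, intVar] at h ⊢
  · exact h
  · exact v'.2 h.symm
  · exact h
  · exact h
  · exact v.2 h
  · exact Subtype.ext h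

theorem form_eq (root : V) (s : ℝ) (t : L → ℝ) : G.form root s t =
    G.skew root s + Matrix.diagonal (Sum.elim (fun _ => 0) (propDiag root t)) := by
  have h : (G.propMatrix t).submatrix (Sum.elim (G.extVar root) (G.intVar root))
      (Sum.elim (G.extVar root) (G.intVar root)) =
      Matrix.diagonal (Sum.elim (fun _ => 0) (propDiag root t)) := by
    rw [propMatrix, Matrix.submatrix_diagonal _ _ (G.elim_injective root)]
    congr 1
    funext i
    rcases i with (e | e) | ((u | u) | v) <;> rfl
  rw [form, Matrix.submatrix_add, Pi.add_apply, Pi.add_apply, h, add_comm]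
  rfl

/-- The exponents of the monomial of the parameters attached to a set of variables. -/
def linePower (J : Finset (L ⊕ L)) (ℓ : L) : ℕ :=
  (if Sum.inl ℓ ∈ J then 0 else 1) + if Sum.inr ℓ ∈ J then 1 else 0

theorem linePower_le (J : Finset (L ⊕ L)) (ℓ : L) : linePower J ℓ ≤ 2 := by
  unfold linePower; split_ifs <;> omega

/-- The factor `∏ t_ℓ` clears the denominators `1 / t_ℓ` of the short variables, so every exponent
is 0, 1 or 2. -/
theorem prod_propDiag (root : V) {t : L → ℝ} (ht : ∀ ℓ, t ℓ ≠ 0) (J : Finset (L ⊕ L)) :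
    (∏ ℓ, t ℓ) * ∏ i ∈ J.map Function.Embedding.inl, propDiag root t i =
      ∏ ℓ, t ℓ ^ linePower J ℓ := by
  have h : ∏ i ∈ J, Sum.elim (fun ℓ => 1 / t ℓ) t i =
      (∏ ℓ, if Sum.inl ℓ ∈ J then 1 / t ℓ else 1) * ∏ ℓ, if Sum.inr ℓ ∈ J then t ℓ else 1 := by
    have := Fintype.prod_sum_type fun i : L ⊕ L =>
      if i ∈ J then Sum.elim (fun ℓ => 1 / t ℓ) t i else 1
    rw [Finset.prod_ite_mem, Finset.univ_inter] at this
    exact this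
  rw [Finset.prod_map]
  refine (congrArg (fun x => (∏ ℓ, t ℓ) * x) h).trans ?_
  rw [← Finset.prod_mul_distrib, ← Finset.prod_mul_distrib]
  refine Finset.prod_congr rfl fun ℓ _ => ?_
  have := ht ℓ
  unfold linePower
  split_ifs <;> field_simp <;> ring

theorem diag_eq_zero (root : V) (t : L → ℝ) (i : IntVar L root)
    (hi : i ∉ (Finset.univ : Finset (L ⊕ L)).map Function.Embedding.inl) : propDiag root t i = 0 := by
  rcases i with i | i
  · simp at hi
  · rfl

theorem sum_coeff (root : V) {t : L → ℝ} (ht : ∀ ℓ, t ℓ ≠ 0)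
    (g : Finset (IntVar L root) → ℝ) :
    (∑ J ∈ ((Finset.univ : Finset (L ⊕ L)).map Function.Embedding.inl).powerset,
      (∏ i ∈ J, propDiag root t i) * g J) * ∏ ℓ, t ℓ =
      ∑ J : Finset (L ⊕ L), (∏ ℓ, t ℓ ^ linePower J ℓ) * g (J.map Function.Embedding.inl) := by
  rw [sum_powerset_map, Finset.powerset_univ, Finset.sum_mul]
  refine Finset.sum_congr rfl fun J _ => ?_
  rw [← prod_propDiag root ht]
  ring

/-- The coefficients of the first hyperbolic polynomial. -/
def coeffU (root : V) (s : ℝ) (J : Finset (L ⊕ L)) : ℝ :=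
  intCoeff (G.skew root s) (J.map Function.Embedding.inl)

/-- The coefficients of the polynomial with unit external part. -/
def coeffP (root : V) (s : ℝ) (J : Finset (L ⊕ L)) : ℝ :=
  fullCoeff (G.skew root s) (J.map Function.Embedding.inl)

/-- The coefficients of the external cofactors. -/
def coeffN (root : V) (s : ℝ) (ij : G.ExtVar × G.ExtVar) (J : Finset (L ⊕ L)) : ℝ :=
  entryCoeff (G.skew root s) ij.1 ij.2 (J.map Function.Embedding.inl)

/-- The polynomial with given coefficients. -/
def poly (c : Finset (L ⊕ L) → ℝ) (t : L → ℝ) : ℝ :=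
  ∑ J : Finset (L ⊕ L), (∏ ℓ, t ℓ ^ linePower J ℓ) * c J

theorem HU_eq_det (root : V) (s : ℝ) (t : L → ℝ) :
    G.HU root s t = (G.form root s t).toBlocks₂₂.det * ∏ ℓ, t ℓ := rfl

theorem HU_eq (root : V) (s : ℝ) {t : L → ℝ} (ht : ∀ ℓ, t ℓ ≠ 0) :
    G.HU root s t = poly (G.coeffU root s) t := by
  rw [HU_eq_det, form_eq, det_toBlocks₂₂_eq _ (diag_eq_zero root t), sum_coeff root ht]
  rfl

theorem form_add_eq (root : V) (s : ℝ) (t : L → ℝ) :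
    G.form root s t + Matrix.diagonal (Sum.elim (fun _ => 1) fun _ => 0) =
      G.skew root s + Matrix.diagonal (Sum.elim (fun _ => 1) (propDiag root t)) := by
  rw [form_eq, add_assoc, Matrix.diagonal_add]
  congr 2
  funext i
  rcases i with i | i <;> simp

theorem det_form_add (root : V) (s : ℝ) {t : L → ℝ} (ht : ∀ ℓ, t ℓ ≠ 0) :
    (G.form root s t + Matrix.diagonal (Sum.elim (fun _ => 1) fun _ => 0)).det * ∏ ℓ, t ℓ =
      poly (G.coeffP root s) t := by
  rw [form_add_eq, det_full_eq _ (diag_eq_zero root t), sum_coeff root ht]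
  rfl

theorem det_form_add_updateRow (root : V) (s : ℝ) {t : L → ℝ} (ht : ∀ ℓ, t ℓ ≠ 0)
    (i j : G.ExtVar) :
    ((G.form root s t + Matrix.diagonal (Sum.elim (fun _ => 1) fun _ => 0)).updateRow (Sum.inl j)
      (Pi.single (Sum.inl i) 1)).det * ∏ ℓ, t ℓ = poly (G.coeffN root s (i, j)) t := by
  rw [form_add_eq, det_entry_eq _ (diag_eq_zero root t), sum_coeff root ht]
  rfl

theorem coeffU_nonneg (root : V) (s : ℝ) (J : Finset (L ⊕ L)) : 0 ≤ G.coeffU root s J :=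
  intCoeff_nonneg (G.skew_transpose root s) _

theorem coeffU_le_coeffP (root : V) (s : ℝ) (J : Finset (L ⊕ L)) :
    G.coeffU root s J ≤ G.coeffP root s J :=
  intCoeff_le_fullCoeff (G.skew_transpose root s) _

theorem abs_coeffN_le (root : V) (s : ℝ) (ij : G.ExtVar × G.ExtVar) (J : Finset (L ⊕ L)) :
    |G.coeffN root s ij J| ≤ G.coeffP root s J :=
  abs_entryCoeff_le (G.skew_transpose root s) _ _ _

/-! ### A nonvanishing coefficient -/

theorem src_ne_tgt (ℓ : L) : G.src ℓ ≠ G.tgt ℓ := fun h =>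
  Sum.inl_ne_inr (G.injective (show Sum.elim G.src G.tgt (Sum.inl ℓ) =
    Sum.elim G.src G.tgt (Sum.inr ℓ) from h))

theorem eta_eq (ℓ : L) (c : V × Fin 4) :
    G.eta ℓ c = (if G.tgt ℓ = c then 1 else 0) + if G.src ℓ = c then 1 else 0 := by
  unfold eta eps
  by_cases h1 : G.tgt ℓ = c
  · have h2 : G.src ℓ ≠ c := fun h => G.src_ne_tgt ℓ (h.trans h1.symm)
    simp [h1, h2]
  · by_cases h2 : G.src ℓ = c <;> simp [h1, h2]

theorem hyperMatrix_long (ℓ : L) (v : V) : G.hyperMatrix (Sum.inr (Sum.inr ℓ)) v =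
    (if (G.tgt ℓ).1 = v then (-1) ^ ((G.tgt ℓ).2 : ℕ) else 0) +
      if (G.src ℓ).1 = v then (-1) ^ ((G.src ℓ).2 : ℕ) else 0 := by
  have h : ∀ c : V × Fin 4, ∑ i : Fin 4, (-1 : ℤ) ^ (i : ℕ) * (if c = (v, i) then 1 else 0) =
      if c.1 = v then (-1) ^ (c.2 : ℕ) else 0 := by
    rintro ⟨w, j⟩
    by_cases hw : w = v
    · simp [hw]
    · simp [hw]
  simp only [hyperMatrix, Matrix.of_apply, posCoeff, eta_eq, mul_add, Finset.sum_add_distrib, h]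

/-- This is where connectedness enters. The row of a long variable couples the hypermomenta at the
two ends of the line with coefficients `±1`, so vanishing at one end implies vanishing at the other
and spreads from the root. -/
theorem eq_zero_of_hyperMatrix (hG : G.IsConnected) (root : V) {p : V → ℝ} (hroot : p root = 0)
    (hp : ∀ ℓ, ∑ v, (G.hyperMatrix (Sum.inr (Sum.inr ℓ)) v : ℝ) * p v = 0) : p = 0 := by
  have hline : ∀ ℓ, p (G.src ℓ).1 = 0 ↔ p (G.tgt ℓ).1 = 0 := by
    intro ℓ
    have h := hp ℓ
    simp only [hyperMatrix_long] at h
    push_cast at h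
    simp only [add_mul, ite_mul, zero_mul, Finset.sum_add_distrib, Finset.sum_ite_eq,
      Finset.mem_univ, if_true] at h
    have h1 : ((-1 : ℝ) ^ ((G.tgt ℓ).2 : ℕ)) ≠ 0 := by positivity
    have h2 : ((-1 : ℝ) ^ ((G.src ℓ).2 : ℕ)) ≠ 0 := by positivity
    constructor
    · intro h0
      rw [h0, mul_zero, add_zero] at h
      exact (mul_eq_zero.1 h).resolve_left h1
    · intro h0
      rw [h0, mul_zero, zero_add] at h
      exact (mul_eq_zero.1 h).resolve_left h2
  have hadj : ∀ v w, G.underlying.Adj v w → p v = 0 → p w = 0 := by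
    intro v w h hv
    rw [underlying, SimpleGraph.fromRel_adj] at h
    rcases h.2 with ⟨ℓ, rfl, rfl⟩ | ⟨ℓ, rfl, rfl⟩
    · exact (hline ℓ).1 hv
    · exact (hline ℓ).2 hv
  funext v
  obtain ⟨walk⟩ := hG.preconnected root v
  induction walk with
  | nil => exact hroot
  | cons h _ ih => exact ih (hadj _ _ h hroot)

/-- A set `J` that contains all the short variables has exponents at most 1. If all these
coefficients vanished, so would the minor with unit rows at the external and short variables and
with 1 added on the diagonal of the long ones. A kernel vector would then vanish on the external and
short variables by the unit rows, on the long ones by its quadratic form, and on the hypermomenta by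
connectedness. The existence of such a coefficient fixes the right edge of the strip. -/
theorem exists_coeffU_ne_zero (hG : G.IsConnected) (root : V) (s : ℝ) :
    ∃ J : Finset (L ⊕ L), (∀ ℓ, linePower J ℓ ≤ 1) ∧ G.coeffU root s J ≠ 0 := by
  by_contra hcon
  push Not at hcon
  let fE : G.ExtVar ↪ G.ExtVar ⊕ IntVar L root := Function.Embedding.inl
  let fI : IntVar L root ↪ G.ExtVar ⊕ IntVar L root := Function.Embedding.inr
  let fL : L ⊕ L ↪ IntVar L root := Function.Embedding.inl
  let fu : L ↪ L ⊕ L := Function.Embedding.inl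
  let fv : L ↪ L ⊕ L := Function.Embedding.inr
  let S : Finset (G.ExtVar ⊕ IntVar L root) := Finset.univ.map fE ∪ ((Finset.univ.map fu).map fL).map fI
  let T : Finset (G.ExtVar ⊕ IntVar L root) := Finset.univ.map (fv.trans (fL.trans fI))
  let a : G.ExtVar ⊕ IntVar L root → ℝ := fun i => if i ∈ T then 1 else 0
  have hST : Disjoint S T := by
    rw [Finset.disjoint_left]
    rintro i hi hiT
    obtain ⟨ℓ, -, rfl⟩ := Finset.mem_map.1 hiT
    simp [S, fE, fI, fL, fu, fv] at hi
  have hzero : rowMinor S (G.skew root s + Matrix.diagonal a) = 0 := by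
    -- Every term of the expansion is a coefficient of a set that contains all the short variables,
    -- hence zero by assumption.
    rw [rowMinor_add_diagonal _ a hST fun i hi => by simp [a, hi]]
    refine Finset.sum_eq_zero fun K hK => ?_
    obtain ⟨K', -, rfl⟩ := Finset.subset_map_iff.1 (Finset.mem_powerset.1 hK)
    have h1 := hcon (Finset.univ.map fu ∪ K'.map fv) fun ℓ => by
      simp only [linePower, Finset.mem_union, Finset.mem_map]
      have : ∃ a, a ∈ Finset.univ ∧ fu a = Sum.inl ℓ := ⟨ℓ, Finset.mem_univ _, rfl⟩
      rw [if_pos (Or.inl this)]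
      split_ifs <;> simp
    have h2 : S ∪ K'.map (fv.trans (fL.trans fI)) =
        Finset.univ.map fE ∪ ((Finset.univ.map fu ∪ K'.map fv).map fL).map fI := by
      simp only [S, Finset.map_union, Finset.map_map, Finset.union_assoc]
      rfl
    rw [h2]
    exact mul_eq_zero_of_right _ h1
  obtain ⟨x, hx0, hx⟩ := Matrix.exists_mulVec_eq_zero_iff.2 hzero
  have hrow : ∀ i, (i ∈ S → x i = 0) ∧
      (i ∉ S → ((G.skew root s + Matrix.diagonal a) *ᵥ x) i = 0) := by
    intro i
    have h := congrFun hx i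
    constructor
    · intro hi
      simpa [Matrix.mulVec, dotProduct, Finset.piecewise, hi, unitRows, Pi.single_apply] using h
    · intro hi
      simpa [Matrix.mulVec, dotProduct, Finset.piecewise, hi, rows] using h
  have hform : x ⬝ᵥ ((G.skew root s + Matrix.diagonal a) *ᵥ x) = 0 := by
    refine Finset.sum_eq_zero fun i _ => ?_
    by_cases hi : i ∈ S
    · rw [(hrow i).1 hi, zero_mul]
    · rw [(hrow i).2 hi, mul_zero]
  rw [Matrix.add_mulVec, dotProduct_add, form_skew (G.skew_transpose root s), form_diagonal,
    zero_add] at hform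
  have hv : ∀ i ∈ T, x i = 0 := by
    intro i hi
    have h := (Finset.sum_eq_zero_iff_of_nonneg (fun i _ => mul_nonneg
      (by simp only [a]; split_ifs <;> simp) (sq_nonneg (x i)))).1 hform i (Finset.mem_univ i)
    simpa [a, hi] using h
  have hext : ∀ e : G.ExtVar, x (Sum.inl e) = 0 := fun e =>
    (hrow _).1 (Finset.mem_union_left _ (Finset.mem_map.2 ⟨e, Finset.mem_univ _, rfl⟩))
  have hu' : ∀ ℓ : L, x (Sum.inr (Sum.inl (Sum.inl ℓ))) = 0 := fun ℓ =>
    (hrow _).1 (Finset.mem_union_right _ (by simp [fI, fL, fu]))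
  have hv' : ∀ ℓ : L, x (Sum.inr (Sum.inl (Sum.inr ℓ))) = 0 := fun ℓ =>
    hv _ (Finset.mem_map.2 ⟨ℓ, Finset.mem_univ _, rfl⟩)
  let p : V → ℝ := fun v => if h : v = root then 0 else x (Sum.inr (Sum.inr ⟨v, h⟩))
  have hp : p = 0 := by
    refine G.eq_zero_of_hyperMatrix hG root (by simp [p]) fun ℓ => ?_
    have hnot : (Sum.inr (Sum.inl (Sum.inr ℓ)) : G.ExtVar ⊕ IntVar L root) ∉ S := by
      simp [S, fE, fI, fL, fu]
    have h := (hrow _).2 hnot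
    rw [Matrix.add_mulVec, Pi.add_apply, Matrix.mulVec_diagonal, hv', mul_zero, add_zero,
      Matrix.mulVec, dotProduct, Fintype.sum_sum_type] at h
    simp only [Fintype.sum_sum_type (α₁ := L ⊕ L), Fintype.sum_sum_type (α₁ := L) (α₂ := L), hext, hu', hv', mul_zero, Finset.sum_const_zero, zero_add, add_zero] at h
    rw [← h, ← Finset.sum_erase_add _ _ (Finset.mem_univ root)]
    simp only [p, dif_pos, mul_zero, add_zero]
    rw [Finset.sum_subtype (p := fun v => v ≠ root) (Finset.univ.erase root) (by simp)]
    refine Finset.sum_congr rfl fun v _ => ?_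
    rw [dif_neg v.2]
    rfl
  refine hx0 (funext fun i => ?_)
  rcases i with e | ((u | u) | v)
  · exact hext e
  · exact hu' u
  · exact hv' u
  · have h := congrFun hp v.1
    simpa [p, v.2] using h

end Phi4Graph

namespace SectorIntegral

open scoped ContDiff

/-! ### Monomials on a simplicial cone -/

section Cone

variable {ι : Type*} [Fintype ι] [DecidableEq ι] (M : Matrix ι ι ℤ)

open Classical in
/-- The rows of nonnegative sign. -/
def posRows : Finset ι := Finset.univ.filter fun i => ∀ j, 0 ≤ M i j

theorem mem_posRows {i : ι} : i ∈ posRows M ↔ ∀ j, 0 ≤ M i j := by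
  simp [posRows]

/-- The monomial `exp (-|y_i|)` in the coordinates of the cone. -/
def rowMono (i : ι) (z : ι → ℝ) : ℝ := ∏ j, z j ^ (2 * (M i j).natAbs)

/-- The parameter `t_i` as a function of the coordinates of the cone. -/
def coneParam (z : ι → ℝ) (i : ι) : ℝ :=
  (if i ∈ posRows M then rowMono M i z else 1) / (1 + rowMono M i z)

/-- The exponents are even because `z = exp (-η / 2)`. Nonnegativity for all real `z` keeps the
denominators positive, so the sector functions are smooth on the whole space and not only on a cube.
-/
theorem rowMono_nonneg (i : ι) (z : ι → ℝ) : 0 ≤ rowMono M i z :=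
  Finset.prod_nonneg fun j _ => by rw [pow_mul]; positivity

theorem rowMono_pos (i : ι) {z : ι → ℝ} (hz : ∀ j, z j ≠ 0) : 0 < rowMono M i z :=
  Finset.prod_pos fun j _ => by
    have := hz j
    rw [pow_mul]; positivity

theorem one_add_rowMono_pos (i : ι) (z : ι → ℝ) : 0 < 1 + rowMono M i z := by
  have := rowMono_nonneg M i z
  positivity

theorem contDiff_rowMono (i : ι) : ContDiff ℝ ∞ (rowMono M i) := by
  unfold rowMono; fun_prop

theorem coneParam_nonneg (z : ι → ℝ) (i : ι) : 0 ≤ coneParam M z i := by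
  have h1 := rowMono_nonneg M i z
  unfold coneParam
  split_ifs <;> positivity

theorem contDiff_coneParam (i : ι) : ContDiff ℝ ∞ fun z => coneParam M z i := by
  have h := contDiff_rowMono M i
  unfold coneParam
  refine ContDiff.div ?_ (contDiff_const.add h) fun z => (one_add_rowMono_pos M i z).ne'
  split_ifs
  · exact h
  · exact contDiff_const

theorem coneParam_mem {z : ι → ℝ} (hz : ∀ j, z j ≠ 0) (i : ι) :
    coneParam M z i ∈ Set.Ioo (0 : ℝ) 1 := by
  have h1 := rowMono_pos M i hz
  unfold coneParam
  constructor
  · split_ifs <;> positivity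
  · rw [div_lt_one (by positivity)]
    split_ifs <;> linarith

/-- The common factor `(1 + t_i) / (1 + X_i)` of `1 - t_i ^ 2`. -/
def coneFactor (i : ι) (z : ι → ℝ) : ℝ := (1 + coneParam M z i) / (1 + rowMono M i z)

theorem coneFactor_pos (i : ι) (z : ι → ℝ) : 0 < coneFactor M i z := by
  have h1 := one_add_rowMono_pos M i z
  have h2 := coneParam_nonneg M z i
  unfold coneFactor
  positivity

theorem contDiff_coneFactor (i : ι) : ContDiff ℝ ∞ (coneFactor M i) :=
  ContDiff.div (contDiff_const.add (contDiff_coneParam M i))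
    (contDiff_const.add (contDiff_rowMono M i)) fun z => (one_add_rowMono_pos M i z).ne'

/-- With `X = exp (-|y|)`, the parameter is `X / (1 + X)` for `y ≥ 0` and `1 / (1 + X)` for `y ≤ 0`.
Only in the second case does `1 - t` vanish at the boundary, to first order in `X`. -/
theorem one_sub_sq_coneParam (i : ι) (z : ι → ℝ) : 1 - coneParam M z i ^ 2 =
    (if i ∈ posRows M then 1 else rowMono M i z) * coneFactor M i z := by
  have h1 := one_add_rowMono_pos M i z
  unfold coneFactor coneParam
  split_ifs <;> field_simp <;> ring

theorem coneParam_mul_one_sub (i : ι) (z : ι → ℝ) :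
    coneParam M z i * (1 - coneParam M z i) =
      rowMono M i z * ((1 + rowMono M i z) ^ 2)⁻¹ := by
  have h1 := one_add_rowMono_pos M i z
  unfold coneParam
  split_ifs <;> field_simp <;> ring

theorem rowMono_halfExp (i : ι) (η : ι → ℝ) :
    rowMono M i (halfExp η) = Real.exp (-∑ j, (M i j).natAbs * η j) := by
  rw [rowMono, ← Finset.sum_neg_distrib, Real.exp_sum]
  refine Finset.prod_congr rfl fun j _ => ?_
  rw [halfExp, ← Real.exp_nat_mul]
  congr 1
  push_cast
  ring

theorem sign_rows {C : Finset (ι → ℤ)} (hC : ∀ i, Pi.single i 1 ∈ C)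
    (hsign : ∀ c ∈ C, SignConst (c ᵥ* M)) {i : ι} (hi : i ∉ posRows M) (j : ι) : M i j ≤ 0 := by
  have h := hsign _ (hC i)
  rw [Matrix.single_one_vecMul] at h
  rcases h with h | h
  · exact absurd ((mem_posRows M).2 h) hi
  · exact h j

theorem logistic_cone (hneg : ∀ i, i ∉ posRows M → ∀ j, M i j ≤ 0) (η : ι → ℝ) (i : ι) :
    logistic ((realMat M *ᵥ η) i) = coneParam M (halfExp η) i := by
  have hy : (realMat M *ᵥ η) i = ∑ j, (M i j : ℝ) * η j := rfl
  unfold coneParam logistic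
  rw [rowMono_halfExp, hy]
  by_cases hi : i ∈ posRows M
  · have h : ∑ j, ((M i j).natAbs : ℝ) * η j = ∑ j, (M i j : ℝ) * η j := by
      refine Finset.sum_congr rfl fun j _ => ?_
      have := (mem_posRows M).1 hi j
      rw [Nat.cast_natAbs, abs_of_nonneg this]
    rw [if_pos hi, h, Real.exp_neg]
    field_simp
    ring
  · have h : -∑ j, ((M i j).natAbs : ℝ) * η j = ∑ j, (M i j : ℝ) * η j := by
      rw [← Finset.sum_neg_distrib]
      refine Finset.sum_congr rfl fun j _ => ?_
      rw [Nat.cast_natAbs, abs_of_nonpos (hneg i hi j)]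
      push_cast
      ring
    rw [if_neg hi, h]

variable {𝒥 : Type*} [Fintype 𝒥] (e : 𝒥 → ι → ℕ)

/-- The polynomial with the coefficients `c` and the exponents `e`. -/
def expPoly (c : 𝒥 → ℝ) (t : ι → ℝ) : ℝ := ∑ J, (∏ i, t i ^ e J i) * c J

/-- The exponent of a monomial in the coordinates of the cone. -/
def coneExp (J : 𝒥) (j : ι) : ℕ := ∑ i ∈ posRows M, e J i * (M i j).natAbs

/-- The unit part of a monomial in the coordinates of the cone. -/
def coneUnit (J : 𝒥) (z : ι → ℝ) : ℝ := ∏ i, ((1 + rowMono M i z) ^ e J i)⁻¹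

theorem coneUnit_pos (J : 𝒥) (z : ι → ℝ) : 0 < coneUnit M e J z :=
  Finset.prod_pos fun i _ => by
    have := one_add_rowMono_pos M i z
    positivity

theorem contDiff_coneUnit (J : 𝒥) : ContDiff ℝ ∞ (coneUnit M e J) := by
  unfold coneUnit
  refine contDiff_prod fun i _ => ContDiff.inv ?_ fun z => ?_
  · exact (contDiff_const.add (contDiff_rowMono M i)).pow _
  · have := one_add_rowMono_pos M i z
    positivity

/-- Parameters from the rows outside `posRows` tend to 1 or stay interior, so they contribute only
to the unit part. -/
theorem prod_coneParam (J : 𝒥) (z : ι → ℝ) : ∏ i, coneParam M z i ^ e J i =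
    (∏ j, z j ^ (2 * coneExp M e J j)) * coneUnit M e J z := by
  have h1 : ∏ i, coneParam M z i ^ e J i =
      (∏ i, (if i ∈ posRows M then rowMono M i z else 1) ^ e J i) * coneUnit M e J z := by
    rw [coneUnit, ← Finset.prod_mul_distrib]
    refine Finset.prod_congr rfl fun i _ => ?_
    rw [coneParam, div_pow, div_eq_mul_inv]
  rw [h1]
  congr 1
  have h2 : ∏ i, (if i ∈ posRows M then rowMono M i z else 1) ^ e J i =
      ∏ i ∈ posRows M, rowMono M i z ^ e J i := by
    rw [← Finset.prod_subset (Finset.subset_univ (posRows M))]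
    · exact Finset.prod_congr rfl fun i hi => by rw [if_pos hi]
    · intro i _ hi
      rw [if_neg hi, one_pow]
  rw [h2]
  simp only [rowMono, coneExp, ← Finset.prod_pow]
  rw [Finset.prod_comm]
  refine Finset.prod_congr rfl fun j _ => ?_
  rw [Finset.mul_sum, ← Finset.prod_pow_eq_pow_sum]
  refine Finset.prod_congr rfl fun i _ => ?_
  rw [← pow_mul]
  congr 1
  ring

/-- A polynomial divided by the monomial of `J₀`, in the coordinates of the cone. -/
def reduced (c : 𝒥 → ℝ) (J₀ : 𝒥) (z : ι → ℝ) : ℝ :=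
  ∑ J, (∏ j, z j ^ (2 * (coneExp M e J j - coneExp M e J₀ j))) * coneUnit M e J z * c J

theorem contDiff_reduced (c : 𝒥 → ℝ) (J₀ : 𝒥) : ContDiff ℝ ∞ (reduced M e c J₀) := by
  have := contDiff_coneUnit M e
  unfold reduced
  fun_prop

theorem expPoly_coneParam {c : 𝒥 → ℝ} {J₀ : 𝒥}
    (hJ : ∀ J, c J ≠ 0 → ∀ j, coneExp M e J₀ j ≤ coneExp M e J j) (z : ι → ℝ) :
    expPoly e c (coneParam M z) = (∏ j, z j ^ (2 * coneExp M e J₀ j)) * reduced M e c J₀ z := by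
  rw [expPoly, reduced, Finset.mul_sum]
  refine Finset.sum_congr rfl fun J _ => ?_
  by_cases hc : c J = 0
  · simp [hc]
  rw [prod_coneParam, ← mul_assoc, ← mul_assoc, ← Finset.prod_mul_distrib]
  congr 2
  refine Finset.prod_congr rfl fun j _ => ?_
  rw [← pow_add]
  congr 1
  have := hJ J hc j
  omega

theorem reduced_pos {c : 𝒥 → ℝ} (hc : ∀ J, 0 ≤ c J) {J₀ : 𝒥} (hJ₀ : c J₀ ≠ 0) (z : ι → ℝ) :
    0 < reduced M e c J₀ z := by
  refine Finset.sum_pos' (fun J _ => ?_) ⟨J₀, Finset.mem_univ _, ?_⟩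
  · refine mul_nonneg (mul_nonneg (Finset.prod_nonneg fun j _ => ?_) (coneUnit_pos M e J z).le) (hc J)
    rw [pow_mul]; positivity
  · have h1 := coneUnit_pos M e J₀ z
    have h2 := lt_of_le_of_ne (hc J₀) (Ne.symm hJ₀)
    simp only [tsub_self, mul_zero, pow_zero, Finset.prod_const_one, one_mul]
    positivity

/-- All the differences of exponents have a constant sign on the cone, so that there is a minimal
monomial. -/
theorem exists_minimal {B : ℕ} (he : ∀ J i, e J i ≤ B)
    (hsign : ∀ c ∈ Fintype.piFinset fun _ : ι => Finset.Icc (-(B : ℤ)) B, SignConst (c ᵥ* M))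
    {c : 𝒥 → ℝ} (hc : ∃ J, c J ≠ 0) :
    ∃ J₀, c J₀ ≠ 0 ∧ ∀ J, c J ≠ 0 → ∀ j, coneExp M e J₀ j ≤ coneExp M e J j := by
  classical
  obtain ⟨J₀, hJ₀, hmin⟩ := (Finset.univ.filter fun J => c J ≠ 0).exists_min_image
    (fun J => ∑ j, coneExp M e J j) (by obtain ⟨J, hJ⟩ := hc; exact ⟨J, by simpa using hJ⟩)
  refine ⟨J₀, by simpa using hJ₀, fun J hJ => ?_⟩
  have hmin' := hmin J (by simpa using hJ)
  -- Only the rows in `posRows` enter the exponents on the cone. The entries lie in `[-B, B]`, so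
  -- this form is among those with constant sign.
  let δ : ι → ℤ := fun i => if i ∈ posRows M then (e J i : ℤ) - e J₀ i else 0
  have hδ : δ ∈ Fintype.piFinset fun _ : ι => Finset.Icc (-(B : ℤ)) B := by
    rw [Fintype.mem_piFinset]
    intro i
    have h1 := he J i
    have h2 := he J₀ i
    simp only [δ, Finset.mem_Icc]
    split_ifs <;> omega
  have hval : ∀ j, (δ ᵥ* M) j = (coneExp M e J j : ℤ) - coneExp M e J₀ j := by
    intro j
    simp only [coneExp, Matrix.vecMul, dotProduct]
    push_cast
    rw [← Finset.sum_sub_distrib, ← Finset.sum_subset (Finset.subset_univ (posRows M))]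
    · refine Finset.sum_congr rfl fun i hi => ?_
      have := (mem_posRows M).1 hi j
      simp only [δ, if_pos hi]
      rw [abs_of_nonneg this]
      ring
    · intro i _ hi
      simp [δ, hi]
  rcases hsign δ hδ with h | h
  · intro j
    have := h j
    rw [hval] at this
    omega
  · have hle : ∀ j ∈ Finset.univ, coneExp M e J j ≤ coneExp M e J₀ j := fun j _ => by
      have := h j
      rw [hval] at this
      omega
    -- The wrong sign contradicts the minimality of the total exponent unless all the exponents
    -- agree.
    have heq := (Finset.sum_eq_sum_iff_of_le hle).1 (le_antisymm (Finset.sum_le_sum hle) hmin')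
    exact fun j => (heq j (Finset.mem_univ j)).ge

end Cone

end SectorIntegral

/-! ### Parametric integrals on a cone -/

namespace SectorIntegral

open scoped ContDiff

variable {ι : Type*} [Fintype ι] [DecidableEq ι] {X Ω κ : Type*} [AddCommGroup X] [Module ℂ X]
  [TopologicalSpace X] [MeasurableSpace Ω] [Fintype κ] {P : PhaseFamily X Ω κ}
  {𝒥 : Type*} [Fintype 𝒥]

/-- The polynomials of a parametric integral over the unit cube: the polynomial with the
coefficients `cU`, the polynomial with the coefficients `cP` which dominates it, and the numerators
of the coefficients of the phase. -/
structure ParametricData (ι : Type*) [Fintype ι] (P : PhaseFamily X Ω κ) (𝒥 : Type*)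
    [Fintype 𝒥] where
  e : 𝒥 → ι → ℕ
  cU : 𝒥 → ℝ
  cP : 𝒥 → ℝ
  cN : κ → 𝒥 → ℝ
  e_le : ∀ J i, e J i ≤ 2
  cU_nonneg : ∀ J, 0 ≤ cU J
  cU_le : ∀ J, cU J ≤ cP J
  cN_le : ∀ k J, |cN k J| ≤ cP J
  low : ∃ J, (∀ i, e J i ≤ 1) ∧ cU J ≠ 0
  adm : ∀ t : ι → ℝ, (∀ i, t i ∈ Set.Ioo (0 : ℝ) 1) →
    P.Admissible fun k => ((expPoly e (cN k) t / expPoly e cP t : ℝ) : ℂ)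

namespace ParametricData

variable (d : ParametricData ι P 𝒥)

/-- The scalar weight of the parametric integral. -/
def weight (D : ℂ) (t : ι → ℝ) : ℂ :=
  (∏ i, ((1 - t i ^ 2 : ℝ) : ℂ) ^ (D / 2 - 1)) / (expPoly d.e d.cU t : ℂ) ^ (D / 2) *
    ((expPoly d.e d.cU t / expPoly d.e d.cP t : ℝ) : ℂ) ^ 2

/-- The integrand. -/
def integrand (D : ℂ) (f : X) (t : ι → ℝ) : ℂ :=
  d.weight D t * P.avg [] (fun k => ((expPoly d.e (d.cN k) t / expPoly d.e d.cP t : ℝ) : ℂ)) f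

/-- The parametric integral. -/
def val (D : ℂ) (f : X) : ℂ := ∫ t in Set.univ.pi fun _ => Set.Ioo 0 1, d.integrand D f t

theorem cP_nonneg (J : 𝒥) : 0 ≤ d.cP J := (d.cU_nonneg J).trans (d.cU_le J)

theorem cP_ne_zero {J : 𝒥} (hJ : d.cU J ≠ 0) : d.cP J ≠ 0 :=
  ((lt_of_le_of_ne (d.cU_nonneg J) (Ne.symm hJ)).trans_le (d.cU_le J)).ne'

theorem cP_ne_zero_of_cN {k : κ} {J : 𝒥} (hJ : d.cN k J ≠ 0) : d.cP J ≠ 0 :=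
  ((abs_pos.2 hJ).trans_le (d.cN_le k J)).ne'

variable (M : Matrix ι ι ℤ)

/-- A minimal monomial of the polynomial on the cone. -/
def IsMinimal (e : 𝒥 → ι → ℕ) (c : 𝒥 → ℝ) (J₀ : 𝒥) : Prop :=
  c J₀ ≠ 0 ∧ ∀ J, c J ≠ 0 → ∀ j, coneExp M e J₀ j ≤ coneExp M e J j

variable {M} {J₀ J₁ : 𝒥}

theorem reduced_cU_pos (h₀ : IsMinimal M d.e d.cU J₀) (z : ι → ℝ) :
    0 < reduced M d.e d.cU J₀ z := reduced_pos M d.e d.cU_nonneg h₀.1 z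

theorem reduced_cP_pos (h₁ : IsMinimal M d.e d.cP J₁) (z : ι → ℝ) :
    0 < reduced M d.e d.cP J₁ z := reduced_pos M d.e d.cP_nonneg h₁.1 z

theorem ratio_eq (h₁ : IsMinimal M d.e d.cP J₁) {z : ι → ℝ} (hz : ∀ j, z j ≠ 0) (k : κ) :
    expPoly d.e (d.cN k) (coneParam M z) / expPoly d.e d.cP (coneParam M z) =
      reduced M d.e (d.cN k) J₁ z / reduced M d.e d.cP J₁ z := by
  rw [expPoly_coneParam M d.e h₁.2, expPoly_coneParam M d.e fun J hJ => h₁.2 J (d.cP_ne_zero_of_cN hJ),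
    mul_div_mul_left]
  exact Finset.prod_ne_zero_iff.2 fun j _ => pow_ne_zero _ (hz j)

/-- Where no coordinate vanishes, `coneParam` lies in the open cube and admissibility is given. The
other points are limits of such points, by moving the zero coordinates to `ε`, and the condition is
closed. -/
theorem admissible_cone (h₁ : IsMinimal M d.e d.cP J₁) (z : ι → ℝ) : P.Admissible fun k =>
    ((reduced M d.e (d.cN k) J₁ z / reduced M d.e d.cP J₁ z : ℝ) : ℂ) := by
  intro w
  let path : ℝ → ι → ℝ := fun ε j => z j + ε * if z j = 0 then 1 else 0
  let g : (ι → ℝ) → ℝ := fun z => (∑ k, ((reduced M d.e (d.cN k) J₁ z /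
    reduced M d.e d.cP J₁ z : ℝ) : ℂ) * P.q k w).re
  have hg : Continuous g := by
    have h1 := fun c => (contDiff_reduced M d.e c J₁).continuous
    have h2 : ∀ k, Continuous fun z => reduced M d.e (d.cN k) J₁ z / reduced M d.e d.cP J₁ z :=
      fun k => (h1 _).div (h1 _) fun z => (d.reduced_cP_pos h₁ z).ne'
    simp only [g]
    fun_prop
  have hpath : Continuous path := by simp only [path]; fun_prop
  have hlim : Filter.Tendsto (fun ε => g (path ε)) (nhdsWithin 0 (Set.Ioi 0)) (nhds (g z)) := by
    have := ((hg.comp hpath).tendsto 0).mono_left (nhdsWithin_le_nhds (s := Set.Ioi 0))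
    have h0 : path 0 = z := by ext j; simp [path]
    rw [Function.comp_apply, h0] at this
    exact this
  refine ge_of_tendsto hlim ?_
  filter_upwards [self_mem_nhdsWithin] with ε hε
  have hne : ∀ j, path ε j ≠ 0 := by
    intro j
    by_cases hj : z j = 0
    · simpa [path, hj] using (Set.mem_Ioi.1 hε).ne'
    · simp [path, hj]
  have := d.adm (coneParam M (path ε)) (coneParam_mem M hne) w
  simp only [d.ratio_eq h₁ hne] at this
  exact this

variable (M) in
/-- The sum of the absolute values of some entries of a column. -/
def colAbs (s : Finset ι) (j : ι) : ℕ := ∑ i ∈ s, (M i j).natAbs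

/-- The sector data of a cone. -/
def coneData (h₀ : IsMinimal M d.e d.cU J₀) (h₁ : IsMinimal M d.e d.cP J₁) : SectorData ι P where
  A j := (colAbs M (posRows M)ᶜ j : ℤ) - coneExp M d.e J₀ j
  b j := 2 * (colAbs M (posRows M) j : ℤ) +
    4 * ((coneExp M d.e J₀ j : ℤ) - coneExp M d.e J₁ j)
  a z := ((1 / 2 * ∑ i, Real.log (coneFactor M i z) -
    1 / 2 * Real.log (reduced M d.e d.cU J₀ z) : ℝ) : ℂ)
  ρ z := (((∏ i, ((1 + rowMono M i z) ^ 2)⁻¹ * (coneFactor M i z)⁻¹) *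
    (reduced M d.e d.cU J₀ z / reduced M d.e d.cP J₁ z) ^ 2 : ℝ) : ℂ)
  R z k := ((reduced M d.e (d.cN k) J₁ z / reduced M d.e d.cP J₁ z : ℝ) : ℂ)
  l := []
  smooth_a := by
    refine Complex.ofRealCLM.contDiff.comp ?_
    refine (contDiff_const.mul (ContDiff.sum fun i _ => ?_)).sub (contDiff_const.mul ?_)
    · exact (contDiff_coneFactor M i).log fun z => (coneFactor_pos M i z).ne'
    · exact (contDiff_reduced M d.e d.cU J₀).log fun z => (d.reduced_cU_pos h₀ z).ne'
  smooth_ρ := by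
    refine Complex.ofRealCLM.contDiff.comp ?_
    refine (contDiff_prod fun i _ => ContDiff.mul (ContDiff.inv ?_ fun z => ?_)
      (ContDiff.inv (contDiff_coneFactor M i) fun z => (coneFactor_pos M i z).ne')).mul
      (ContDiff.pow (ContDiff.div (contDiff_reduced M d.e _ _) (contDiff_reduced M d.e _ _)
        fun z => (d.reduced_cP_pos h₁ z).ne') 2)
    · exact (contDiff_const.add (contDiff_rowMono M i)).pow 2
    · exact pow_ne_zero 2 (one_add_rowMono_pos M i z).ne'
  smooth_R k := Complex.ofRealCLM.contDiff.comp
    (ContDiff.div (contDiff_reduced M d.e _ _) (contDiff_reduced M d.e _ _)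
        fun z => (d.reduced_cP_pos h₁ z).ne')
  adm := d.admissible_cone h₁

theorem ofReal_cpow_exp {x : ℝ} (hx : 0 < x) (c : ℂ) :
    (x : ℂ) ^ c = Complex.exp (Real.log x * c) := by
  rw [Complex.cpow_def_of_ne_zero (by exact_mod_cast hx.ne'), Complex.ofReal_log hx.le]

theorem halfExp_ne_zero (η : ι → ℝ) (j : ι) : halfExp η j ≠ 0 := (Real.exp_pos _).ne'

theorem prod_halfExp (n : ι → ℕ) (η : ι → ℝ) :
    ∏ j, halfExp η j ^ (2 * n j) = Real.exp (-∑ j, n j * η j) := by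
  rw [← Finset.sum_neg_distrib, Real.exp_sum]
  refine Finset.prod_congr rfl fun j _ => ?_
  rw [halfExp, ← Real.exp_nat_mul]
  congr 1
  push_cast
  ring

theorem integrand_cone (hneg : ∀ i, i ∉ posRows M → ∀ j, M i j ≤ 0)
    (h₀ : IsMinimal M d.e d.cU J₀) (h₁ : IsMinimal M d.e d.cP J₁) (D : ℂ) (f : X) (η : ι → ℝ) :
    (logisticJac (realMat M *ᵥ η) : ℂ) * d.integrand D f (fun i => logistic ((realMat M *ᵥ η) i)) =
      (d.coneData h₀ h₁).kernel D f η := by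
  have hz := halfExp_ne_zero η
  set z := halfExp η with hzdef
  have ht : (fun i => logistic ((realMat M *ᵥ η) i)) = coneParam M z :=
    funext fun i => logistic_cone M hneg η i
  -- The sums `E1` and `E2` collect `|y_i|` over the rows outside and inside `posRows`; `E3` and
  -- `E4` are the exponents of the minimal monomials of `U` and `P`. The Jacobian contributes `-E1 -
  -- E2`, the powers of `1 - t²` contribute `-E1 (D / 2 - 1)`, `U` contributes `E3 D / 2` and the
  -- squared ratio `-2 (E3 - E4)`. The sum is the exponent encoded by `A` and `b` of `coneData`.
  let E1 : ℝ := ∑ i ∈ (posRows M)ᶜ, ∑ j, (M i j).natAbs * η j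
  let E2 : ℝ := ∑ i ∈ posRows M, ∑ j, (M i j).natAbs * η j
  let E3 : ℝ := ∑ j, coneExp M d.e J₀ j * η j
  let E4 : ℝ := ∑ j, coneExp M d.e J₁ j * η j
  let Λ : ℝ := ∑ i, Real.log (coneFactor M i z)
  let U : ℝ := reduced M d.e d.cU J₀ z
  let W : ℝ := reduced M d.e d.cP J₁ z
  let q : ℝ := ∏ i, ((1 + rowMono M i z) ^ 2)⁻¹
  have hU : 0 < U := d.reduced_cU_pos h₀ z
  have hW : 0 < W := d.reduced_cP_pos h₁ z
  have hjac : logisticJac (realMat M *ᵥ η) = Real.exp (-E1 - E2) * q := by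
    have h1 : logisticJac (realMat M *ᵥ η) =
        (∏ i, rowMono M i z) * q := by
      rw [← Finset.prod_mul_distrib, logisticJac]
      refine Finset.prod_congr rfl fun i _ => ?_
      rw [← coneParam_mul_one_sub, ← congrFun ht i]
    have h2 : ∏ i, rowMono M i z = Real.exp (-E1 - E2) := by
      simp only [hzdef, rowMono_halfExp]
      rw [← Real.exp_sum, Finset.sum_neg_distrib, ← Finset.sum_add_sum_compl (posRows M)]
      congr 1
      simp only [E1, E2]
      ring
    rw [h1, h2]
  have hlog : ∑ i, Real.log (1 - coneParam M z i ^ 2) = -E1 + Λ := by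
    have h1 : ∀ i, Real.log (1 - coneParam M z i ^ 2) =
        (if i ∈ posRows M then 0 else -∑ j, (M i j).natAbs * η j) +
          Real.log (coneFactor M i z) := by
      intro i
      rw [one_sub_sq_coneParam]
      split_ifs with hi
      · rw [one_mul, zero_add]
      · rw [Real.log_mul (rowMono_pos M i hz).ne' (coneFactor_pos M i z).ne', hzdef,
          rowMono_halfExp, Real.log_exp]
    simp only [h1, Finset.sum_add_distrib]
    congr 1
    rw [← Finset.sum_add_sum_compl (posRows M), Finset.sum_eq_zero (s := posRows M), zero_add,
      ← Finset.sum_neg_distrib]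
    · refine Finset.sum_congr rfl fun i hi => ?_
      rw [if_neg (Finset.mem_compl.1 hi)]
    · intro i hi
      rw [if_pos hi]
  have hprod : (∏ i, ((1 - coneParam M z i ^ 2 : ℝ) : ℂ) ^ (D / 2 - 1)) =
      Complex.exp (((-E1 + Λ : ℝ) : ℂ) * (D / 2 - 1)) := by
    rw [← hlog, Complex.ofReal_sum, Finset.sum_mul, Complex.exp_sum]
    refine Finset.prod_congr rfl fun i _ => ofReal_cpow_exp ?_ _
    have := coneParam_mem M hz i
    nlinarith [this.1, this.2]
  have hPU : expPoly d.e d.cU (coneParam M z) = Real.exp (-E3) * U := by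
    rw [expPoly_coneParam M d.e h₀.2, hzdef, prod_halfExp]
  have hPW : expPoly d.e d.cP (coneParam M z) = Real.exp (-E4) * W := by
    rw [expPoly_coneParam M d.e h₁.2, hzdef, prod_halfExp]
  have hpow : ((expPoly d.e d.cU (coneParam M z) : ℝ) : ℂ) ^ (D / 2) =
      Complex.exp (((-E3 + Real.log U : ℝ) : ℂ) * (D / 2)) := by
    rw [hPU, ofReal_cpow_exp (by positivity), Real.log_mul (Real.exp_pos _).ne' hU.ne',
      Real.log_exp]
  have hratio : expPoly d.e d.cU (coneParam M z) / expPoly d.e d.cP (coneParam M z) =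
      Real.exp (-E3 + E4) * (U / W) := by
    rw [hPU, hPW, Real.exp_add, Real.exp_neg E4]
    field_simp
  have hs : -∑ j, (d.coneData h₀ h₁).s D j * η j =
      -(D / 2 * (E1 - E3) + E2 + 2 * (E3 - E4)) := by
    have e1 : E1 = ∑ j, (colAbs M (posRows M)ᶜ j : ℝ) * η j := by
      simp only [E1, colAbs, Nat.cast_sum, Finset.sum_mul]
      rw [Finset.sum_comm]
    have e2 : E2 = ∑ j, (colAbs M (posRows M) j : ℝ) * η j := by
      simp only [E2, colAbs, Nat.cast_sum, Finset.sum_mul]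
      rw [Finset.sum_comm]
    rw [e1, e2]
    simp only [E3, E4, SectorData.s, coneData]
    push_cast
    simp only [mul_sub, Finset.mul_sum]
    rw [← Finset.sum_sub_distrib, ← Finset.sum_add_distrib, ← Finset.sum_sub_distrib,
      ← Finset.sum_add_distrib]
    congr 1
    refine Finset.sum_congr rfl fun j _ => ?_
    ring
  have hρ : (d.coneData h₀ h₁).ρ z = q * Complex.exp (-Λ) * (U / W) ^ 2 := by
    have h1 : ∏ i, ((1 + rowMono M i z) ^ 2)⁻¹ * (coneFactor M i z)⁻¹ = q * Real.exp (-Λ) := by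
      rw [Finset.prod_mul_distrib]
      congr 1
      simp only [Λ]
      rw [← Finset.sum_neg_distrib, Real.exp_sum]
      refine Finset.prod_congr rfl fun i _ => ?_
      rw [Real.exp_neg, Real.exp_log (coneFactor_pos M i z)]
    simp only [coneData, h1]
    push_cast
    rfl
  have ha : (d.coneData h₀ h₁).a z = 1 / 2 * Λ - 1 / 2 * (Real.log U : ℝ) := by
    simp only [coneData, Λ]
    push_cast
    rfl
  have hR : (fun k => ((expPoly d.e (d.cN k) (coneParam M z) /
      expPoly d.e d.cP (coneParam M z) : ℝ) : ℂ)) = (d.coneData h₀ h₁).R z :=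
    funext fun k => by rw [d.ratio_eq h₁ hz]; rfl
  rw [ht, SectorData.kernel, SectorData.reg, integrand, weight, hjac, hprod, hpow, hratio, hR, hs,
    ← hzdef, hρ, ha]
  change _ = _ * (_ * _ * P.avg [] _ f)
  push_cast
  rw [mul_pow, ← Complex.exp_nat_mul]
  have key : ∀ a b c g h k l m : ℂ, a - c + b + g = h + k + l →
      Complex.exp a * q * (Complex.exp b / Complex.exp c * (Complex.exp g * (U / W) ^ 2) * m) =
      Complex.exp h * (Complex.exp k * (q * Complex.exp l * (U / W) ^ 2) * m) := by
    intro a b c g h k l m hsum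
    have h1 : Complex.exp a * (Complex.exp b / Complex.exp c) * Complex.exp g =
        Complex.exp h * Complex.exp k * Complex.exp l := by
      rw [← Complex.exp_sub, ← Complex.exp_add, ← Complex.exp_add, ← Complex.exp_add,
        ← Complex.exp_add, ← hsum]
      congr 1
      ring
    calc _ = (Complex.exp a * (Complex.exp b / Complex.exp c) * Complex.exp g) *
          (q * (U / W) ^ 2 * m) := by ring
      _ = _ := by rw [h1]; ring
  refine key _ _ _ _ _ _ _ _ ?_
  push_cast
  ring

/-- Let `a` and `b` be the sums of `|M i j|` over the rows inside and outside `posRows`. The low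
monomial bounds the minimal exponent of `U` by `a`, and `U ≤ P` makes the exponent of `P` no larger
than that of `U`. Hence `2 Re s_j ≥ b Re D + a (2 - Re D)`, which is positive in the strip since no
column of `M` is zero. -/
theorem strip_subset_domain (hdet : M.det ≠ 0) (h₀ : IsMinimal M d.e d.cU J₀)
    (h₁ : IsMinimal M d.e d.cP J₁) (D : ℂ) (hD0 : 0 < D.re) (hD2 : D.re < 2) :
    D ∈ (d.coneData h₀ h₁).domain := by
  intro j
  have hcol : 0 < ∑ i, (M i j).natAbs := by
    by_contra hcon
    refine hdet (Matrix.det_eq_zero_of_column_eq_zero j fun i => ?_)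
    have h := Finset.sum_eq_zero_iff.1 (Nat.eq_zero_of_not_pos hcon) i (Finset.mem_univ i)
    exact Int.natAbs_eq_zero.1 h
  rw [← Finset.sum_add_sum_compl (posRows M)] at hcol
  change 0 < colAbs M (posRows M) j + colAbs M (posRows M)ᶜ j at hcol
  obtain ⟨J, hJe, hJ⟩ := d.low
  have hκ0 : (coneExp M d.e J₀ j : ℝ) ≤ colAbs M (posRows M) j := by
    have h1 := h₀.2 J hJ j
    have h2 : coneExp M d.e J j ≤ colAbs M (posRows M) j :=
      Finset.sum_le_sum fun i _ => by
        have := Nat.mul_le_mul_right (M i j).natAbs (hJe i)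
        simpa using this
    exact_mod_cast h1.trans h2
  have hκ1 : (coneExp M d.e J₁ j : ℝ) ≤ coneExp M d.e J₀ j := by
    exact_mod_cast h₁.2 J₀ (d.cP_ne_zero h₀.1) j
  have hre : ((d.coneData h₀ h₁).s D j).re =
      (((colAbs M (posRows M)ᶜ j : ℝ) - coneExp M d.e J₀ j) * D.re +
        (2 * (colAbs M (posRows M) j : ℝ) +
          4 * ((coneExp M d.e J₀ j : ℝ) - coneExp M d.e J₁ j))) / 2 := by
    have : (d.coneData h₀ h₁).s D j =
        (((((colAbs M (posRows M)ᶜ j : ℝ) - coneExp M d.e J₀ j : ℝ) : ℂ) * D +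
        ((2 * (colAbs M (posRows M) j : ℝ) +
          4 * ((coneExp M d.e J₀ j : ℝ) - coneExp M d.e J₁ j) : ℝ) : ℂ)) / 2) := by
      simp only [SectorData.s, coneData]
      push_cast
      rfl
    rw [this, Complex.div_ofNat_re, Complex.add_re, Complex.re_ofReal_mul, Complex.ofReal_re]
  rw [hre]
  have hcol' : (0 : ℝ) < colAbs M (posRows M) j + colAbs M (posRows M)ᶜ j := by exact_mod_cast hcol
  have ha : (0 : ℝ) ≤ colAbs M (posRows M) j := Nat.cast_nonneg _
  have hb : (0 : ℝ) ≤ colAbs M (posRows M)ᶜ j := Nat.cast_nonneg _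
  set a : ℝ := (colAbs M (posRows M) j : ℝ)
  set b : ℝ := (colAbs M (posRows M)ᶜ j : ℝ)
  have h1 : (coneExp M d.e J₀ j : ℝ) * D.re ≤ a * D.re := mul_le_mul_of_nonneg_right hκ0 hD0.le
  have h2 : 0 < b * D.re + a * (2 - D.re) := by
    rcases hb.eq_or_lt with h | h
    · have : 0 < a := by linarith
      have := mul_pos this (sub_pos.2 hD2)
      rw [← h]; linarith
    · have := mul_pos h hD0
      have := mul_nonneg ha (sub_pos.2 hD2).le
      linarith
  nlinarith

end ParametricData

end SectorIntegral

/-! ### Summation over the cones -/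

namespace SectorIntegral

open scoped ContDiff

/-- The bound 2 covers the differences of two exponent vectors of the polynomials, and also the unit
forms, which give the rows of `M` constant signs. The cones depend on nothing but the index set, and
so will the poles. -/
theorem exists_cones (ι : Type*) [Fintype ι] [DecidableEq ι] : ∃ l : List (Matrix ι ι ℤ),
    (∀ M ∈ l, M.det ≠ 0 ∧ ∀ c ∈ Fintype.piFinset fun _ : ι => Finset.Icc (-((2 : ℕ) : ℤ)) (2 : ℕ),
      SignConst (c ᵥ* M)) ∧
    (volume : Measure (ι → ℝ)) =
      (l.map fun M => (volume : Measure (ι → ℝ)).restrict (cone M)).sum :=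
  decomp_forms _ decomp_volume

/-- Simplicial cones that subdivide `ℝ^ι` and are compatible with all the linear forms with
coefficients at most `2`. -/
def cones (ι : Type*) [Fintype ι] [DecidableEq ι] : List (Matrix ι ι ℤ) := (exists_cones ι).choose

/-- The sum of the absolute values of the entries. -/
def entrySum {ι : Type*} [Fintype ι] (M : Matrix ι ι ℤ) : ℕ := ∑ i, ∑ j, (M i j).natAbs

/-- A common multiple of the slopes of the exponents on the cones. -/
def modulus (ι : Type*) [Fintype ι] [DecidableEq ι] : ℕ :=
  ((cones ι).map fun M => (2 * entrySum M).factorial).prod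

theorem modulus_ne_zero (ι : Type*) [Fintype ι] [DecidableEq ι] : modulus ι ≠ 0 := by
  rw [modulus, Ne, List.prod_eq_zero_iff, List.mem_map]
  rintro ⟨M, -, h⟩
  exact (Nat.factorial_ne_zero _) h

variable {ι : Type*} [Fintype ι] [DecidableEq ι] {X Ω κ : Type*} [AddCommGroup X] [Module ℂ X]
  [TopologicalSpace X] [MeasurableSpace Ω] [Fintype κ] {P : PhaseFamily X Ω κ}
  {𝒥 : Type*} [Fintype 𝒥]

instance : Nonempty (SectorData ι P) :=
  ⟨{ A := 0, b := 0, a := 0, ρ := 0, R := 0, l := [],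
     smooth_a := contDiff_const, smooth_ρ := contDiff_const,
     smooth_R := fun _ => contDiff_const, adm := fun _ _ => by simp }⟩

theorem Continues.list_sum [IsTopologicalAddGroup X] [ContinuousSMul ℂ X] {N : ℕ} {r : ℝ}
    {β : Type*} (l : List β) {J : β → ℂ → X → ℂ}
    (h : ∀ k ∈ l, Continues N r (J k)) :
    Continues N r fun D f => (l.map fun k => J k D f).sum := by
  induction l with
  | nil => simpa using Continues.zero
  | cons a l ih =>
    simp_rw [List.map_cons, List.sum_cons]
    exact (h a (by simp)).add (ih fun k hk => h k (by simp [hk]))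

theorem natAbs_le_entrySum (M : Matrix ι ι ℤ) (s : Finset ι) (j : ι) :
    ∑ i ∈ s, (M i j).natAbs ≤ entrySum M := by
  refine (Finset.sum_le_sum_of_subset (Finset.subset_univ s)).trans ?_
  exact Finset.sum_le_sum fun i _ =>
    Finset.single_le_sum (f := fun j => (M i j).natAbs) (fun j _ => Nat.zero_le _) (Finset.mem_univ j)

namespace ParametricData

variable (d : ParametricData ι P 𝒥)

theorem exists_sectorData : ∃ σ : Matrix ι ι ℤ → SectorData ι P, ∀ M ∈ cones ι,
    (∀ D f (η : ι → ℝ), (logisticJac (realMat M *ᵥ η) : ℂ) *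
      d.integrand D f (fun i => logistic ((realMat M *ᵥ η) i)) = (σ M).kernel D f η) ∧
    (∀ j, (σ M).A j ≠ 0 → (σ M).A j ∣ modulus ι) ∧
    ∀ D : ℂ, 0 < D.re → D.re < 2 → D ∈ (σ M).domain := by
  suffices h : ∀ M ∈ cones ι, ∃ σ : SectorData ι P,
      (∀ D f (η : ι → ℝ), (logisticJac (realMat M *ᵥ η) : ℂ) *
        d.integrand D f (fun i => logistic ((realMat M *ᵥ η) i)) = σ.kernel D f η) ∧
      (∀ j, σ.A j ≠ 0 → σ.A j ∣ modulus ι) ∧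
      ∀ D : ℂ, 0 < D.re → D.re < 2 → D ∈ σ.domain by
    choose! σ hσ using h
    exact ⟨σ, hσ⟩
  intro M hM
  obtain ⟨hdet, hsign⟩ := (exists_cones ι).choose_spec.1 M hM
  obtain ⟨J, -, hJ⟩ := d.low
  obtain ⟨J₀, h₀⟩ := exists_minimal M d.e d.e_le hsign ⟨J, hJ⟩
  obtain ⟨J₁, h₁⟩ := exists_minimal M d.e d.e_le hsign ⟨J, d.cP_ne_zero hJ⟩
  have hneg : ∀ i, i ∉ posRows M → ∀ j, M i j ≤ 0 := fun i hi => sign_rows M (fun i => by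
    rw [Fintype.mem_piFinset]
    intro k
    rw [Pi.single_apply, Finset.mem_Icc]
    split_ifs <;> simp) hsign hi
  refine ⟨d.coneData h₀ h₁, fun D f η => d.integrand_cone hneg h₀ h₁ D f η, fun j hj => ?_,
    d.strip_subset_domain hdet h₀ h₁⟩
  have hb1 := natAbs_le_entrySum M (posRows M)ᶜ j
  have hb2 : coneExp M d.e J₀ j ≤ 2 * entrySum M := by
    refine le_trans ?_ (Nat.mul_le_mul_left 2 (natAbs_le_entrySum M (posRows M) j))
    rw [Finset.mul_sum]
    exact Finset.sum_le_sum fun i _ => Nat.mul_le_mul_right _ (d.e_le J₀ i)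
  have hle : ((d.coneData h₀ h₁).A j).natAbs ≤ 2 * entrySum M := by
    change ((colAbs M (posRows M)ᶜ j : ℤ) - coneExp M d.e J₀ j).natAbs ≤ _
    change colAbs M (posRows M)ᶜ j ≤ _ at hb1
    omega
  -- A nonzero slope of size at most `2 * entrySum M` divides the factorial that stands for `M` in
  -- the modulus.
  have h1 : ((d.coneData h₀ h₁).A j).natAbs ∣ modulus ι :=
    (Nat.dvd_factorial (Int.natAbs_pos.2 hj) hle).trans
      (List.dvd_prod (List.mem_map.2 ⟨M, hM, rfl⟩))
  exact Int.natAbs_dvd_natAbs.1 (by simpa using h1)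

/-- **Continuation of parametric integrals.** -/
theorem exists_family [IsTopologicalAddGroup X] [ContinuousSMul ℂ X]
    (hint : ∀ D ∈ strip, ∀ f, IntegrableOn (d.integrand D f)
      (Set.univ.pi fun _ => Set.Ioo (0 : ℝ) 1)) :
    ∃ T : ℂ → X →L[ℂ] ℂ, (∀ D ∈ strip, ∀ f, T D f = d.val D f) ∧
      ∀ f, (∀ D, MeromorphicAt (fun D => T D f) D) ∧
        ∀ D, (D ∈ strip ∨ ¬ ∃ k : ℤ, (modulus ι : ℂ) * D = k) →
          AnalyticAt ℂ (fun D => T D f) D := by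
  obtain ⟨σ, hσ⟩ := d.exists_sectorData
  have hval : ∀ D ∈ strip, ∀ f, d.val D f =
      ((cones ι).map fun M => ((|M.det| : ℤ) : ℂ) * (σ M).val D f).sum := by
    intro D hD f
    obtain ⟨h1, h2⟩ := cube_change_of_variables (d.integrand D f)
    have h3 := h1.1 (hint D hD f)
    have hvol := (exists_cones ι).choose_spec.2
    rw [val, h2]
    rw [hvol] at h3 ⊢
    rw [(integral_decomp (fun M hM => ((exists_cones ι).choose_spec.1 M hM).1) h3).2]
    refine congrArg List.sum (List.map_congr_left fun M hM => ?_)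
    rw [SectorData.val]
    congr 1
    refine setIntegral_congr_fun measurableSet_orthant fun η _ => ?_
    exact (hσ M hM).1 D f η
  refine Continues.exists_global (modulus_ne_zero ι) (fun r => ?_) (fun D hD => ?_) fun f => ?_
  · refine Continues.congr (Continues.list_sum (cones ι) fun M hM =>
      ((σ M).continues r (hσ M hM).2.1 (hσ M hM).2.2).const_mul ((|M.det| : ℤ) : ℂ))
      fun D h0 h2 f => hval D ⟨h0, h2⟩ f
  · have h : ∀ l : List (Matrix ι ι ℤ), (∀ M ∈ l, M ∈ cones ι) → ∃ T : X →L[ℂ] ℂ, ∀ f, T f =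
        (l.map fun M => ((|M.det| : ℤ) : ℂ) * (σ M).val D f).sum := by
      intro l
      induction l with
      | nil => exact fun _ => ⟨0, by simp⟩
      | cons M l ih =>
        intro hl
        obtain ⟨T, hT⟩ := ih fun M' hM' => hl M' (by simp [hM'])
        obtain ⟨T', hT'⟩ := (σ M).exists_clm ((hσ M (hl M (by simp))).2.2 D hD.1 hD.2)
        exact ⟨((|M.det| : ℤ) : ℂ) • T' + T, fun f => by simp [hT, hT']⟩
    obtain ⟨T, hT⟩ := h (cones ι) fun _ h => h
    exact ⟨T, fun f => by rw [hT, hval D hD]⟩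
  · refine DifferentiableOn.congr ?_ fun D hD => hval D hD f
    have h : ∀ l : List (Matrix ι ι ℤ), (∀ M ∈ l, M ∈ cones ι) → DifferentiableOn ℂ (fun D =>
        (l.map fun M => ((|M.det| : ℤ) : ℂ) * (σ M).val D f).sum) strip := by
      intro l
      induction l with
      | nil => exact fun _ => by simp
      | cons M l ih =>
        intro hl
        simp_rw [List.map_cons, List.sum_cons]
        refine DifferentiableOn.add (fun D hD => ?_) (ih fun M' hM' => hl M' (by simp [hM']))
        exact (((σ M).val_hasDerivAt ((hσ M (hl M (by simp))).2.2 D hD.1 hD.2) f).const_mul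
          _).differentiableWithinAt
    exact h (cones ι) fun _ h => h

end ParametricData

end SectorIntegral

/-! ### The amplitude of a graph as a parametric integral -/

namespace Phi4Graph

open RowMinor Twisted SectorIntegral SchwartzMap

variable {V L : Type*} [Fintype V] [DecidableEq V] [Fintype L] [DecidableEq L]
  (G : Phi4Graph V L)

theorem mem_cube {t : L → ℝ} : t ∈ cube L ↔ ∀ ℓ, t ℓ ∈ Set.Ioo (0 : ℝ) 1 := by
  simp [cube]

theorem measurableSet_cube : MeasurableSet (cube L) :=
  MeasurableSet.univ_pi fun _ => measurableSet_Ioo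

theorem ne_zero_of_mem_cube {t : L → ℝ} (ht : t ∈ cube L) (ℓ : L) : t ℓ ≠ 0 :=
  (mem_cube.1 ht ℓ).1.ne'

variable {G} in
-- All the monomials are nonnegative on the cube, and the one with exponents at most 1 alone
-- dominates the product of the parameters.
theorem exists_lower_bound (hG : G.IsConnected) (root : V) (s : ℝ) : ∃ c : ℝ, 0 < c ∧
    ∀ t ∈ cube L, c * ∏ ℓ, t ℓ ≤ G.HU root s t := by
  obtain ⟨J, hJ, hJ0⟩ := G.exists_coeffU_ne_zero hG root s
  have hc := lt_of_le_of_ne (G.coeffU_nonneg root s J) (Ne.symm hJ0)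
  refine ⟨G.coeffU root s J, hc, fun t ht => ?_⟩
  have ht' := mem_cube.1 ht
  rw [G.HU_eq root s (ne_zero_of_mem_cube ht)]
  have h1 : ∏ ℓ, t ℓ ≤ ∏ ℓ, t ℓ ^ linePower J ℓ :=
    Finset.prod_le_prod (fun ℓ _ => (ht' ℓ).1.le) fun ℓ _ => by
      simpa using pow_le_pow_of_le_one (ht' ℓ).1.le (ht' ℓ).2.le (hJ ℓ)
  have h2 : (∏ ℓ, t ℓ ^ linePower J ℓ) * G.coeffU root s J ≤ poly (G.coeffU root s) t :=
    Finset.single_le_sum (f := fun J => (∏ ℓ, t ℓ ^ linePower J ℓ) * G.coeffU root s J)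
      (fun J _ => mul_nonneg (Finset.prod_nonneg fun ℓ _ => pow_nonneg (ht' ℓ).1.le _)
        (G.coeffU_nonneg root s J)) (Finset.mem_univ J)
  rw [mul_comm]
  exact (mul_le_mul_of_nonneg_right h1 hc.le).trans h2

variable {G} in
theorem HU_pos (hG : G.IsConnected) (root : V) (s : ℝ) {t : L → ℝ} (ht : t ∈ cube L) :
    0 < G.HU root s t := by
  obtain ⟨c, hc, h⟩ := exists_lower_bound hG root s
  exact (mul_pos hc (Finset.prod_pos fun ℓ _ => (mem_cube.1 ht ℓ).1)).trans_le (h t ht)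

theorem form_nonneg (root : V) (s : ℝ) {t : L → ℝ} (ht : t ∈ cube L) :
    FormNonneg (G.form root s t) := by
  intro x
  rw [form_eq, Matrix.add_mulVec, dotProduct_add, form_skew (G.skew_transpose root s),
    form_diagonal, zero_add]
  refine Finset.sum_nonneg fun i _ => mul_nonneg ?_ (sq_nonneg _)
  rcases i with i | ((i | i) | i)
  · exact le_rfl
  · exact (one_div_pos.2 (mem_cube.1 ht i).1).le
  · exact (mem_cube.1 ht i).1.le
  · exact le_rfl

variable {G} in
theorem det_internal_ne_zero (hG : G.IsConnected) (root : V) (s : ℝ) {t : L → ℝ}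
    (ht : t ∈ cube L) : (G.form root s t).toBlocks₂₂.det ≠ 0 := by
  intro h
  have := HU_pos hG root s ht
  rw [HU_eq_det, h, zero_mul] at this
  exact lt_irrefl _ this

variable {G} in
theorem schur_nonneg (hG : G.IsConnected) (root : V) (s : ℝ) {t : L → ℝ} (ht : t ∈ cube L) :
    FormNonneg (schur (G.form root s t)) :=
  schur_form_nonneg (G.form_nonneg root s ht) (det_internal_ne_zero hG root s ht)

variable {G} in
theorem det_full_ne_zero (hG : G.IsConnected) (root : V) (s : ℝ) {t : L → ℝ} (ht : t ∈ cube L) :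
    (G.form root s t + Matrix.diagonal (Sum.elim (fun _ => 1) fun _ => 0)).det ≠ 0 := by
  have h := det_internal_ne_zero hG root s ht
  rw [det_full_eq_mul h]
  exact mul_ne_zero h (one_add_det_pos (schur_nonneg hG root s ht)).ne'

variable {G} in
theorem det_one_add_schur (hG : G.IsConnected) (root : V) (s : ℝ) {t : L → ℝ} (ht : t ∈ cube L) :
    (1 + schur (G.form root s t)).det = poly (G.coeffP root s) t / poly (G.coeffU root s) t := by
  have h := det_internal_ne_zero hG root s ht
  have ht0 := ne_zero_of_mem_cube ht
  have h1 : ∏ ℓ, t ℓ ≠ 0 := Finset.prod_ne_zero_iff.2 fun ℓ _ => ht0 ℓ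
  rw [← G.HU_eq root s ht0, HU_eq_det, ← G.det_form_add root s ht0, det_full_eq_mul h]
  field_simp

variable {G} in
-- The constant coefficient 1 is written as `P / P`, so that all the coefficients of the phase are
-- quotients with the same denominator.
theorem phaseCoeff_eq (hG : G.IsConnected) (root : V) (s : ℝ) {t : L → ℝ} (ht : t ∈ cube L) :
    phaseCoeff (1 + schur (G.form root s t))⁻¹ = fun k => ((poly (k.elim (G.coeffP root s)
      (G.coeffN root s)) t / poly (G.coeffP root s) t : ℝ) : ℂ) := by
  have h := det_internal_ne_zero hG root s ht
  have hf := det_full_ne_zero hG root s ht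
  have ht0 := ne_zero_of_mem_cube ht
  have h1 : ∏ ℓ, t ℓ ≠ 0 := Finset.prod_ne_zero_iff.2 fun ℓ _ => ht0 ℓ
  funext k
  rcases k with _ | ⟨i, j⟩
  · have : poly (G.coeffP root s) t ≠ 0 := by
      rw [← G.det_form_add root s ht0]
      exact mul_ne_zero hf h1
    simp only [phaseCoeff, Option.elim_none]
    rw [div_self this, Complex.ofReal_one]
  · simp only [phaseCoeff, Option.elim_some]
    rw [inv_one_add_schur h hf, ← G.det_form_add root s ht0,
      ← G.det_form_add_updateRow root s ht0, mul_div_mul_right _ _ h1]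

/-- The data of the parametric integral of a graph. -/
def parametricData {G : Phi4Graph V L} (hG : G.IsConnected) (root : V) (s : ℝ) {Ω : ℝ} (hΩ : 0 < Ω)
    (w : 𝓢(G.ExtSpace, ℂ)) :
    ParametricData L (extFamily hΩ w) (Finset (L ⊕ L)) where
  e := linePower
  cU := G.coeffU root s
  cP := G.coeffP root s
  cN k := k.elim (G.coeffP root s) (G.coeffN root s)
  e_le := linePower_le
  cU_nonneg := G.coeffU_nonneg root s
  cU_le := G.coeffU_le_coeffP root s
  cN_le k J := by
    rcases k with _ | ij
    · exact (abs_of_nonneg ((G.coeffU_nonneg root s J).trans (G.coeffU_le_coeffP root s J))).le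
    · exact G.abs_coeffN_le root s ij J
  low := G.exists_coeffU_ne_zero hG root s
  adm t ht := by
    have h := admissible_inv hΩ w (schur_nonneg hG root s (mem_cube.2 ht))
    rw [phaseCoeff_eq hG root s (mem_cube.2 ht)] at h
    exact h

/-- The scalar factor of the integrand. -/
def scalarFactor (root : V) (s : ℝ) (D : ℂ) (t : L → ℝ) : ℂ :=
  (∏ ℓ, ((1 - t ℓ ^ 2 : ℝ) : ℂ) ^ (D / 2 - 1)) / (G.HU root s t : ℂ) ^ (D / 2)

variable {G} in
theorem integrand_eq (hG : G.IsConnected) (root : V) (s Ω : ℝ) (D : ℂ) (x : G.ExtSpace)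
    {t : L → ℝ} (ht : t ∈ cube L) : G.integrand root s Ω D x t =
      G.scalarFactor root s D t * Complex.exp (-gaussExp Ω (schur (G.form root s t)) x) := by
  have hU : (G.HU root s t : ℂ) ≠ 0 := by exact_mod_cast (HU_pos hG root s ht).ne'
  rw [integrand, HV, G.schur_eq root s t (det_internal_ne_zero hG root s ht),
    mul_div_cancel_left₀ _ hU, scalarFactor, gaussExp]
  ring

/-! ### Integrability in the strip -/

theorem integrable_beta {x : ℝ} (h0 : 0 < x) (h2 : x < 2) :
    IntegrableOn (fun τ : ℝ => τ ^ (-(x / 2)) * (1 - τ) ^ (x / 2 - 1)) (Set.Ioo 0 1) := by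
  have h := Complex.betaIntegral_convergent (u := ((1 - x / 2 : ℝ) : ℂ)) (v := ((x / 2 : ℝ) : ℂ))
    (by rw [Complex.ofReal_re]; linarith) (by rw [Complex.ofReal_re]; linarith)
  rw [intervalIntegrable_iff_integrableOn_Ioo_of_le zero_le_one] at h
  refine IntegrableOn.congr_fun h.norm (fun τ hτ => ?_) measurableSet_Ioo
  have e1 : ((1 : ℂ) - τ) = ((1 - τ : ℝ) : ℂ) := by push_cast; rfl
  rw [norm_mul, e1, Complex.norm_cpow_eq_rpow_re_of_pos hτ.1,
    Complex.norm_cpow_eq_rpow_re_of_pos (sub_pos.2 hτ.2)]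
  congr 2
  · simp

/-- An integrable bound for the integrand. -/
def majorant (c x : ℝ) (t : L → ℝ) : ℝ :=
  c ^ (-(x / 2)) * ∏ ℓ, (t ℓ ^ (-(x / 2)) * (1 - t ℓ) ^ (x / 2 - 1))

theorem integrableOn_majorant (c : ℝ) {x : ℝ} (h0 : 0 < x) (h2 : x < 2) :
    IntegrableOn (majorant (L := L) c x) (cube L) := by
  have h : Integrable (fun t : L → ℝ => ∏ ℓ, (t ℓ ^ (-(x / 2)) * (1 - t ℓ) ^ (x / 2 - 1)))
      (Measure.pi fun _ : L => (volume : Measure ℝ).restrict (Set.Ioo 0 1)) :=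
    Integrable.fintype_prod fun _ => integrable_beta h0 h2
  rw [← Measure.restrict_pi_pi] at h
  exact h.const_mul _

variable {G} in
-- The condition `Re D > 0` turns the lower bound of `HU` into an upper bound of its inverse power,
-- and `Re D < 2` gives the same for `1 - t² ≥ 1 - t`. The majorant is a product of Beta integrands,
-- integrable at 0 for `Re D < 2` and at 1 for `Re D > 0`.
theorem norm_scalarFactor_le (hG : G.IsConnected) (root : V) (s : ℝ) : ∃ c : ℝ, 0 < c ∧
    ∀ D : ℂ, D ∈ strip → ∀ t ∈ cube L, ‖G.scalarFactor root s D t‖ ≤ majorant c D.re t := by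
  obtain ⟨c, hc, hle⟩ := exists_lower_bound hG root s
  refine ⟨c, hc, fun D hD t ht => ?_⟩
  have ht' := mem_cube.1 ht
  have hU := HU_pos hG root s ht
  have hp : 0 < ∏ ℓ, t ℓ := Finset.prod_pos fun ℓ _ => (ht' ℓ).1
  have hre : (D / 2).re = D.re / 2 := by simp
  have hre' : (D / 2 - 1).re = D.re / 2 - 1 := by simp
  have h1 : ‖∏ ℓ, ((1 - t ℓ ^ 2 : ℝ) : ℂ) ^ (D / 2 - 1)‖ ≤ ∏ ℓ, (1 - t ℓ) ^ (D.re / 2 - 1) := by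
    rw [norm_prod]
    refine Finset.prod_le_prod (fun _ _ => norm_nonneg _) fun ℓ _ => ?_
    have h3 := (ht' ℓ).1
    have h4 := (ht' ℓ).2
    rw [Complex.norm_cpow_eq_rpow_re_of_pos (by nlinarith), hre']
    exact Real.rpow_le_rpow_of_nonpos (by linarith) (by nlinarith) (by linarith [hD.2])
  have h2 : ‖(G.HU root s t : ℂ) ^ (D / 2)‖⁻¹ ≤ (c * ∏ ℓ, t ℓ) ^ (-(D.re / 2)) := by
    rw [Complex.norm_cpow_eq_rpow_re_of_pos hU, hre, ← Real.rpow_neg hU.le]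
    exact Real.rpow_le_rpow_of_nonpos (mul_pos hc hp) (hle t ht) (by linarith [hD.1])
  rw [scalarFactor, norm_div, div_eq_mul_inv]
  calc _ ≤ (∏ ℓ, (1 - t ℓ) ^ (D.re / 2 - 1)) * (c * ∏ ℓ, t ℓ) ^ (-(D.re / 2)) :=
        mul_le_mul h1 h2 (inv_nonneg.2 (norm_nonneg _))
          (Finset.prod_nonneg fun ℓ _ => Real.rpow_nonneg (by linarith [(ht' ℓ).2]) _)
    _ = majorant c D.re t := by
        rw [Real.mul_rpow hc.le hp.le, ← Real.finsetProd_rpow _ _ fun ℓ _ => (ht' ℓ).1.le,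
          majorant, Finset.prod_mul_distrib]
        ring

theorem continuousOn_form (root : V) (s : ℝ) : ContinuousOn (G.form root s) (cube L) := by
  rw [continuousOn_iff_continuous_domRestrict]
  refine continuous_matrix fun i j => ?_
  have h : (fun t : cube L => G.form root s t.1 i j) = fun t : cube L =>
      G.skew root s i j + Matrix.diagonal (Sum.elim (fun _ => 0) (propDiag root t.1)) i j := by
    funext t
    rw [form_eq]
    rfl
  change Continuous fun t : cube L => G.form root s t.1 i j
  rw [h]
  refine continuous_const.add ?_
  by_cases hij : i = j
  · subst hij
    simp only [Matrix.diagonal_apply_eq]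
    have hc : ∀ ℓ, Continuous fun t : cube L => t.1 ℓ := fun ℓ =>
      (continuous_apply ℓ).comp continuous_subtype_val
    rcases i with i | ((i | i) | i)
    · exact continuous_const
    · exact continuous_const.div (hc i) fun t => ne_zero_of_mem_cube t.2 i
    · exact hc i
    · exact continuous_const
  · simp only [Matrix.diagonal_apply_ne _ hij]
    exact continuous_const

variable {G} in
theorem continuousOn_schur (hG : G.IsConnected) (root : V) (s : ℝ) (i j : G.ExtVar) :
    ContinuousOn (fun t => schur (G.form root s t) i j) (cube L) := by
  have h := G.continuousOn_form root s
  rw [continuousOn_iff_continuous_domRestrict] at h ⊢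
  have h11 : Continuous fun t : cube L => (G.form root s t).toBlocks₁₁ :=
    h.matrix_submatrix Sum.inl Sum.inl
  have h12 : Continuous fun t : cube L => (G.form root s t).toBlocks₁₂ :=
    h.matrix_submatrix Sum.inl Sum.inr
  have h21 : Continuous fun t : cube L => (G.form root s t).toBlocks₂₁ :=
    h.matrix_submatrix Sum.inr Sum.inl
  have h22 : Continuous fun t : cube L => (G.form root s t).toBlocks₂₂ :=
    h.matrix_submatrix Sum.inr Sum.inr
  have hinv : Continuous fun t : cube L => ((G.form root s t).toBlocks₂₂)⁻¹ := by
    simp_rw [Matrix.inv_def, Ring.inverse_eq_inv']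
    exact (h22.matrix_det.inv₀ fun t => det_internal_ne_zero hG root s t.2).smul
      h22.matrix_adjugate
  have : Continuous fun t : cube L => schur (G.form root s t) :=
    h11.sub ((h12.matrix_mul hinv).matrix_mul h21)
  exact this.matrix_elem i j

theorem gaussExp_eq_sum {m : Type*} [Fintype m] [DecidableEq m] (Ω : ℝ) (Z : Matrix m m ℝ)
    (x : EuclideanSpace ℝ (m × Fin 4)) : gaussExp Ω Z x = Ω * ∑ ij : m × m, (Z ij.1 ij.2 : ℂ) *
      ∑ k, ∑ l, (x (ij.1, k) : ℂ) * ePlus k l * (x (ij.2, l) : ℂ) := by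
  rw [gaussExp, form_tw]; ring

variable {G} in
theorem continuousOn_scalarFactor (hG : G.IsConnected) (root : V) (s : ℝ) (D : ℂ) :
    ContinuousOn (G.scalarFactor root s D) (cube L) := by
  have hHU : ContinuousOn (G.HU root s) (cube L) := by
    have : Continuous (poly (G.coeffU root s)) := by unfold poly; fun_prop
    exact this.continuousOn.congr fun t ht => G.HU_eq root s (ne_zero_of_mem_cube ht)
  refine ContinuousOn.div ?_ ?_ fun t ht => ?_
  · refine continuousOn_finsetProd _ fun ℓ _ => ContinuousOn.cpow ?_ continuousOn_const fun t ht => ?_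
    · exact Continuous.continuousOn (by fun_prop)
    · have := mem_cube.1 ht ℓ
      exact Complex.ofReal_mem_slitPlane.2 (by nlinarith [this.1, this.2])
  · exact ContinuousOn.cpow (Complex.continuous_ofReal.comp_continuousOn hHU) continuousOn_const
      fun t ht => Complex.ofReal_mem_slitPlane.2 (HU_pos hG root s ht)
  · rw [Ne, Complex.cpow_eq_zero_iff]
    have : (G.HU root s t : ℂ) ≠ 0 := by exact_mod_cast (HU_pos hG root s ht).ne'
    tauto

variable {G} in
theorem continuousOn_integrand (hG : G.IsConnected) (root : V) (s Ω : ℝ) (D : ℂ) :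
    ContinuousOn (fun p : G.ExtSpace × (L → ℝ) => G.integrand root s Ω D p.1 p.2)
      (Set.univ ×ˢ cube L) := by
  have hmaps : Set.MapsTo Prod.snd ((Set.univ : Set G.ExtSpace) ×ˢ cube L) (cube L) :=
    fun p hp => hp.2
  have h : ContinuousOn (fun p : G.ExtSpace × (L → ℝ) => G.scalarFactor root s D p.2 *
      Complex.exp (-(Ω * ∑ ij : G.ExtVar × G.ExtVar, (schur (G.form root s p.2) ij.1 ij.2 : ℂ) *
        ∑ k, ∑ l, (p.1 (ij.1, k) : ℂ) * ePlus k l * (p.1 (ij.2, l) : ℂ))))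
      (Set.univ ×ˢ cube L) := by
    refine ((continuousOn_scalarFactor hG root s D).comp continuousOn_snd hmaps).mul
      (ContinuousOn.cexp (ContinuousOn.neg (continuousOn_const.mul
        (continuousOn_finsetSum _ fun ij _ => ContinuousOn.mul ?_ ?_))))
    · exact Complex.continuous_ofReal.comp_continuousOn
        ((continuousOn_schur hG root s ij.1 ij.2).comp continuousOn_snd hmaps)
    · exact Continuous.continuousOn (by fun_prop)
  refine h.congr fun p hp => ?_
  rw [integrand_eq hG root s Ω D p.1 hp.2, gaussExp_eq_sum]

variable {G} in
theorem norm_integrand_le (hG : G.IsConnected) (root : V) (s : ℝ) {Ω : ℝ} (hΩ : 0 < Ω) (D : ℂ)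
    (x : G.ExtSpace) {t : L → ℝ} (ht : t ∈ cube L) :
    ‖G.integrand root s Ω D x t‖ ≤ ‖G.scalarFactor root s D t‖ := by
  rw [integrand_eq hG root s Ω D x ht, norm_mul]
  exact mul_le_of_le_one_right (norm_nonneg _)
    (norm_exp_gaussExp_le hΩ (schur_nonneg hG root s ht) x)

variable {G} in
theorem integrableOn_integrand (hG : G.IsConnected) (root : V) (s : ℝ) {Ω : ℝ} (hΩ : 0 < Ω) {D : ℂ}
    (hD : D ∈ strip) (x : G.ExtSpace) : IntegrableOn (G.integrand root s Ω D x) (cube L) := by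
  obtain ⟨c, -, hc⟩ := norm_scalarFactor_le hG root s
  refine Integrable.mono' (integrableOn_majorant c hD.1 hD.2) ?_ ?_
  · refine ContinuousOn.aestronglyMeasurable ?_ measurableSet_cube
    exact (continuousOn_integrand hG root s Ω D).comp (f := fun t => (x, t)) (by fun_prop)
      fun t ht => ⟨Set.mem_univ _, ht⟩
  · filter_upwards [ae_restrict_mem measurableSet_cube] with t ht
    exact (norm_integrand_le hG root s hΩ D x ht).trans (hc D hD t ht)

variable {G} in
-- The exponential has modulus at most 1, so a product of a function of `x` and one of `t`
-- dominates. This permits the exchange of the two integrations.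
theorem integrable_mul_integrand (hG : G.IsConnected) (root : V) (s : ℝ) {Ω : ℝ} (hΩ : 0 < Ω) {D : ℂ}
    (hD : D ∈ strip) (f : 𝓢(G.ExtSpace, ℂ)) :
    Integrable (fun p : G.ExtSpace × (L → ℝ) => f p.1 * G.integrand root s Ω D p.1 p.2)
      ((volume : Measure G.ExtSpace).prod ((volume : Measure (L → ℝ)).restrict (cube L))) := by
  obtain ⟨c, -, hc⟩ := norm_scalarFactor_le hG root s
  have hprod : (volume : Measure G.ExtSpace).prod ((volume : Measure (L → ℝ)).restrict (cube L)) =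
      ((volume : Measure G.ExtSpace).prod (volume : Measure (L → ℝ))).restrict
        (Set.univ ×ˢ cube L) := by
    rw [← Measure.prod_restrict, Measure.restrict_univ]
  have hmeas : MeasurableSet ((Set.univ : Set G.ExtSpace) ×ˢ cube L) :=
    MeasurableSet.univ.prod measurableSet_cube
  have hb : Integrable (fun p : G.ExtSpace × (L → ℝ) => ‖f p.1‖ * majorant c D.re p.2)
      ((volume : Measure G.ExtSpace).prod ((volume : Measure (L → ℝ)).restrict (cube L))) :=
    f.integrable.norm.mul_prod (integrableOn_majorant c hD.1 hD.2)
  refine Integrable.mono' hb ?_ ?_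
  · rw [hprod]
    refine ContinuousOn.aestronglyMeasurable ?_ hmeas
    exact (f.continuous.comp continuous_fst).continuousOn.mul
      (continuousOn_integrand hG root s Ω D)
  · rw [hprod]
    filter_upwards [ae_restrict_mem hmeas] with p hp
    rw [norm_mul]
    exact mul_le_mul_of_nonneg_left
      ((norm_integrand_le hG root s hΩ D p.1 hp.2).trans (hc D hD p.2 hp.2)) (norm_nonneg _)

end Phi4Graph

/-! ### The distribution and its poles -/

namespace Phi4Graph

open RowMinor Twisted SectorIntegral SchwartzMap

variable {V L : Type*} [Fintype V] [DecidableEq V] [Fintype L] [DecidableEq L]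
  {G : Phi4Graph V L}

/-- Integrating the integrand against a test function gives the parametric integrand. -/
theorem integral_mul_integrand (hG : G.IsConnected) (root : V) (s : ℝ) {Ω : ℝ} (hΩ : 0 < Ω)
    (w f : 𝓢(G.ExtSpace, ℂ)) (D : ℂ) {t : L → ℝ} (ht : t ∈ cube L) :
    (∫ y, ((Real.exp (-(Ω / 2) * ‖y‖ ^ 2) : ℝ) : ℂ) * w y) *
      ∫ x, f x * G.integrand root s Ω D x t =
      gaussConst G.ExtVar Ω * (parametricData hG root s hΩ w).integrand D f t := by
  have ht0 := ne_zero_of_mem_cube ht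
  have h1 : ∫ x, f x * G.integrand root s Ω D x t = G.scalarFactor root s D t *
      ∫ x, f x * Complex.exp (-gaussExp Ω (schur (G.form root s t)) x) := by
    rw [← integral_const_mul]
    refine integral_congr_ae (Filter.Eventually.of_forall fun x => ?_)
    change f x * G.integrand root s Ω D x t = _
    rw [integrand_eq hG root s Ω D x ht]
    ring
  rw [h1, mul_left_comm, integral_mul_gaussian hΩ w (schur_nonneg hG root s ht),
    det_one_add_schur hG root s ht, phaseCoeff_eq hG root s ht, scalarFactor, G.HU_eq root s ht0]
  change _ = gaussConst G.ExtVar Ω * (((∏ ℓ, ((1 - t ℓ ^ 2 : ℝ) : ℂ) ^ (D / 2 - 1)) /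
    (poly (G.coeffU root s) t : ℂ) ^ (D / 2) *
    ((poly (G.coeffU root s) t / poly (G.coeffP root s) t : ℝ) : ℂ) ^ 2) *
    (extFamily hΩ w).avg [] (fun k => ((poly (k.elim (G.coeffP root s)
      (G.coeffN root s)) t / poly (G.coeffP root s) t : ℝ) : ℂ)) f)
  push_cast
  rw [div_eq_mul_inv (gaussConst G.ExtVar Ω), ← inv_pow, inv_div]
  ring

/-- The amplitude as a family of distributions. -/
theorem exists_distribution (hG : G.IsConnected) (root : V) (s : ℝ) {Ω : ℝ} (hΩ : 0 < Ω) :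
    ∃ T : ℂ → 𝓢(G.ExtSpace, ℂ) →L[ℂ] ℂ,
      (∀ D ∈ strip, ∀ f : 𝓢(G.ExtSpace, ℂ),
        T D f = ∫ x, f x * ∫ t in cube L, G.integrand root s Ω D x t) ∧
      ∀ f, (∀ D, MeromorphicAt (fun D => T D f) D) ∧
        ∀ D, (D ∈ strip ∨ ¬ ∃ k : ℤ, (modulus L : ℂ) * D = k) →
          AnalyticAt ℂ (fun D => T D f) D := by
  obtain ⟨w, hw⟩ := exists_window (m := G.ExtVar) (Ω := Ω)
  set c := ∫ y : G.ExtSpace, ((Real.exp (-(Ω / 2) * ‖y‖ ^ 2) : ℝ) : ℂ) * w y with hc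
  have hg := gaussConst_ne_zero (m := G.ExtVar) hΩ
  set g := gaussConst G.ExtVar Ω with hgdef
  set d := parametricData hG root s hΩ w with hd
  have key : ∀ (D : ℂ) (f : 𝓢(G.ExtSpace, ℂ)), ∀ t ∈ cube L,
      ∫ x, f x * G.integrand root s Ω D x t = c⁻¹ * g * d.integrand D f t := by
    intro D f t ht
    rw [mul_assoc, ← integral_mul_integrand hG root s hΩ w f D ht, inv_mul_cancel_left₀ hw]
  -- Integrability of the parametric integrand is not estimated anew: up to nonzero constants the
  -- integrand is the partial integral over `x` of a jointly integrable function.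
  obtain ⟨T, hT, hT'⟩ := d.exists_family fun D hD f => by
    have h : IntegrableOn (fun t => ∫ x, f x * G.integrand root s Ω D x t) (cube L) :=
      (integrable_mul_integrand hG root s hΩ hD f).integral_prod_right
    refine IntegrableOn.congr_fun (h.const_mul (g⁻¹ * c)) (fun t ht => ?_) measurableSet_cube
    change g⁻¹ * c * ∫ x, f x * G.integrand root s Ω D x t = _
    rw [key D f t ht]
    field_simp
  refine ⟨fun D => (c⁻¹ * g) • T D, fun D hD f => ?_, fun f => ⟨fun D => ?_, fun D hD => ?_⟩⟩
  · change c⁻¹ * g * T D f = _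
    rw [hT D hD, ParametricData.val, ← integral_const_mul]
    change ∫ t in cube L, c⁻¹ * g * d.integrand D f t = _
    rw [← setIntegral_congr_fun measurableSet_cube fun t ht => key D f t ht,
      ← integral_integral_swap (integrable_mul_integrand hG root s hΩ hD f)]
    simp_rw [integral_const_mul]
  · exact (MeromorphicAt.const (c⁻¹ * g) D).mul ((hT' f).1 D)
  · exact analyticAt_const.mul ((hT' f).2 D hD)

theorem integrable_mul_amplitude (hG : G.IsConnected) (root : V) (s : ℝ) {Ω : ℝ} (hΩ : 0 < Ω)
    (K : ℂ → ℂ) {D : ℂ} (hD : D ∈ strip) (f : 𝓢(G.ExtSpace, ℂ)) :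
    Integrable fun x => f x * G.amplitude root s Ω K D x := by
  refine ((integrable_mul_integrand hG root s hΩ hD f).integral_prod_left.const_mul
    (K D)).congr (Filter.Eventually.of_forall fun x => ?_)
  change K D * ∫ t in cube L, f x * G.integrand root s Ω D x t = _
  rw [integral_const_mul]
  exact mul_left_comm _ _ _

variable (L) in
/-- The possible poles: the multiples of the inverse of the modulus, outside of the strip. -/
def poles : Set ℚ := {q | (∃ k : ℤ, (modulus L : ℚ) * q = k) ∧ ¬ (0 < q ∧ q < 2)}

variable (L) in
theorem finite_poles (R : ℝ) : {q : ℚ | q ∈ poles L ∧ |(q : ℝ)| ≤ R}.Finite := by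
  have hN : (0 : ℝ) < modulus L := by exact_mod_cast Nat.pos_of_ne_zero (modulus_ne_zero L)
  refine ((Set.finite_Icc (-⌈modulus L * R⌉) ⌈modulus L * R⌉).image
    fun k : ℤ => (k : ℚ) / modulus L).subset ?_
  rintro q ⟨⟨⟨k, hk⟩, -⟩, hq⟩
  refine ⟨k, ?_, ?_⟩
  · have h : |(k : ℝ)| ≤ modulus L * R := by
      have : ((k : ℝ)) = modulus L * q := by exact_mod_cast hk.symm
      rw [this, abs_mul, abs_of_pos hN]
      exact mul_le_mul_of_nonneg_left hq hN.le
    have h' := (abs_le.1 (h.trans (Int.le_ceil _)))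
    exact ⟨by exact_mod_cast h'.1, by exact_mod_cast h'.2⟩
  · have : (modulus L : ℚ) ≠ 0 := by exact_mod_cast modulus_ne_zero L
    change (k : ℚ) / modulus L = q
    rw [← hk, mul_div_cancel_left₀ _ this]

/-- A point of `ℤ / N` is rational; if it is not in the listed set, it lies between 0 and 2, where
the convergent integral already gives analyticity. -/
theorem mem_strip_or_not_pole {D : ℂ} (hD : ∀ q ∈ poles L, D ≠ (q : ℂ)) :
    D ∈ strip ∨ ¬ ∃ k : ℤ, (modulus L : ℂ) * D = k := by
  by_contra! h
  obtain ⟨hs, k, hk⟩ := h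
  have hN : (modulus L : ℂ) ≠ 0 := by exact_mod_cast modulus_ne_zero L
  have hN' : (modulus L : ℚ) ≠ 0 := by exact_mod_cast modulus_ne_zero L
  have hq : D = (((k : ℚ) / modulus L : ℚ) : ℂ) := by
    rw [eq_comm]
    push_cast
    rw [← hk, mul_div_cancel_left₀ _ hN]
  refine hD _ ⟨⟨k, mul_div_cancel₀ _ hN'⟩, fun h => hs ?_⟩ hq
  rw [hq]
  refine ⟨?_, ?_⟩
  · rw [Complex.ratCast_re]
    exact_mod_cast h.1
  · rw [Complex.ratCast_re]
    exact_mod_cast h.2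

end Phi4Graph

end

theorem mainTheorem12 {V L : Type*} [Fintype V] [DecidableEq V] [Fintype L] [DecidableEq L]
    (G : Phi4Graph V L) (hG : G.IsConnected) :
    ∃ S : Set ℚ, (∀ R : ℝ, {q : ℚ | q ∈ S ∧ |(q : ℝ)| ≤ R}.Finite) ∧
      (∀ q ∈ S, ¬ (0 < q ∧ q < 2)) ∧
      ∀ (root : V) (s Ω : ℝ), 0 < s → 0 < Ω → ∀ K : ℂ → ℂ, Differentiable ℂ K →
        ∃ T : ℂ → TemperedDistribution G.ExtSpace ℂ,
          (∀ D : ℂ, 0 < D.re → D.re < 2 →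
            (∀ x : G.ExtSpace, MeasureTheory.IntegrableOn (G.integrand root s Ω D x)
              (Phi4Graph.cube L)) ∧
            ∀ f : SchwartzMap G.ExtSpace ℂ,
              MeasureTheory.Integrable (fun x => f x * G.amplitude root s Ω K D x) ∧
              T D f = ∫ x, f x * G.amplitude root s Ω K D x) ∧
          ∀ f : SchwartzMap G.ExtSpace ℂ,
            (∀ D : ℂ, MeromorphicAt (fun D => T D f) D) ∧
            ∀ D : ℂ, (∀ q ∈ S, D ≠ (q : ℂ)) → AnalyticAt ℂ (fun D => T D f) D := by
  refine ⟨Phi4Graph.poles L, Phi4Graph.finite_poles L, fun q hq => hq.2,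
    fun root s Ω _ hΩ K hK => ?_⟩
  obtain ⟨T, hT, hT'⟩ := Phi4Graph.exists_distribution hG root s hΩ
  have hKa : ∀ D, AnalyticAt ℂ K D := fun D => hK.analyticAt D
  -- The family constructed without normalization is multiplied by the entire function `K`, which
  -- adds no pole. Tempered distributions carry the topology of pointwise convergence, hence the
  -- coercion.
  refine ⟨fun D => ContinuousLinearMap.toPointwiseConvergenceCLM _ _ _ _ (K D • T D),
    fun D h0 h2 => ⟨Phi4Graph.integrableOn_integrand hG root s hΩ ⟨h0, h2⟩, fun f =>
      ⟨Phi4Graph.integrable_mul_amplitude hG root s hΩ K ⟨h0, h2⟩ f, ?_⟩⟩,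
    fun f => ⟨fun D => (hKa D).meromorphicAt.mul ((hT' f).1 D), fun D hD =>
      (hKa D).mul ((hT' f).2 D (Phi4Graph.mem_strip_or_not_pole hD))⟩⟩
  change K D * T D f = _
  rw [hT D ⟨h0, h2⟩, ← MeasureTheory.integral_const_mul]
  refine MeasureTheory.integral_congr_ae (Filter.Eventually.of_forall fun x => ?_)
  exact mul_left_comm _ _ _
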